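/- **Setting.** Let $d\ge 1$, $p\ge 0$ be integers, $\mathbf t\in[-1/2,1/2]^d$, and let $\{Z(\mathbf s):\mathbf s\in \mathbf t+\mathbb Z^d\}$ be a strictly stationary random field with values in $\mathbb R^p$, with mean $\mu=\mathrm E Z(\mathbf t)$. Let $H:\mathbb R^p\to\mathbb R$. Write $\|\cdot\|$ for the Euclidean norm, $\nabla$ for the gradient of $H$ at $\mu$, and $\mathrm{dis}(E_1,E_2)$ for the $\ell^\infty$ distance of two sets. *Regions.* Let $R_0\subset(-1/2,1/2]^d$ be a Borel set containing a neighbourhood of the origin such that for every sequence of positive reals $a_n\to0$ the number of cubes $a_n(\mathbf k+[0,1]^d)$, $\mathbf k\in\mathbb Z^d$, that intersect both $\overline{R_0}$ and $\overline{R_0^c}$ is $O(a_n^{-(d-1)})$ (boundary condition). Let $\Delta_n$ and ${}_s\Delta_n$ be $d\times d$ diagonal matrices with positive diagonal entries $\lambda_i^{(n)}\to\infty$ and ${}_s\lambda_i^{(n)}\to\infty$, with ${}_s\lambda_i^{(n)}/\lambda_i^{(n)}\to0$, $i=1,\dots,d$. Put $R_n=\Delta_nR_0$. For a bounded $A\subset\mathbb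 R^d$ let $N(A)$ be the number of points of $\mathbf t+\mathbb Z^d$ in $A$, let $\bar Z(A)$ be the average of $Z$ over these points, and let $\hat\theta(A)=H(\bar Z(A))$. Put $N_n=N(R_n)$, $\hat\theta_n=\hat\theta(R_n)$ and $\tau_n^2=N_n\mathrm{Var}(\hat\theta_n)$. *Estimators.* Let $J_{\mathrm{OL}}=\{\mathbf i\in\mathbb Z^d:\mathbf i+{}_s\Delta_nR_0\subset R_n\}$ and $R_{\mathbf i,n}=\mathbf i+{}_s\Delta_nR_0$; let $J_{\mathrm{NOL}}=\{\mathbf i\in\mathbb Z^d:{}_s\Delta_n(\mathbf i+(-1/2,1/2]^d)\subset R_n\}$ and $\tilde R_{\mathbf i,n}={}_s\Delta_n(\mathbf i+R_0)$. The overlapping and nonoverlapping subsample variance estimators are $$\hat\tau^2_{n,\mathrm{OL}}=\frac1{|J_{\mathrm{OL}}|}\sum_{\mathbf i\in J_{\mathrm{OL}}}N({}_s\Delta_nR_0)\Big(\hat\theta(R_{\mathbf i,n})-\frac1{|J_{\mathrm{OL}}|}\sum_{\mathbf j\in J_{\mathrm{OL}}}\hat\theta(R_{\mathbf j,n})\Big)^2,$$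 $$\hat\tau^2_{n,\mathrm{NOL}}=\frac1{|J_{\mathrm{NOL}}|}\sum_{\mathbf i\in J_{\mathrm{NOL}}}N(\tilde R_{\mathbf i,n})\Big(\hat\theta(\tilde R_{\mathbf i,n})-\frac1{|J_{\mathrm{NOL}}|}\sum_{\mathbf j\in J_{\mathrm{NOL}}}\hat\theta(\tilde R_{\mathbf j,n})\Big)^2.$$ (Averages over an empty set, which can occur only for finitely many $n$, are set to $0$.) *Mixing.* For sets of sites $T_1,T_2\subset\mathbf t+\mathbb Z^d$ let $\tilde\alpha(T_1,T_2)=\sup|P(A\cap B)-P(A)P(B)|$ over $A\in\sigma\langle Z(\mathbf s):\mathbf s\in T_1\rangle$, $B\in\sigma\langle Z(\mathbf s):\mathbf s\in T_2\rangle$, and let $\alpha(k,l)=\sup\{\tilde\alpha(T_1,T_2):|T_1|,|T_2|\le l,\ \mathrm{dis}(T_1,T_2)\ge k\}$. **Assumptions.** - A.1. There is a diagonal matrix $\Delta_0$ with $\det\Delta_0>0$ and ${}_s\Delta_n/{}_s\lambda_1^{(n)}\to\Delta_0$. - A.2. $\sum_{i=1}^d\frac1{{}_s\lambda_i^{(n)}}+\sum_{i=1}^d\frac{{}_s\lambda_i^{(n)}}{\lambda_i^{(n)}}+\frac{[\det({}_s\Delta_n)]^{(d+1)/d}}{\det(\Delta_n)}=o(1)$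 and $\max_i\lambda_i^{(n)}=O(\min_i\lambda_i^{(n)})$. - A.3. There are nonnegative functions $\alpha_1,g$ with $\alpha_1(k)\to0$ as $k\to\infty$, $g(l)\to\infty$ as $l\to\infty$ and $\alpha(k,l)\le\alpha_1(k)g(l)$ for all real $k,l>0$. - A.4. $\sup\{\tilde\alpha(T_1,T_2):|T_1|=1,\ \mathrm{dis}(T_1,T_2)\ge k\}=o(k^{-d})$ as $k\to\infty$ ($T_2$ may be infinite). - A.5. $\tau^2=\sum_{\mathbf k\in\mathbb Z^d}\sigma(\mathbf k)>0$, where $\sigma(\mathbf k)=\mathrm{Cov}(\nabla'Z(\mathbf t),\nabla'Z(\mathbf t+\mathbf k))$. For an integer $r\ge1$ and an integer $a\ge 0$: - Condition $D_r$ (with exponent $a$). $H$ is $r$ times continuously differentiable and, for some $C>0$, every partial derivative of order $r$ satisfies $|D^\nu H(x)|\le C(1+\|x\|^a)$ for all $x\in\mathbb R^p$. - Condition $M_r$. For some $0<\delta\le1$, $0<\kappa<(2r-1-1/d)(2r+\delta)/\delta$ and $C>0$: $\mathrm E\|Z(\mathbf t)\|^{2r+\delta}<\infty$, $\sum_{m=1}^\infty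 m^{(2r-1)d-1}\alpha_1(m)^{\delta/(2r+\delta)}<\infty$, and $g(x)\le Cx^\kappa$ for all $x\ge1$, with $\alpha_1,g$ from A.3. **Lemma.** Suppose that A.1–A.5 hold, and that either $d\ge2$ and, for some integer $a\ge0$, Conditions $D_2$ (with exponent $a$) and $M_{2+a}$ hold, or $d=1$ and, for some integer $a\ge0$, Conditions $D_3$ (with exponent $a$) and $M_{3+a}$ hold. Then $\hat\theta_n$ has a finite second moment, $\hat\tau^2_{n,\mathrm{OL}}$ and $\hat\tau^2_{n,\mathrm{NOL}}$ have finite expectations for every $n$, and, as $n\to\infty$, $$\mathrm E(\hat\tau^2_{n,\mathrm{OL}})=\tau_n^2+O(1/{}_s\lambda_1^{(n)})\quad\text{and}\quad \mathrm E(\hat\tau^2_{n,\mathrm{NOL}})=\tau_n^2+O(1/{}_s\lambda_1^{(n)}).$$ -/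

import Mathlib

open MeasureTheory ProbabilityTheory Filter Asymptotics
open scoped Topology

namespace SpatialSubsampling

noncomputable section

/- Points of the sampling space `ℝ^d` are `Fin d → ℝ`; values of the field live in
`EuclideanSpace ℝ (Fin p)`, so that `‖·‖` is the Euclidean norm there. A diagonal `d × d` matrix
is given by its vector of diagonal entries, and its determinant is the product of the entries. -/

/-! ### Sampling regions -/

/-- The image `Δ A` of `A ⊆ ℝ^d` under the diagonal matrix with diagonal entries `l`. -/
def scaleSet {d : ℕ} (l : Fin d → ℝ) (A : Set (Fin d → ℝ)) : Set (Fin d → ℝ) :=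
  (fun x i => l i * x i) '' A

/-- The translate `i + A` of `A ⊆ ℝ^d` by an integer vector. -/
def shiftSet {d : ℕ} (i : Fin d → ℤ) (A : Set (Fin d → ℝ)) : Set (Fin d → ℝ) :=
  (fun x j => (i j : ℝ) + x j) '' A

/-- The cube `(-1/2, 1/2]^d`. -/
def unitCube (d : ℕ) : Set (Fin d → ℝ) :=
  {x | ∀ i, -(1 / 2) < x i ∧ x i ≤ 1 / 2}

/-- The cube `a (k + [0, 1]^d)` of the scaled lattice `a ℤ^d`. -/
def latticeCube {d : ℕ} (a : ℝ) (k : Fin d → ℤ) : Set (Fin d → ℝ) :=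
  {x | ∀ i, a * k i ≤ x i ∧ x i ≤ a * (k i + 1)}

/-- The number of cubes of the scaled lattice `a ℤ^d` that intersect both the closure of `A` and
the closure of the complement of `A`. -/
def boundaryCubeCount {d : ℕ} (A : Set (Fin d → ℝ)) (a : ℝ) : ℕ :=
  {k : Fin d → ℤ | (latticeCube a k ∩ closure A).Nonempty ∧
    (latticeCube a k ∩ closure Aᶜ).Nonempty}.ncard

/-- The requirements on the template set `R₀`, including the boundary condition. -/
structure IsTemplate {d : ℕ} (R₀ : Set (Fin d → ℝ)) : Prop where
  borel : MeasurableSet R₀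
  subset_unitCube : R₀ ⊆ unitCube d
  nhds_origin : R₀ ∈ 𝓝 (0 : Fin d → ℝ)
  boundary : ∀ a : ℕ → ℝ, (∀ n, 0 < a n) → Tendsto a atTop (𝓝 0) →
    (fun n => (boundaryCubeCount R₀ (a n) : ℝ)) =O[atTop] fun n => (a n)⁻¹ ^ ((d : ℝ) - 1)

/-- The standing requirements on the diagonal entries `lam n i` of the scaling matrix of the
sampling region and `slam n i` of the scaling matrix of the subsamples. -/
structure IsScaling {d : ℕ} (lam slam : ℕ → Fin d → ℝ) : Prop where
  lam_pos : ∀ n i, 0 < lam n i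
  slam_pos : ∀ n i, 0 < slam n i
  lam_tendsto : ∀ i, Tendsto (fun n => lam n i) atTop atTop
  slam_tendsto : ∀ i, Tendsto (fun n => slam n i) atTop atTop
  ratio_tendsto : ∀ i, Tendsto (fun n => slam n i / lam n i) atTop (𝓝 0)

/-! ### The statistic and the two subsample variance estimators

The field is observed on the translated lattice `t + ℤ^d`. The observation at the site `t + k` is
written `Z k`, `k : Fin d → ℤ`. -/

/-- The sites of the lattice `t + ℤ^d` that lie in `A`, indexed by their integer part `k`. -/
def sites {d : ℕ} (t : Fin d → ℝ) (A : Set (Fin d → ℝ)) : Set (Fin d → ℤ) :=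
  {k | (fun i => t i + (k i : ℝ)) ∈ A}

/-- The number of sites in `A`. -/
def siteCount {d : ℕ} (t : Fin d → ℝ) (A : Set (Fin d → ℝ)) : ℕ :=
  (sites t A).ncard

/-- The average of `f` over a finite index set `J`. -/
def finAverage {ι E : Type*} [AddCommGroup E] [Module ℝ E] (J : Set ι) (f : ι → E) : E :=
  (J.ncard : ℝ)⁻¹ • ∑ᶠ i ∈ J, f i

section Estimators

variable {d p : ℕ} {Ω : Type*} (t : Fin d → ℝ) (Z : (Fin d → ℤ) → Ω → EuclideanSpace ℝ (Fin p))
  (H : EuclideanSpace ℝ (Fin p) → ℝ) (R₀ : Set (Fin d → ℝ))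

/-- The statistic computed from the region `A`: `H` at the sample mean of the observations at
the sites in `A`. -/
def thetaHat (A : Set (Fin d → ℝ)) (ω : Ω) : ℝ :=
  H (finAverage (sites t A) fun k => Z k ω)

/-- `τ_n² = N_n Var(θ̂_n)` when `l` is the diagonal of `Δ_n`. -/
def tauSqN [MeasurableSpace Ω] (P : Measure Ω) (l : Fin d → ℝ) : ℝ :=
  (siteCount t (scaleSet l R₀) : ℝ) * variance (thetaHat t Z H (scaleSet l R₀)) P

/-- Integer translates of the subsampling region `ₛΔ R₀` that lie inside `Δ R₀`; `l` and `s` are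
the diagonals of `Δ` and `ₛΔ`. -/
def JOL (l s : Fin d → ℝ) : Set (Fin d → ℤ) :=
  {i | shiftSet i (scaleSet s R₀) ⊆ scaleSet l R₀}

/-- The overlapping (OL) subsample variance estimator. -/
def tauHatOL (l s : Fin d → ℝ) (ω : Ω) : ℝ :=
  finAverage (JOL R₀ l s) fun i =>
    (siteCount t (scaleSet s R₀) : ℝ) *
      (thetaHat t Z H (shiftSet i (scaleSet s R₀)) ω -
        finAverage (JOL R₀ l s) fun j => thetaHat t Z H (shiftSet j (scaleSet s R₀)) ω) ^ 2

/-- The inflated cubes `ₛΔ (i + (-1/2, 1/2]^d)` that lie inside `Δ R₀`. -/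
def JNOL (l s : Fin d → ℝ) : Set (Fin d → ℤ) :=
  {i | scaleSet s (shiftSet i (unitCube d)) ⊆ scaleSet l R₀}

/-- The nonoverlapping (NOL) subsample variance estimator, based on the regions
`ₛΔ (i + R₀)`. -/
def tauHatNOL (l s : Fin d → ℝ) (ω : Ω) : ℝ :=
  finAverage (JNOL R₀ l s) fun i =>
    (siteCount t (scaleSet s (shiftSet i R₀)) : ℝ) *
      (thetaHat t Z H (scaleSet s (shiftSet i R₀)) ω -
        finAverage (JNOL R₀ l s) fun j => thetaHat t Z H (scaleSet s (shiftSet j R₀)) ω) ^ 2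

end Estimators

/-! ### Stationarity and mixing -/

section Mixing

variable {d p : ℕ} {Ω : Type*} [MeasurableSpace Ω]

/-- Strict stationarity: the law of the field is invariant under lattice translations. -/
def IsStationary (P : Measure Ω) (Z : (Fin d → ℤ) → Ω → EuclideanSpace ℝ (Fin p)) : Prop :=
  ∀ h : Fin d → ℤ, P.map (fun ω k => Z (k + h) ω) = P.map (fun ω k => Z k ω)

/-- The σ-field generated by the observations at the sites in `T`. -/
abbrev sigmaField (Z : (Fin d → ℤ) → Ω → EuclideanSpace ℝ (Fin p)) (T : Set (Fin d → ℤ)) :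
    MeasurableSpace Ω :=
  ⨆ k ∈ T, MeasurableSpace.comap (Z k) inferInstance

/-- `dis(T₁, T₂) ≥ r` in the `ℓ^∞` distance (which is `dist` on `Fin d → ℤ`). -/
def DisGE (T₁ T₂ : Set (Fin d → ℤ)) (r : ℝ) : Prop :=
  ∀ x ∈ T₁, ∀ y ∈ T₂, r ≤ dist x y

/-- `α̃(T₁, T₂)`. -/
def alphaTilde (P : Measure Ω) (Z : (Fin d → ℤ) → Ω → EuclideanSpace ℝ (Fin p))
    (T₁ T₂ : Set (Fin d → ℤ)) : ℝ :=
  sSup {x | ∃ A B : Set Ω, MeasurableSet[sigmaField Z T₁] A ∧ MeasurableSet[sigmaField Z T₂] B ∧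
    x = |P.real (A ∩ B) - P.real A * P.real B|}

/-- The strong mixing coefficient `α(k, l)`, a supremum over finite sets of sites. -/
def mixingCoeff (P : Measure Ω) (Z : (Fin d → ℤ) → Ω → EuclideanSpace ℝ (Fin p))
    (k l : ℝ) : ℝ :=
  sSup {x | ∃ T₁ T₂ : Finset (Fin d → ℤ), (T₁.card : ℝ) ≤ l ∧ (T₂.card : ℝ) ≤ l ∧
    DisGE (T₁ : Set (Fin d → ℤ)) T₂ k ∧ x = alphaTilde P Z T₁ T₂}

/-- The supremum of `α̃(T₁, T₂)` over one-point sets `T₁` and arbitrary sets `T₂` at distance at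
least `k`. -/
def pointMixingCoeff (P : Measure Ω) (Z : (Fin d → ℤ) → Ω → EuclideanSpace ℝ (Fin p))
    (k : ℝ) : ℝ :=
  sSup {x | ∃ (u : Fin d → ℤ) (T₂ : Set (Fin d → ℤ)),
    DisGE {u} T₂ k ∧ x = alphaTilde P Z {u} T₂}

/-! ### Assumptions on the design, the field and the function `H` -/

/-- The subsample scaling factors, relative to the first one, converge to the entries of a
diagonal matrix with positive determinant. -/
def AssumptionA1 [NeZero d] (slam : ℕ → Fin d → ℝ) : Prop :=
  ∃ l₀ : Fin d → ℝ, 0 < ∏ i, l₀ i ∧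
    ∀ i, Tendsto (fun n => 1 / slam n 0 * slam n i) atTop (𝓝 (l₀ i))

/-- Growth conditions on the scaling factors of the sampling region and of the subsamples. -/
def AssumptionA2 (lam slam : ℕ → Fin d → ℝ) : Prop :=
  Tendsto (fun n => ∑ i, 1 / slam n i + ∑ i, slam n i / lam n i +
      (∏ i, slam n i) ^ (((d : ℝ) + 1) / d) / ∏ i, lam n i) atTop (𝓝 0) ∧
    (fun n => ⨆ i, lam n i) =O[atTop] fun n => ⨅ i, lam n i

/-- The strong mixing coefficient is bounded by `α₁ k * g l`. -/
structure AssumptionA3 (P : Measure Ω) (Z : (Fin d → ℤ) → Ω → EuclideanSpace ℝ (Fin p))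
    (α₁ g : ℝ → ℝ) : Prop where
  alpha_nonneg : ∀ k, 0 < k → 0 ≤ α₁ k
  g_nonneg : ∀ l, 0 < l → 0 ≤ g l
  alpha_tendsto : Tendsto α₁ atTop (𝓝 0)
  g_tendsto : Tendsto g atTop atTop
  bound : ∀ k l, 0 < k → 0 < l → mixingCoeff P Z k l ≤ α₁ k * g l

/-- The mixing coefficient between one site and arbitrary remote sets is `o(k^{-d})`. -/
def AssumptionA4 (P : Measure Ω) (Z : (Fin d → ℤ) → Ω → EuclideanSpace ℝ (Fin p)) : Prop :=
  (fun k : ℕ => pointMixingCoeff P Z k) =o[atTop] fun k : ℕ => ((k : ℝ) ^ d)⁻¹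

/-- The mean `μ = E Z(t)` of the field. -/
def fieldMean (P : Measure Ω) (Z : (Fin d → ℤ) → Ω → EuclideanSpace ℝ (Fin p)) :
    EuclideanSpace ℝ (Fin p) :=
  ∫ ω, Z 0 ω ∂P

/-- `σ(k) = Cov(∇' Z(t), ∇' Z(t + k))`, where `∇` is the gradient of `H` at `μ`. -/
def sigmaCov (P : Measure Ω) (Z : (Fin d → ℤ) → Ω → EuclideanSpace ℝ (Fin p))
    (H : EuclideanSpace ℝ (Fin p) → ℝ) (k : Fin d → ℤ) : ℝ :=
  covariance (fun ω => inner ℝ (gradient H (fieldMean P Z)) (Z 0 ω))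
    (fun ω => inner ℝ (gradient H (fieldMean P Z)) (Z k ω)) P

/-- The asymptotic variance `τ² = ∑ σ(k)` is positive. -/
def AssumptionA5 (P : Measure Ω) (Z : (Fin d → ℤ) → Ω → EuclideanSpace ℝ (Fin p))
    (H : EuclideanSpace ℝ (Fin p) → ℝ) : Prop :=
  0 < ∑' k : Fin d → ℤ, sigmaCov P Z H k

/-- Condition `D_r` with exponent `a`. The partial derivatives of order `r` of the `C^r` function
`H` are the values `∂^r H / ∂x_{j 0} ⋯ ∂x_{j (r-1)}` of its `r`-th derivative at tuples of
standard basis vectors. -/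
def ConditionD (H : EuclideanSpace ℝ (Fin p) → ℝ) (r a : ℕ) : Prop :=
  ContDiff ℝ r H ∧ ∃ C : ℝ, 0 < C ∧ ∀ (x : EuclideanSpace ℝ (Fin p)) (j : Fin r → Fin p),
    |iteratedFDeriv ℝ r H x fun i => EuclideanSpace.single (j i) (1 : ℝ)| ≤ C * (1 + ‖x‖ ^ a)

/-- Condition `M_r` for the functions `α₁` and `g` of the mixing bound. -/
def ConditionM (P : Measure Ω) (Z : (Fin d → ℤ) → Ω → EuclideanSpace ℝ (Fin p))
    (α₁ g : ℝ → ℝ) (r : ℕ) : Prop :=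
  ∃ δ κ C : ℝ, 0 < δ ∧ δ ≤ 1 ∧ 0 < κ ∧ κ < (2 * r - 1 - 1 / d) * (2 * r + δ) / δ ∧ 0 < C ∧
    Integrable (fun ω => ‖Z 0 ω‖ ^ (2 * (r : ℝ) + δ)) P ∧
    Summable (fun m : ℕ => ((m : ℝ) + 1) ^ ((2 * (r : ℝ) - 1) * d - 1) *
      α₁ ((m : ℝ) + 1) ^ (δ / (2 * r + δ))) ∧
    ∀ x : ℝ, 1 ≤ x → g x ≤ C * x ^ κ

end Mixing

end

end SpatialSubsampling

open SpatialSubsampling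

/-!
By Taylor expansion at `μ`, the statistic on a set `S` of sites is `H(μ)` plus the mean over `S` of
the linearized field `∇'(Z - μ)` plus a remainder. Strong mixing bounds the moments of the sample
mean, so that the remainder has variance `O(|S|⁻²)`, while its covariance with the linear part is
small enough that `|S| Var(θ̂(S)) = |S| Var(linear part) + O(|S|^{-1/d})`; for `d = 1` this requires
one more order of the expansion.

For a region `S = Δ R₀` the normalized variance of the linear part is `∑ σ(k)`, each `σ(k)` weighted
by the proportion of the sites of `S` whose translate by `k` stays in `S`. By the boundary condition
that proportion is `1 - O(‖k‖ / λ)`, so the normalized variance is `∑ σ(k) + O(1/λ)`, both for the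
sampling region and for every subsampling region.

The expected subsample variance is the normalized variance of one block minus the block size times
the variance of the average of `θ̂` over the blocks. That average is, up to remainders, a
weighted average of the linearized field over the sites of `Δ_n R₀`, each with weight at most
`O(1 / det Δ_n)`, so the subtracted term is `O(1 / det ₛΔ_n + det ₛΔ_n / det Δ_n)`, which A.1 and
A.2 turn into `O(1 / ₛλ₁)`.
-/

namespace SpatialSubsampling

/-! ### Covariance inequalities under strong mixing -/

/-- The strong mixing coefficient of the σ-fields `m₁` and `m₂` under `P` is at most `α`. -/
def HasMixingBound {Ω : Type*} {_ : MeasurableSpace Ω} (P : Measure Ω) (m₁ m₂ : MeasurableSpace Ω)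
    (α : ℝ) : Prop :=
  ∀ S T : Set Ω, MeasurableSet[m₁] S → MeasurableSet[m₂] T →
    |P.real (S ∩ T) - P.real S * P.real T| ≤ α

section BoundedCovariance

variable {Ω : Type*} {m m₁ m₂ m0 : MeasurableSpace Ω} {P : Measure Ω}

lemma integral_abs_eq_two_mul_setIntegral_nonneg {h : Ω → ℝ} (hh : Integrable h P)
    (hmeas : MeasurableSet {ω | 0 ≤ h ω}) (hzero : ∫ ω, h ω ∂P = 0) :
    ∫ ω, |h ω| ∂P = 2 * ∫ ω in {ω | 0 ≤ h ω}, h ω ∂P := by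
  have hpos : ∫ ω in {ω | 0 ≤ h ω}, |h ω| ∂P = ∫ ω in {ω | 0 ≤ h ω}, h ω ∂P :=
    setIntegral_congr_fun hmeas fun ω hω => abs_of_nonneg hω
  have hneg : ∫ ω in {ω | 0 ≤ h ω}ᶜ, |h ω| ∂P = -∫ ω in {ω | 0 ≤ h ω}ᶜ, h ω ∂P := by
    rw [← integral_neg]
    exact setIntegral_congr_fun hmeas.compl fun ω hω => abs_of_neg (not_le.1 hω)
  linarith [integral_add_compl hmeas hh, integral_add_compl hmeas hh.abs]

variable [IsProbabilityMeasure P]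

lemma abs_measureReal_inter_sub_mul_le_one (A B : Set Ω) :
    |P.real (A ∩ B) - P.real A * P.real B| ≤ 1 :=
  abs_sub_le_of_nonneg_of_le measureReal_nonneg measureReal_le_one
    (mul_nonneg measureReal_nonneg measureReal_nonneg)
    (mul_le_one₀ measureReal_le_one measureReal_nonneg measureReal_le_one)

lemma integral_mul_sub_eq_integral_mul_condExp_sub (hm : m ≤ m0) {f g : Ω → ℝ} {A : ℝ}
    (hf : StronglyMeasurable[m] f) (hA : ∀ ω, |f ω| ≤ A) (hg : Integrable g P) :
    (∫ ω, f ω * g ω ∂P) - (∫ ω, f ω ∂P) * ∫ ω, g ω ∂P =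
      ∫ ω, f ω * ((P[g|m]) ω - ∫ ω', g ω' ∂P) ∂P := by
  have hfm : AEStronglyMeasurable f P := (hf.mono hm).aestronglyMeasurable
  have hfb : ∀ᵐ ω ∂P, ‖f ω‖ ≤ A := .of_forall hA
  have hpull : ∫ ω, f ω * g ω ∂P = ∫ ω, f ω * (P[g|m]) ω ∂P := by
    rw [← integral_condExp hm (f := fun ω => f ω * g ω)]
    exact integral_congr_ae
      (condExp_mul_of_stronglyMeasurable_left hf (hg.bdd_mul hfm hfb) hg)
  simp only [mul_sub]
  rw [integral_sub (integrable_condExp.bdd_mul hfm hfb)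
    ((Integrable.of_bound hfm A hfb).mul_const _), hpull, integral_mul_const]

lemma exists_measurableSet_abs_cov_le (hm : m ≤ m0) {f g : Ω → ℝ} {A : ℝ}
    (hf : StronglyMeasurable[m] f) (hA : ∀ ω, |f ω| ≤ A) (hg : Integrable g P) :
    ∃ S : Set Ω, MeasurableSet[m] S ∧
      |(∫ ω, f ω * g ω ∂P) - (∫ ω, f ω ∂P) * ∫ ω, g ω ∂P| ≤
        2 * A * |(∫ ω in S, g ω ∂P) - P.real S * ∫ ω, g ω ∂P| := by
  set h : Ω → ℝ := fun ω => (P[g|m]) ω - ∫ ω', g ω' ∂P with hh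
  set S : Set Ω := {ω | 0 ≤ h ω}
  have hh_int : Integrable h P := integrable_condExp.sub (integrable_const _)
  have hfm : AEStronglyMeasurable f P := (hf.mono hm).aestronglyMeasurable
  have hA0 : 0 ≤ A := by
    obtain ⟨ω⟩ : Nonempty Ω := nonempty_of_isProbabilityMeasure P
    exact (abs_nonneg _).trans (hA ω)
  have hS : MeasurableSet[m] S := measurableSet_le measurable_const
    (stronglyMeasurable_condExp.sub stronglyMeasurable_const).measurable
  have hzero : ∫ ω, h ω ∂P = 0 := by
    simp [hh, integral_sub integrable_condExp (integrable_const _), integral_condExp hm]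
  have hset : ∫ ω in S, h ω ∂P = (∫ ω in S, g ω ∂P) - P.real S * ∫ ω, g ω ∂P := by
    simp [hh, integral_sub integrable_condExp.integrableOn (integrable_const _).integrableOn,
      setIntegral_condExp hm hg hS]
  refine ⟨S, hS, ?_⟩
  rw [integral_mul_sub_eq_integral_mul_condExp_sub hm hf hA hg, ← hset]
  calc |∫ ω, f ω * h ω ∂P| ≤ ∫ ω, |f ω * h ω| ∂P := abs_integral_le_integral_abs
    _ ≤ ∫ ω, A * |h ω| ∂P := by
        refine integral_mono (hh_int.bdd_mul hfm (.of_forall hA)).abs (hh_int.abs.const_mul A)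
          fun ω => ?_
        simpa only [abs_mul] using mul_le_mul_of_nonneg_right (hA ω) (abs_nonneg _)
    _ = 2 * A * ∫ ω in S, h ω ∂P := by
        rw [integral_const_mul,
          integral_abs_eq_two_mul_setIntegral_nonneg hh_int (hm _ hS) hzero]
        ring
    _ ≤ 2 * A * |∫ ω in S, h ω ∂P| := by gcongr; exact le_abs_self _

/-- The bound for sets is extended to functions one factor at a time: first `f`, then `g`, is
replaced by the indicator of a set. -/
lemma HasMixingBound.abs_cov_le {α : ℝ} (hα : HasMixingBound P m₁ m₂ α) (h₁ : m₁ ≤ m0)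
    (h₂ : m₂ ≤ m0) {f g : Ω → ℝ} {A B : ℝ} (hf : StronglyMeasurable[m₁] f) (hA : ∀ ω, |f ω| ≤ A)
    (hg : StronglyMeasurable[m₂] g) (hB : ∀ ω, |g ω| ≤ B) :
    |(∫ ω, f ω * g ω ∂P) - (∫ ω, f ω ∂P) * ∫ ω, g ω ∂P| ≤ 4 * A * B * α := by
  obtain ⟨ω⟩ : Nonempty Ω := nonempty_of_isProbabilityMeasure P
  have hA0 : 0 ≤ A := (abs_nonneg _).trans (hA ω)
  have hB0 : 0 ≤ B := (abs_nonneg _).trans (hB ω)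
  have hgi : Integrable g P :=
    .of_bound (hg.mono h₂).aestronglyMeasurable B (.of_forall hB)
  obtain ⟨S, hS, hfS⟩ := exists_measurableSet_abs_cov_le h₁ hf hA hgi
  have hSi : Integrable (S.indicator fun _ => (1 : ℝ)) P :=
    (integrable_const (1 : ℝ)).indicator (h₁ _ hS)
  obtain ⟨T, hT, hgT⟩ := exists_measurableSet_abs_cov_le h₂ hg hB hSi
  have hgS : ∫ ω, g ω * S.indicator (fun _ => (1 : ℝ)) ω ∂P = ∫ ω in S, g ω ∂P := by
    rw [← integral_indicator (h₁ _ hS)]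
    congr 1 with ω
    by_cases h : ω ∈ S <;> simp [h]
  have hS_real : ∫ ω, S.indicator (fun _ => (1 : ℝ)) ω ∂P = P.real S := by
    simp [integral_indicator (h₁ _ hS)]
  have hST_real : ∫ ω in T, S.indicator (fun _ => (1 : ℝ)) ω ∂P = P.real (S ∩ T) := by
    simp [setIntegral_indicator (h₁ _ hS), Set.inter_comm]
  rw [hgS, hS_real, hST_real, mul_comm (∫ ω, g ω ∂P), mul_comm (P.real T)] at hgT
  calc _ ≤ 2 * A * |(∫ ω in S, g ω ∂P) - P.real S * ∫ ω, g ω ∂P| := hfS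
    _ ≤ 2 * A * (2 * B * |P.real (S ∩ T) - P.real S * P.real T|) := by gcongr
    _ ≤ 2 * A * (2 * B * α) := by gcongr; exact hα S T hS hT
    _ = 4 * A * B * α := by ring

end BoundedCovariance

section FieldMixing

variable {d p : ℕ} {Ω : Type*}

lemma measurable_sigmaField {Z : (Fin d → ℤ) → Ω → EuclideanSpace ℝ (Fin p)}
    {T : Set (Fin d → ℤ)} {k : Fin d → ℤ} (hk : k ∈ T) :
    Measurable[sigmaField Z T] (Z k) :=
  (comap_measurable (Z k)).mono (le_iSup₂_of_le k hk le_rfl) le_rfl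

variable [m0 : MeasurableSpace Ω]

lemma sigmaField_le {Z : (Fin d → ℤ) → Ω → EuclideanSpace ℝ (Fin p)}
    (hZ : ∀ k, Measurable (Z k)) (T : Set (Fin d → ℤ)) :
    sigmaField Z T ≤ m0 :=
  iSup₂_le fun k _ => (hZ k).comap_le

variable (P : Measure Ω) [IsProbabilityMeasure P]
  (Z : (Fin d → ℤ) → Ω → EuclideanSpace ℝ (Fin p))

lemma hasMixingBound_alphaTilde (T₁ T₂ : Set (Fin d → ℤ)) :
    HasMixingBound P (sigmaField Z T₁) (sigmaField Z T₂) (alphaTilde P Z T₁ T₂) := by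
  intro A B hA hB
  refine le_csSup ⟨1, ?_⟩ ⟨A, B, hA, hB, rfl⟩
  rintro x ⟨A, B, -, -, rfl⟩
  exact abs_measureReal_inter_sub_mul_le_one A B

lemma alphaTilde_le_one (T₁ T₂ : Set (Fin d → ℤ)) : alphaTilde P Z T₁ T₂ ≤ 1 := by
  refine Real.sSup_le ?_ zero_le_one
  rintro x ⟨A, B, -, -, rfl⟩
  exact abs_measureReal_inter_sub_mul_le_one A B

lemma alphaTilde_le_mixingCoeff {T₁ T₂ : Finset (Fin d → ℤ)} {k l : ℝ}
    (h₁ : (T₁.card : ℝ) ≤ l) (h₂ : (T₂.card : ℝ) ≤ l) (h : DisGE (T₁ : Set (Fin d → ℤ)) T₂ k) :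
    alphaTilde P Z T₁ T₂ ≤ mixingCoeff P Z k l := by
  refine le_csSup ⟨1, ?_⟩ ⟨T₁, T₂, h₁, h₂, h, rfl⟩
  rintro x ⟨T₁, T₂, -, -, -, rfl⟩
  exact alphaTilde_le_one P Z _ _

end FieldMixing

/-! ### Products of random variables with bounded moments -/

section RealProducts

variable {ι : Type*} [Fintype ι]

lemma abs_prod_le_of_exists_le {s δ T : ℝ} (hδ : 0 ≤ δ) (hs : Fintype.card ι + δ ≤ s)
    (hT : 1 ≤ T) (x : ι → ℝ) (h : ∃ i, T ≤ |x i|) :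
    |∏ i, x i| ≤ T ^ (-δ) * ∑ i, |x i| ^ s := by
  obtain ⟨i, hi⟩ := h
  have : Nonempty ι := ⟨i⟩
  obtain ⟨j, hj⟩ := Finite.exists_max fun i => |x i|
  have hTj : T ≤ |x j| := hi.trans (hj i)
  have hj1 : 1 ≤ |x j| := hT.trans hTj
  calc |∏ i, x i| = ∏ i, |x i| := Finset.abs_prod _ _
    _ ≤ ∏ _i : ι, |x j| := Finset.prod_le_prod (fun _ _ => abs_nonneg _) fun i _ => hj i
    _ = |x j| ^ (Fintype.card ι : ℝ) := by simp
    _ ≤ |x j| ^ (-δ + s) := Real.rpow_le_rpow_of_exponent_le hj1 (by linarith)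
    _ = |x j| ^ (-δ) * |x j| ^ s := Real.rpow_add (by linarith) _ _
    _ ≤ T ^ (-δ) * ∑ i, |x i| ^ s := by
        refine mul_le_mul ?_ ?_ (by positivity) (by positivity)
        · exact Real.rpow_le_rpow_of_nonpos (by linarith) hTj (by linarith)
        · exact Finset.single_le_sum (f := fun i => |x i| ^ s) (fun i _ => by positivity)
            (Finset.mem_univ j)

lemma abs_prod_le_one_add_sum_rpow {s : ℝ} (hs : Fintype.card ι ≤ s) (x : ι → ℝ) :
    |∏ i, x i| ≤ 1 + ∑ i, |x i| ^ s := by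
  by_cases! h : ∃ i, 1 ≤ |x i|
  · have := abs_prod_le_of_exists_le le_rfl (by simpa using hs) le_rfl x h
    simp only [neg_zero, Real.rpow_zero, one_mul] at this
    linarith
  · rw [Finset.abs_prod]
    exact (Finset.prod_le_one (fun i _ => abs_nonneg _) fun i _ => (h i).le).trans
      (le_add_of_nonneg_right (Finset.sum_nonneg fun i _ => by positivity))

lemma truncation_eq_self_or_eq_zero {Ω : Type*} (f : Ω → ℝ) (T : ℝ) (ω : Ω) :
    truncation f T ω = f ω ∨ truncation f T ω = 0 :=
  (Set.indicator_eq_zero_or_self _ _ _).symm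

lemma abs_prod_sub_prod_truncation_le {Ω : Type*} {s δ T : ℝ} (hδ : 0 ≤ δ)
    (hs : Fintype.card ι + δ ≤ s) (hT : 1 ≤ T) (X : ι → Ω → ℝ) (ω : Ω) :
    |∏ i, X i ω - ∏ i, truncation (X i) T ω| ≤ T ^ (-δ) * ∑ i, |X i ω| ^ s := by
  by_cases! h : ∃ i, T ≤ |X i ω|
  · refine le_trans ?_ (abs_prod_le_of_exists_le hδ hs hT (fun i => X i ω) h)
    by_cases! h0 : ∃ i, truncation (X i) T ω = 0
    · obtain ⟨i, hi⟩ := h0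
      have hprod : ∏ i, truncation (X i) T ω = 0 := Finset.prod_eq_zero (Finset.mem_univ i) hi
      rw [hprod, sub_zero]
    · rw [Finset.prod_congr rfl fun i _ =>
        (truncation_eq_self_or_eq_zero (X i) T ω).resolve_right (h0 i), sub_self, abs_zero]
      exact abs_nonneg _
  · rw [Finset.prod_congr rfl fun i _ => truncation_eq_self (h i), sub_self, abs_zero]
    positivity

lemma abs_prod_truncation_le {Ω : Type*} {T : ℝ} (hT : 0 ≤ T) (X : ι → Ω → ℝ) (ω : Ω) :
    |∏ i, truncation (X i) T ω| ≤ T ^ Fintype.card ι := by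
  calc |∏ i, truncation (X i) T ω| = ∏ i, |truncation (X i) T ω| := Finset.abs_prod _ _
    _ ≤ ∏ _i : ι, T := Finset.prod_le_prod (fun _ _ => abs_nonneg _) fun i _ =>
        (abs_truncation_le_bound _ _ _).trans_eq (abs_of_nonneg hT)
    _ = T ^ Fintype.card ι := by simp

end RealProducts

/-- The real random variables `X i` have absolute moments of order `s` bounded by `K`. -/
structure HasMomentBound {ι Ω : Type*} {m0 : MeasurableSpace Ω} (P : Measure Ω) (X : ι → Ω → ℝ)
    (s K : ℝ) : Prop where
  measurable : ∀ i, Measurable (X i)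
  integrable : ∀ i, Integrable (fun ω => |X i ω| ^ s) P
  integral_le : ∀ i, ∫ ω, |X i ω| ^ s ∂P ≤ K

lemma measurable_truncation {Ω : Type*} {_ : MeasurableSpace Ω} {f : Ω → ℝ} (hf : Measurable f)
    (T : ℝ) : Measurable (truncation f T) :=
  (measurable_id.indicator measurableSet_Ioc).comp hf

namespace HasMomentBound

variable {ι κ Ω : Type*} {m0 : MeasurableSpace Ω} {P : Measure Ω} {X : ι → Ω → ℝ} {s δ K T : ℝ}

lemma comp (h : HasMomentBound P X s K) (e : κ → ι) : HasMomentBound P (fun j => X (e j)) s K :=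
  ⟨fun j => h.measurable (e j), fun j => h.integrable (e j), fun j => h.integral_le (e j)⟩

lemma truncation (h : HasMomentBound P X s K) (hs : 0 ≤ s) (T : ℝ) :
    HasMomentBound P (fun i => truncation (X i) T) s K := by
  have hle (i ω) : |ProbabilityTheory.truncation (X i) T ω| ^ s ≤ |X i ω| ^ s :=
    Real.rpow_le_rpow (abs_nonneg _) (abs_truncation_le_abs_self _ _ _) hs
  have hmeas (i) := measurable_truncation (h.measurable i) T
  have hint (i) : Integrable (fun ω => |ProbabilityTheory.truncation (X i) T ω| ^ s) P :=
    (h.integrable i).mono' ((hmeas i).abs.pow_const s).aestronglyMeasurable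
      (.of_forall fun ω => by
        rw [Real.norm_of_nonneg (by positivity)]
        exact hle i ω)
  exact ⟨hmeas, hint, fun i =>
    (integral_mono (hint i) (h.integrable i) (hle i)).trans (h.integral_le i)⟩

variable [Fintype ι]

lemma integrable_sum (h : HasMomentBound P X s K) :
    Integrable (fun ω => ∑ i, |X i ω| ^ s) P :=
  integrable_finsetSum _ fun i _ => h.integrable i

lemma integral_sum_le (h : HasMomentBound P X s K) :
    ∫ ω, ∑ i, |X i ω| ^ s ∂P ≤ Fintype.card ι * K := by
  rw [integral_finsetSum _ fun i _ => h.integrable i]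
  simpa using Finset.sum_le_sum fun i (_ : i ∈ Finset.univ) => h.integral_le i

variable [IsProbabilityMeasure P]

lemma integrable_prod (h : HasMomentBound P X s K) (hs : Fintype.card ι ≤ s) :
    Integrable (fun ω => ∏ i, X i ω) P :=
  ((integrable_const (1 : ℝ)).add h.integrable_sum).mono'
    (Finset.measurable_fun_prod _ fun i _ => h.measurable i).aestronglyMeasurable
    (.of_forall fun ω => abs_prod_le_one_add_sum_rpow hs fun i => X i ω)

lemma abs_integral_prod_le (h : HasMomentBound P X s K) (hs : Fintype.card ι ≤ s) :
    |∫ ω, ∏ i, X i ω ∂P| ≤ 1 + Fintype.card ι * K := by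
  calc |∫ ω, ∏ i, X i ω ∂P| ≤ ∫ ω, |∏ i, X i ω| ∂P := abs_integral_le_integral_abs
    _ ≤ ∫ ω, (1 + ∑ i, |X i ω| ^ s) ∂P :=
        integral_mono (h.integrable_prod hs).abs ((integrable_const 1).add h.integrable_sum)
          fun ω => abs_prod_le_one_add_sum_rpow hs fun i => X i ω
    _ = 1 + ∫ ω, ∑ i, |X i ω| ^ s ∂P := by
        simp [integral_add (integrable_const _) h.integrable_sum]
    _ ≤ 1 + Fintype.card ι * K := by grw [h.integral_sum_le]

lemma abs_integral_prod_sub_truncation_le (h : HasMomentBound P X s K) (hδ : 0 ≤ δ)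
    (hs : Fintype.card ι + δ ≤ s) (hT : 1 ≤ T) :
    |(∫ ω, ∏ i, X i ω ∂P) - ∫ ω, ∏ i, ProbabilityTheory.truncation (X i) T ω ∂P| ≤
      T ^ (-δ) * (Fintype.card ι * K) := by
  have hX := h.integrable_prod (by linarith)
  have hXT := (h.truncation (by linarith) T).integrable_prod (by linarith)
  rw [← integral_sub hX hXT]
  calc _ ≤ ∫ ω, |∏ i, X i ω - ∏ i, ProbabilityTheory.truncation (X i) T ω| ∂P :=
        abs_integral_le_integral_abs
    _ ≤ ∫ ω, T ^ (-δ) * ∑ i, |X i ω| ^ s ∂P :=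
        integral_mono (hX.sub hXT).abs (h.integrable_sum.const_mul _) fun ω =>
          abs_prod_sub_prod_truncation_le hδ hs hT X ω
    _ = T ^ (-δ) * ∫ ω, ∑ i, |X i ω| ^ s ∂P := integral_const_mul _ _
    _ ≤ _ := by grw [h.integral_sum_le]

end HasMomentBound

section Davydov

variable {ι Ω : Type*} [Fintype ι] {m₁ m₂ m0 : MeasurableSpace Ω} {P : Measure Ω}
  [IsProbabilityMeasure P] {X : ι → Ω → ℝ} {s δ K α T : ℝ} {q : ι → Prop} [DecidablePred q]

lemma HasMixingBound.abs_integral_prod_truncation_sub_mul_le (hα : HasMixingBound P m₁ m₂ α)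
    (h₁ : m₁ ≤ m0) (h₂ : m₂ ≤ m0) (hq₁ : ∀ i, q i → Measurable[m₁] (X i))
    (hq₂ : ∀ i, ¬ q i → Measurable[m₂] (X i)) (hT : 0 ≤ T) :
    |(∫ ω, ∏ i, truncation (X i) T ω ∂P) -
      (∫ ω, ∏ i : {i // q i}, truncation (X i) T ω ∂P) *
        ∫ ω, ∏ i : {i // ¬ q i}, truncation (X i) T ω ∂P| ≤ 4 * T ^ Fintype.card ι * α := by
  have hmeas₁ : Measurable[m₁] fun ω => ∏ i : {i // q i}, truncation (X i) T ω :=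
    Finset.measurable_fun_prod _ fun i _ => measurable_truncation (hq₁ i i.2) T
  have hmeas₂ : Measurable[m₂] fun ω => ∏ i : {i // ¬ q i}, truncation (X i) T ω :=
    Finset.measurable_fun_prod _ fun i _ => measurable_truncation (hq₂ i i.2) T
  have hcov := hα.abs_cov_le h₁ h₂ hmeas₁.stronglyMeasurable
    (abs_prod_truncation_le hT fun i : {i // q i} => X i) hmeas₂.stronglyMeasurable
    (abs_prod_truncation_le hT fun i : {i // ¬ q i} => X i)
  have hcard : Fintype.card {i // q i} + Fintype.card {i // ¬ q i} = Fintype.card ι := by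
    rw [← Fintype.card_sum, Fintype.card_congr (Equiv.sumCompl q)]
  simp only [fun ω => Fintype.prod_subtype_mul_prod_subtype q fun i => truncation (X i) T ω] at hcov
  rwa [mul_assoc 4, ← pow_add, hcard] at hcov

lemma abs_mul_sub_mul_le {u v u' v' B ε : ℝ} (hv : |v| ≤ B) (hu' : |u'| ≤ B) (hu : |u - u'| ≤ ε)
    (hv' : |v - v'| ≤ ε) : |u' * v' - u * v| ≤ 2 * B * ε := by
  have hB : 0 ≤ B := (abs_nonneg _).trans hv
  calc |u' * v' - u * v| = |u' * (v' - v) + v * (u' - u)| := by congr 1; ring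
    _ ≤ |u'| * |v' - v| + |v| * |u' - u| := by
        simpa only [abs_mul] using abs_add_le (u' * (v' - v)) (v * (u' - u))
    _ ≤ B * ε + B * ε := by rw [abs_sub_comm v', abs_sub_comm u']; gcongr
    _ = 2 * B * ε := by ring

lemma HasMixingBound.abs_integral_prod_sub_mul_le_of_level (hα : HasMixingBound P m₁ m₂ α)
    (h₁ : m₁ ≤ m0) (h₂ : m₂ ≤ m0) (hq₁ : ∀ i, q i → Measurable[m₁] (X i))
    (hq₂ : ∀ i, ¬ q i → Measurable[m₂] (X i)) (hX : HasMomentBound P X s K) (hK : 0 ≤ K)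
    (hδ : 0 ≤ δ) (hs : Fintype.card ι + δ ≤ s) (hT : 1 ≤ T) :
    |(∫ ω, ∏ i, X i ω ∂P) -
      (∫ ω, ∏ i : {i // q i}, X i ω ∂P) * ∫ ω, ∏ i : {i // ¬ q i}, X i ω ∂P| ≤
      4 * T ^ Fintype.card ι * α + 3 * (1 + Fintype.card ι * K) ^ 2 * T ^ (-δ) := by
  set B : ℝ := 1 + Fintype.card ι * K with hB
  have hB1 : 1 ≤ B := le_add_of_nonneg_right (by positivity)
  have hcard₁ : (Fintype.card {i // q i} : ℝ) ≤ Fintype.card ι :=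
    mod_cast Fintype.card_subtype_le q
  have hcard₂ : (Fintype.card {i // ¬ q i} : ℝ) ≤ Fintype.card ι :=
    mod_cast Fintype.card_subtype_le fun i => ¬ q i
  have hX₁ := hX.comp ((↑) : {i // q i} → ι)
  have hX₂ := hX.comp ((↑) : {i // ¬ q i} → ι)
  have hs0 : 0 ≤ s := by linarith [(Nat.cast_nonneg (Fintype.card ι) : (0 : ℝ) ≤ _)]
  set E := ∫ ω, ∏ i, X i ω ∂P
  set E₁ := ∫ ω, ∏ i : {i // q i}, X i ω ∂P
  set E₂ := ∫ ω, ∏ i : {i // ¬ q i}, X i ω ∂P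
  set E' := ∫ ω, ∏ i, truncation (X i) T ω ∂P
  set E₁' := ∫ ω, ∏ i : {i // q i}, truncation (X i) T ω ∂P
  set E₂' := ∫ ω, ∏ i : {i // ¬ q i}, truncation (X i) T ω ∂P
  have htrunc {n : ℝ} (hn : n ≤ Fintype.card ι) : T ^ (-δ) * (n * K) ≤ B * T ^ (-δ) := by
    rw [mul_comm, hB]
    gcongr
    linarith [mul_le_mul_of_nonneg_right hn hK]
  have hE : |E - E'| ≤ B * T ^ (-δ) :=
    (hX.abs_integral_prod_sub_truncation_le hδ hs hT).trans (htrunc le_rfl)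
  have hE₁ : |E₁ - E₁'| ≤ B * T ^ (-δ) :=
    (hX₁.abs_integral_prod_sub_truncation_le hδ (by linarith) hT).trans (htrunc hcard₁)
  have hE₂ : |E₂ - E₂'| ≤ B * T ^ (-δ) :=
    (hX₂.abs_integral_prod_sub_truncation_le hδ (by linarith) hT).trans (htrunc hcard₂)
  have hE₂B : |E₂| ≤ B := (hX₂.abs_integral_prod_le (by linarith)).trans (by rw [hB]; gcongr)
  have hE₁B : |E₁'| ≤ B :=
    ((hX₁.truncation hs0 T).abs_integral_prod_le (by linarith)).trans (by rw [hB]; gcongr)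
  have hfactor := hα.abs_integral_prod_truncation_sub_mul_le h₁ h₂ hq₁ hq₂ (by linarith : 0 ≤ T)
  have hproduct := abs_mul_sub_mul_le hE₂B hE₁B hE₁ hE₂
  have hsq : B * T ^ (-δ) ≤ B ^ 2 * T ^ (-δ) := by gcongr; exact le_self_pow₀ hB1 two_ne_zero
  calc |E - E₁ * E₂| = |(E - E') + (E' - E₁' * E₂') + (E₁' * E₂' - E₁ * E₂)| := by
        congr 1; ring
    _ ≤ |E - E'| + |E' - E₁' * E₂'| + |E₁' * E₂' - E₁ * E₂| := abs_add_three _ _ _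
    _ ≤ 4 * T ^ Fintype.card ι * α + 3 * B ^ 2 * T ^ (-δ) := by linarith

/-- A Davydov-type covariance inequality for products. The truncation level `α ^ (-1 / s)` balances
the two errors of the truncated inequality. -/
lemma HasMixingBound.abs_integral_prod_sub_mul_le (hα : HasMixingBound P m₁ m₂ α)
    (h₁ : m₁ ≤ m0) (h₂ : m₂ ≤ m0) (hq₁ : ∀ i, q i → Measurable[m₁] (X i))
    (hq₂ : ∀ i, ¬ q i → Measurable[m₂] (X i)) (hX : HasMomentBound P X s K) (hK : 0 ≤ K)
    (hδ : 0 < δ) (hs : Fintype.card ι + δ ≤ s) (hα0 : 0 ≤ α) :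
    |(∫ ω, ∏ i, X i ω ∂P) -
      (∫ ω, ∏ i : {i // q i}, X i ω ∂P) * ∫ ω, ∏ i : {i // ¬ q i}, X i ω ∂P| ≤
      (4 + 3 * (1 + Fintype.card ι * K) ^ 2) * α ^ (δ / s) := by
  set c : ℝ := 4 + 3 * (1 + Fintype.card ι * K) ^ 2 with hc
  have hs0 : 0 < s := by linarith [(Nat.cast_nonneg (Fintype.card ι) : (0 : ℝ) ≤ _)]
  have hcont : Tendsto (fun β : ℝ => c * β ^ (δ / s)) (𝓝[>] α) (𝓝 (c * α ^ (δ / s))) :=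
    (((Real.continuous_rpow_const (by positivity)).tendsto α).const_mul _).mono_left
      nhdsWithin_le_nhds
  refine ge_of_tendsto hcont (eventually_nhdsWithin_of_forall fun β hβ => ?_)
  set η := min β 1
  have hη0 : 0 < η := lt_min (hα0.trans_lt hβ) one_pos
  have hη : HasMixingBound P m₁ m₂ η := fun S T hS hT =>
    le_min ((hα S T hS hT).trans hβ.le) (abs_measureReal_inter_sub_mul_le_one S T)
  have hlevel : 1 ≤ η ^ (-(1 / s)) :=
    Real.one_le_rpow_of_pos_of_le_one_of_nonpos hη0 (min_le_right _ _) (by simpa using hs0.le)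
  have htail : (η ^ (-(1 / s))) ^ (-δ) = η ^ (δ / s) := by
    rw [← Real.rpow_mul hη0.le]; congr 1; ring
  have hbulk : (η ^ (-(1 / s))) ^ Fintype.card ι * η ≤ η ^ (δ / s) := by
    rw [← Real.rpow_natCast, ← Real.rpow_mul hη0.le, ← Real.rpow_add_one hη0.ne']
    refine Real.rpow_le_rpow_of_exponent_ge hη0 (min_le_right _ _) ?_
    rw [div_le_iff₀ hs0, add_mul, mul_assoc, neg_mul, mul_comm, mul_assoc,
      mul_one_div_cancel hs0.ne']
    linarith
  have hηβ : η ^ (δ / s) ≤ β ^ (δ / s) :=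
    Real.rpow_le_rpow hη0.le (min_le_left _ _) (by positivity)
  refine (hη.abs_integral_prod_sub_mul_le_of_level h₁ h₂ hq₁ hq₂ hX hK hδ.le hs hlevel).trans ?_
  rw [htail]
  calc _ ≤ c * η ^ (δ / s) := by rw [hc]; linarith
    _ ≤ c * β ^ (δ / s) := by gcongr

end Davydov

/-! ### Sums of mixed moments over an integer lattice -/

/-- The `ℓ^∞` norm of an integer vector, as a natural number. -/
def supNorm {κ : Type*} [Fintype κ] (v : κ → ℤ) : ℕ := Finset.univ.sup fun i => (v i).natAbs

/-- The integer vectors of `ℓ^∞` norm at most `R`. -/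
noncomputable def latticeBox (κ : Type*) [Fintype κ] [DecidableEq κ] (R : ℕ) : Finset (κ → ℤ) :=
  Fintype.piFinset fun _ => Finset.Icc (-(R : ℤ)) R

/-- The bound of `sum_radial_le` for the sum of `f (supNorm v ⌈/⌉ q)` over vectors `v` in
dimension `D`. -/
noncomputable def radialSumBound (D q : ℕ) (f : ℕ → ℝ) : ℝ :=
  f 0 + (2 * q) * D * (3 * q) ^ (D - 1) * ∑' m : ℕ, ((m : ℝ) + 1) ^ (D - 1) * f (m + 1)

section LatticeSums

variable {κ : Type*} [Fintype κ] {v w : κ → ℤ} {q R : ℕ}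

lemma supNorm_le_iff : supNorm v ≤ R ↔ ∀ i, (v i).natAbs ≤ R := by
  simp [supNorm, Finset.sup_le_iff]

lemma natAbs_le_supNorm (v : κ → ℤ) (i : κ) : (v i).natAbs ≤ supNorm v :=
  supNorm_le_iff.1 le_rfl i

lemma supNorm_eq_zero : supNorm v = 0 ↔ v = 0 := by
  rw [← Nat.le_zero, supNorm_le_iff]
  simp only [Nat.le_zero, Int.natAbs_eq_zero, funext_iff, Pi.zero_apply]

lemma exists_natAbs_eq_supNorm [Nonempty κ] (v : κ → ℤ) : ∃ i, (v i).natAbs = supNorm v := by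
  obtain ⟨i, -, hi⟩ :=
    Finset.exists_mem_eq_sup Finset.univ Finset.univ_nonempty fun i => (v i).natAbs
  exact ⟨i, hi.symm⟩

lemma supNorm_add_le (v w : κ → ℤ) : supNorm (v + w) ≤ supNorm v + supNorm w :=
  supNorm_le_iff.2 fun i => (Int.natAbs_add_le _ _).trans
    (add_le_add (natAbs_le_supNorm v i) (natAbs_le_supNorm w i))

lemma supNorm_sub_le_dist (v w : κ → ℤ) : (supNorm (v - w) : ℝ) ≤ dist v w := by
  have : supNorm (v - w) ≤ ⌊dist v w⌋₊ := supNorm_le_iff.2 fun i => Nat.le_floor <| by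
    refine le_trans (le_of_eq ?_) (dist_le_pi_dist v w i)
    rw [Int.dist_eq]
    simp [Nat.cast_natAbs]
  exact (Nat.cast_le.2 this).trans (Nat.floor_le dist_nonneg)

lemma ceilDiv_eq_zero_iff {a : ℕ} (hq : 0 < q) : a ⌈/⌉ q = 0 ↔ a = 0 := by
  rw [← Nat.le_zero, ceilDiv_le_iff_le_mul hq, mul_zero, Nat.le_zero]

section Boxes

variable [DecidableEq κ]

lemma mem_latticeBox : v ∈ latticeBox κ R ↔ supNorm v ≤ R := by
  simp only [latticeBox, Fintype.mem_piFinset, Finset.mem_Icc, supNorm_le_iff]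
  exact forall_congr' fun i => by omega

lemma card_latticeBox (κ : Type*) [Fintype κ] [DecidableEq κ] (R : ℕ) :
    (latticeBox κ R).card = (2 * R + 1) ^ Fintype.card κ := by
  have : ((R : ℤ) + 1 + R).toNat = 2 * R + 1 := by omega
  simp [latticeBox, Fintype.card_piFinset, this]

lemma card_latticeBox_sdiff_le (κ : Type*) [Fintype κ] [DecidableEq κ] {r R : ℕ} (h : r ≤ R) :
    (latticeBox κ R \ latticeBox κ r).card ≤
      2 * (R - r) * Fintype.card κ * (2 * R + 1) ^ (Fintype.card κ - 1) := by
  have hsub : latticeBox κ r ⊆ latticeBox κ R := fun v hv =>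
    mem_latticeBox.2 ((mem_latticeBox.1 hv).trans h)
  have hpow := (le_abs_self _).trans
    (abs_pow_sub_pow_le (2 * R + 1 : ℤ) (2 * r + 1 : ℤ) (Fintype.card κ))
  rw [abs_of_nonneg (by omega), abs_of_nonneg (by omega), abs_of_nonneg (by omega),
    max_eq_left (by omega)] at hpow
  have hwidth : (2 * R + 1 : ℤ) - (2 * r + 1) = 2 * (R - r) := by ring
  rw [Finset.card_sdiff_of_subset hsub, card_latticeBox, card_latticeBox]
  zify [h, Nat.pow_le_pow_left (show 2 * r + 1 ≤ 2 * R + 1 by omega) (Fintype.card κ)]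
  rwa [hwidth] at hpow

end Boxes

lemma card_filter_supNorm_ceilDiv_le (hq : 0 < q) (W : Finset (κ → ℤ)) (m : ℕ) :
    (W.filter fun v => supNorm v ⌈/⌉ q = m + 1).card ≤
      2 * q * Fintype.card κ * (3 * q) ^ (Fintype.card κ - 1) * (m + 1) ^ (Fintype.card κ - 1) := by
  classical
  have hsub : (W.filter fun v => supNorm v ⌈/⌉ q = m + 1) ⊆
      latticeBox κ (q * (m + 1)) \ latticeBox κ (q * m) := fun v hv => by
    have hv' := (Finset.mem_filter.1 hv).2
    rw [Finset.mem_sdiff, mem_latticeBox, mem_latticeBox, ← ceilDiv_le_iff_le_mul hq,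
      ← ceilDiv_le_iff_le_mul hq, hv']
    omega
  have hwidth : q * (m + 1) - q * m = q := by rw [mul_add_one, Nat.add_sub_cancel_left]
  calc _ ≤ (latticeBox κ (q * (m + 1)) \ latticeBox κ (q * m)).card := Finset.card_le_card hsub
    _ ≤ 2 * q * Fintype.card κ * (2 * (q * (m + 1)) + 1) ^ (Fintype.card κ - 1) := by
        simpa only [hwidth] using
          card_latticeBox_sdiff_le κ (Nat.mul_le_mul_left q m.le_succ)
    _ ≤ 2 * q * Fintype.card κ * (3 * q * (m + 1)) ^ (Fintype.card κ - 1) := by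
        gcongr
        nlinarith
    _ = _ := by rw [mul_pow]; ring

lemma card_filter_supNorm_ceilDiv_eq_zero_le (hq : 0 < q) (W : Finset (κ → ℤ)) :
    (W.filter fun v => supNorm v ⌈/⌉ q = 0).card ≤ 1 := by
  refine Finset.card_le_one.2 fun v hv w hw => ?_
  simp only [Finset.mem_filter, ceilDiv_eq_zero_iff hq, supNorm_eq_zero] at hv hw
  rw [hv.2, hw.2]

lemma sum_radial_le (hq : 0 < q) {f : ℕ → ℝ} (hf0 : ∀ m, 0 ≤ f m)
    (hf : Summable fun m : ℕ => ((m : ℝ) + 1) ^ (Fintype.card κ - 1) * f (m + 1))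
    (W : Finset (κ → ℤ)) :
    ∑ v ∈ W, f (supNorm v ⌈/⌉ q) ≤ radialSumBound (Fintype.card κ) q f := by
  set A : ℝ := 2 * q * Fintype.card κ * (3 * q) ^ (Fintype.card κ - 1) with hA
  set M := W.sup fun v => supNorm v ⌈/⌉ q
  have hM : ∀ v ∈ W, supNorm v ⌈/⌉ q ∈ Finset.range (M + 1) := fun v hv =>
    Finset.mem_range_succ_iff.2 (Finset.le_sup (f := fun v => supNorm v ⌈/⌉ q) hv)
  have hshell (m : ℕ) : ((W.filter fun v => supNorm v ⌈/⌉ q = m + 1).card : ℝ) ≤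
      A * ((m : ℝ) + 1) ^ (Fintype.card κ - 1) := by
    rw [hA]
    exact_mod_cast card_filter_supNorm_ceilDiv_le hq W m
  have hcentre : ((W.filter fun v => supNorm v ⌈/⌉ q = 0).card : ℝ) ≤ 1 :=
    mod_cast card_filter_supNorm_ceilDiv_eq_zero_le hq W
  rw [← Finset.sum_fiberwise_of_maps_to' hM]
  simp only [Finset.sum_const, nsmul_eq_mul]
  rw [Finset.sum_range_succ', add_comm, radialSumBound]
  refine add_le_add (mul_le_of_le_one_left (hf0 0) hcentre) ?_
  calc _ ≤ ∑ m ∈ Finset.range M, A * (((m : ℝ) + 1) ^ (Fintype.card κ - 1) * f (m + 1)) :=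
        Finset.sum_le_sum fun m _ => by
          rw [← mul_assoc]
          exact mul_le_mul_of_nonneg_right (hshell m) (hf0 _)
    _ = A * ∑ m ∈ Finset.range M, ((m : ℝ) + 1) ^ (Fintype.card κ - 1) * f (m + 1) :=
        (Finset.mul_sum _ _ _).symm
    _ ≤ A * ∑' m : ℕ, ((m : ℝ) + 1) ^ (Fintype.card κ - 1) * f (m + 1) := by
        gcongr
        exact hf.sum_le_tsum _ fun m _ => mul_nonneg (by positivity) (hf0 _)

end LatticeSums

/-- By the pigeonhole principle one of the intervals `[k M / q, (k + 1) M / q)`, with `k < q` and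
`q` the number of indices, contains none of the numbers `r i`. -/
lemma exists_separated {ι : Type*} [Fintype ι] (r : ι → ℕ) {i₀ j₀ : ι}
    {M : ℕ} (hi₀ : r i₀ = 0) (hM : 0 < M) (hj₀ : M ≤ r j₀) :
    ∃ U : ι → Bool, U i₀ ∧ ¬ U j₀ ∧
      ∀ i j, U i → ¬ U j → r i + M ⌈/⌉ Fintype.card ι ≤ r j := by
  classical
  set q := Fintype.card ι
  have hq : 0 < q := Fintype.card_pos_iff.2 ⟨i₀⟩
  have hcard : ((Finset.univ.erase j₀).image fun i => q * r i / M).card < (Finset.range q).card :=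
    Finset.card_image_le.trans_lt <| by
      rw [Finset.card_erase_of_mem (Finset.mem_univ _), Finset.card_univ, Finset.card_range]
      exact Nat.sub_one_lt hq.ne'
  obtain ⟨k, hkq, hk⟩ := Finset.exists_mem_notMem_of_card_lt_card hcard
  have hkM : (k + 1) * M ≤ q * r j₀ :=
    Nat.mul_le_mul (Finset.mem_range.1 hkq) hj₀
  have hgap : ∀ j, k * M ≤ q * r j → (k + 1) * M ≤ q * r j := by
    intro j hj
    by_contra! hlt
    refine hk (Finset.mem_image.2 ⟨j, Finset.mem_erase.2 ⟨?_, Finset.mem_univ _⟩,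
      Nat.div_eq_of_lt_le hj hlt⟩)
    rintro rfl
    exact hlt.not_ge hkM
  refine ⟨fun i => q * r i < k * M, ?_, ?_, fun i j hi hj => ?_⟩
  · simp only [decide_eq_true_eq]
    by_contra! hi
    simpa [hi₀, hM.ne'] using hgap i₀ hi
  · simp only [decide_eq_true_eq, not_lt]
    exact (Nat.mul_le_mul_right M k.le_succ).trans hkM
  · simp only [decide_eq_true_eq, not_lt] at hi hj
    have hij : q * r i + M ≤ q * r j :=
      calc q * r i + M ≤ k * M + M := by gcongr
        _ = (k + 1) * M := (add_one_mul k M).symm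
        _ ≤ q * r j := hgap j hj
    have hle : r i ≤ r j := Nat.le_of_mul_le_mul_left ((Nat.le_add_right _ _).trans hij) hq
    have : M ⌈/⌉ q ≤ r j - r i := by
      rw [ceilDiv_le_iff_le_mul hq, Nat.mul_sub]
      omega
    omega

/-- The positions of the sites `s i` relative to the site `s i₀`, as one integer vector. -/
def relativePositions {ι : Type*} {d : ℕ} (i₀ : ι) (s : ι → Fin d → ℤ) :
    {i // i ≠ i₀} × Fin d → ℤ :=
  fun x => s x.1 x.2 - s i₀ x.2

section PiFinset

variable {ι : Type*} [Fintype ι] [DecidableEq ι] {d : ℕ}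

/-- An `ι`-tuple of sites is determined by one of its sites and the relative positions of the
others, so that fixing the site costs a factor `S.card` only. -/
lemma sum_piFinset_radial_le {f : ℕ → ℝ} (hf0 : ∀ m, 0 ≤ f m)
    (hf : Summable fun m : ℕ => ((m : ℝ) + 1) ^ ((Fintype.card ι - 1) * d - 1) * f (m + 1))
    (i₀ : ι) (S : Finset (Fin d → ℤ)) :
    ∑ s ∈ Fintype.piFinset fun _ : ι => S,
      f (supNorm (relativePositions i₀ s) ⌈/⌉ Fintype.card ι) ≤
      radialSumBound ((Fintype.card ι - 1) * d) (Fintype.card ι) f * S.card := by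
  set φ : (ι → Fin d → ℤ) → (Fin d → ℤ) × ({i // i ≠ i₀} × Fin d → ℤ) :=
    fun s => (s i₀, relativePositions i₀ s)
  have hφ : Function.Injective φ := by
    intro s s' h
    obtain ⟨h_base, h_rel⟩ := Prod.mk.inj h
    funext i j
    by_cases hi : i = i₀
    · rw [hi, h_base]
    · have := congrFun h_rel (⟨i, hi⟩, j)
      simp only [relativePositions, h_base] at this
      omega
  set W := (Fintype.piFinset fun _ : ι => S).image (relativePositions i₀)
  have hcard : Fintype.card ({i // i ≠ i₀} × Fin d) = (Fintype.card ι - 1) * d := by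
    simp [Fintype.card_prod, Fintype.card_subtype_compl]
  calc _ = ∑ y ∈ (Fintype.piFinset fun _ : ι => S).image φ, f (supNorm y.2 ⌈/⌉ Fintype.card ι) := by
        rw [Finset.sum_image hφ.injOn]
    _ ≤ ∑ y ∈ S ×ˢ W, f (supNorm y.2 ⌈/⌉ Fintype.card ι) := by
        refine Finset.sum_le_sum_of_subset_of_nonneg (fun y hy => ?_) fun _ _ _ => hf0 _
        obtain ⟨s, hs, rfl⟩ := Finset.mem_image.1 hy
        exact Finset.mem_product.2 ⟨Fintype.mem_piFinset.1 hs i₀, Finset.mem_image_of_mem _ hs⟩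
    _ = S.card * ∑ v ∈ W, f (supNorm v ⌈/⌉ Fintype.card ι) := by
        simp only [Finset.sum_product, Finset.sum_const, nsmul_eq_mul]
    _ ≤ S.card * radialSumBound ((Fintype.card ι - 1) * d) (Fintype.card ι) f := by
        gcongr
        rw [← hcard] at hf ⊢
        exact sum_radial_le (Fintype.card_pos_iff.2 ⟨i₀⟩) hf0 hf W
    _ = _ := mul_comm _ _

lemma sum_piFinset_mul_subtype {E : Type*} (q : ι → Prop) [DecidablePred q] (S : Finset E)
    (F : ({i // q i} → E) → ℝ) (G : ({i // ¬ q i} → E) → ℝ) :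
    ∑ s ∈ Fintype.piFinset fun _ : ι => S, F (fun i => s i) * G (fun i => s i) =
      (∑ s ∈ Fintype.piFinset fun _ : {i // q i} => S, F s) *
        ∑ s ∈ Fintype.piFinset fun _ : {i // ¬ q i} => S, G s := by
  rw [Finset.sum_mul_sum, ← Finset.sum_product']
  refine Finset.sum_equiv (Equiv.piEquivPiSubtypeProd q fun _ => E) (fun s => ?_) fun s _ => rfl
  simp only [Fintype.mem_piFinset, Finset.mem_product, Equiv.piEquivPiSubtypeProd,
    Equiv.coe_fn_mk, Subtype.forall]
  exact ⟨fun h => ⟨fun i _ => h i, fun i _ => h i⟩,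
    fun h i => if hi : q i then h.1 i hi else h.2 i hi⟩

end PiFinset

/-- A centred family of random fields on `ℤ^d` whose mixed moments of order at most `Q` are
bounded by `f 0` and factorize up to `f m` when the sites split into groups at distance `m`. -/
structure IsWeaklyDependent {d : ℕ} {κ Ω : Type*} [MeasurableSpace Ω] (P : Measure Ω)
    (X : κ → (Fin d → ℤ) → Ω → ℝ) (Q : ℕ) (f : ℕ → ℝ) : Prop where
  nonneg : ∀ m, 0 ≤ f m
  summable : Summable fun m : ℕ => ((m : ℝ) + 1) ^ ((Q - 1) * d - 1) * f (m + 1)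
  mean_zero : ∀ c k, ∫ ω, X c k ω ∂P = 0
  integrable : ∀ (ι : Type) [Fintype ι] (c : ι → κ) (s : ι → Fin d → ℤ), Fintype.card ι ≤ Q →
    Integrable (fun ω => ∏ i, X (c i) (s i) ω) P
  bound : ∀ (ι : Type) [Fintype ι] (c : ι → κ) (s : ι → Fin d → ℤ), Fintype.card ι ≤ Q →
    |∫ ω, ∏ i, X (c i) (s i) ω ∂P| ≤ f 0
  split : ∀ (ι : Type) [Fintype ι] (c : ι → κ) (s : ι → Fin d → ℤ) (q : ι → Prop)
    [DecidablePred q] (m : ℕ), Fintype.card ι ≤ Q → 1 ≤ m →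
    (∀ i j, q i → ¬ q j → m ≤ supNorm (s j - s i)) →
    |(∫ ω, ∏ i, X (c i) (s i) ω ∂P) - (∫ ω, ∏ i : {i // q i}, X (c i) (s i) ω ∂P) *
      ∫ ω, ∏ i : {i // ¬ q i}, X (c i) (s i) ω ∂P| ≤ f m

/-- The absolute mixed moments of order `n`, summed over all `n`-tuples of sites in a set of `N`
sites, are at most `C * N ^ ⌊n / 2⌋`. -/
def HasMomentSumBound {d : ℕ} {κ Ω : Type*} [MeasurableSpace Ω] (P : Measure Ω)
    (X : κ → (Fin d → ℤ) → Ω → ℝ) (n : ℕ) (C : ℝ) : Prop :=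
  ∀ (ι : Type) [Fintype ι] [DecidableEq ι], Fintype.card ι = n → ∀ (c : ι → κ)
    (S : Finset (Fin d → ℤ)), S.Nonempty →
    ∑ s ∈ Fintype.piFinset fun _ : ι => S, |∫ ω, ∏ i, X (c i) (s i) ω ∂P| ≤
      C * (S.card : ℝ) ^ (n / 2)

section MomentSums

variable {d : ℕ} {κ Ω : Type*} [MeasurableSpace Ω] {P : Measure Ω}
  {X : κ → (Fin d → ℤ) → Ω → ℝ} {Q n : ℕ} {f : ℕ → ℝ} {C : ℝ}

lemma HasMomentSumBound.mono {C' : ℝ} (h : HasMomentSumBound P X n C) (hC : C ≤ C') :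
    HasMomentSumBound P X n C' := fun ι _ _ hι c S hS =>
  (h ι hι c S hS).trans (by gcongr)

lemma HasMomentSumBound.sum_mul_subtype_le {ι : Type} [Fintype ι] [DecidableEq ι] {U : ι → Bool}
    (hC : 0 ≤ C) (h₁ : HasMomentSumBound P X (Fintype.card {i // U i}) C)
    (h₂ : HasMomentSumBound P X (Fintype.card {i // ¬ U i}) C) (c : ι → κ)
    {S : Finset (Fin d → ℤ)} (hS : S.Nonempty) :
    ∑ s ∈ Fintype.piFinset fun _ : ι => S,
      |∫ ω, ∏ i : {i // U i}, X (c i) (s i) ω ∂P| *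
        |∫ ω, ∏ i : {i // ¬ U i}, X (c i) (s i) ω ∂P| ≤
      C ^ 2 * (S.card : ℝ) ^ (Fintype.card ι / 2) := by
  have hN : (1 : ℝ) ≤ S.card := mod_cast hS.card_pos
  have hle : Fintype.card {i // U i} / 2 + Fintype.card {i // ¬ U i} / 2 ≤ Fintype.card ι / 2 := by
    have := Fintype.card_subtype_compl fun i => U i = true
    have := Fintype.card_subtype_le fun i => U i = true
    omega
  rw [sum_piFinset_mul_subtype (fun i => U i = true) S
    (fun s => |∫ ω, ∏ i : {i // U i}, X (c i) (s i) ω ∂P|)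
    (fun s => |∫ ω, ∏ i : {i // ¬ U i}, X (c i) (s i) ω ∂P|)]
  calc _ ≤ (C * (S.card : ℝ) ^ (Fintype.card {i // U i} / 2)) *
        (C * (S.card : ℝ) ^ (Fintype.card {i // ¬ U i} / 2)) :=
        mul_le_mul (h₁ _ rfl (fun i => c i) S hS) (h₂ _ rfl (fun i => c i) S hS)
          (Finset.sum_nonneg fun _ _ => abs_nonneg _) (by positivity)
    _ = C ^ 2 * (S.card : ℝ) ^ (Fintype.card {i // U i} / 2 + Fintype.card {i // ¬ U i} / 2) := by
        rw [pow_add]; ring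
    _ ≤ C ^ 2 * (S.card : ℝ) ^ (Fintype.card ι / 2) := by
        gcongr

namespace IsWeaklyDependent

lemma summable_of_le (h : IsWeaklyDependent P X Q f) (hn : n ≤ Q) :
    Summable fun m : ℕ => ((m : ℝ) + 1) ^ ((n - 1) * d - 1) * f (m + 1) := by
  refine h.summable.of_nonneg_of_le (fun m => mul_nonneg (by positivity) (h.nonneg _)) fun m => ?_
  gcongr
  · exact h.nonneg _
  · linarith [m.cast_nonneg (α := ℝ)]

/-- The sites in `U` are far from those outside `U`: `U` comes from a gap in the distances to
`s i₀`. -/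
lemma exists_abs_integral_prod_le (h : IsWeaklyDependent P X Q f) {ι : Type} [Fintype ι]
    [DecidableEq ι] (hι : Fintype.card ι ≤ Q) (i₀ : ι) (c : ι → κ) (s : ι → Fin d → ℤ)
    (hs : supNorm (relativePositions i₀ s) ≠ 0) :
    ∃ U : ι → Bool, (∃ i, U i) ∧ (∃ i, ¬ U i) ∧
      |∫ ω, ∏ i, X (c i) (s i) ω ∂P| ≤
        f (supNorm (relativePositions i₀ s) ⌈/⌉ Fintype.card ι) +
          |∫ ω, ∏ i : {i // U i}, X (c i) (s i) ω ∂P| *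
            |∫ ω, ∏ i : {i // ¬ U i}, X (c i) (s i) ω ∂P| := by
  have hq : 0 < Fintype.card ι := Fintype.card_pos_iff.2 ⟨i₀⟩
  have : Nonempty ({i // i ≠ i₀} × Fin d) := by
    by_contra hempty
    rw [not_nonempty_iff] at hempty
    exact hs (supNorm_eq_zero.2 (Subsingleton.elim _ _))
  obtain ⟨⟨⟨j₀, _⟩, b⟩, hj₀⟩ := exists_natAbs_eq_supNorm (relativePositions i₀ s)
  obtain ⟨U, hi₀U, hj₀U, hU⟩ := exists_separated (fun i => supNorm (s i - s i₀))
    (i₀ := i₀) (j₀ := j₀) (by simp [supNorm_eq_zero]) (Nat.pos_of_ne_zero hs)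
    (hj₀.ge.trans (natAbs_le_supNorm (s j₀ - s i₀) b))
  refine ⟨U, ⟨i₀, hi₀U⟩, ⟨j₀, hj₀U⟩, ?_⟩
  have hsplit := h.split ι c s (fun i => U i = true)
    (supNorm (relativePositions i₀ s) ⌈/⌉ Fintype.card ι) hι
    (Nat.one_le_iff_ne_zero.2 ((ceilDiv_eq_zero_iff hq).not.2 hs)) fun i j hi hj => by
      have htriangle := supNorm_add_le (s j - s i) (s i - s i₀)
      rw [sub_add_sub_cancel] at htriangle
      have := hU i j hi hj
      omega
  rw [← abs_mul]
  exact tsub_le_iff_right.1 ((abs_sub_abs_le_abs_sub _ _).trans hsplit)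

lemma abs_integral_prod_le (h : IsWeaklyDependent P X Q f) {ι : Type} [Fintype ι]
    [DecidableEq ι] (hι : Fintype.card ι ≤ Q) (i₀ : ι) (c : ι → κ) (s : ι → Fin d → ℤ) :
    |∫ ω, ∏ i, X (c i) (s i) ω ∂P| ≤
      f (supNorm (relativePositions i₀ s) ⌈/⌉ Fintype.card ι) +
        ∑ U : ι → Bool with (∃ i, U i) ∧ ∃ i, ¬ U i,
          |∫ ω, ∏ i : {i // U i}, X (c i) (s i) ω ∂P| *
            |∫ ω, ∏ i : {i // ¬ U i}, X (c i) (s i) ω ∂P| := by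
  by_cases hs : supNorm (relativePositions i₀ s) = 0
  · rw [hs, zero_ceilDiv]
    exact (h.bound ι c s hι).trans (le_add_of_nonneg_right
      (Finset.sum_nonneg fun _ _ => by positivity))
  · obtain ⟨U, hU, hU', hle⟩ := h.exists_abs_integral_prod_le hι i₀ c s hs
    refine hle.trans ?_
    gcongr
    exact Finset.single_le_sum (f := fun U : ι → Bool =>
      |∫ ω, ∏ i : {i // U i}, X (c i) (s i) ω ∂P| *
        |∫ ω, ∏ i : {i // ¬ U i}, X (c i) (s i) ω ∂P|) (fun _ _ => by positivity)
      (Finset.mem_filter.2 ⟨Finset.mem_univ U, hU, hU'⟩)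

lemma hasMomentSumBound_one (h : IsWeaklyDependent P X Q f) : HasMomentSumBound P X 1 0 := by
  intro ι _ _ hι c S _
  obtain ⟨i₀, hi₀⟩ := Fintype.card_eq_one_iff.1 hι
  have : Unique ι := ⟨⟨i₀⟩, hi₀⟩
  simp [h.mean_zero]

lemma hasMomentSumBound_of_lt (h : IsWeaklyDependent P X Q f) (hn2 : 2 ≤ n) (hn : n ≤ Q)
    (hC0 : 0 ≤ C) (hC : ∀ k, 1 ≤ k → k < n → HasMomentSumBound P X k C) :
    HasMomentSumBound P X n (radialSumBound ((n - 1) * d) n f + 2 ^ n * C ^ 2) := by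
  rintro ι _ _ rfl c S hS
  obtain ⟨i₀⟩ : Nonempty ι := Fintype.card_pos_iff.1 (by omega)
  have hN : (1 : ℝ) ≤ S.card := mod_cast hS.card_pos
  have hR0 : 0 ≤ radialSumBound ((Fintype.card ι - 1) * d) (Fintype.card ι) f :=
    add_nonneg (h.nonneg 0) (mul_nonneg (by positivity)
      (tsum_nonneg fun m => mul_nonneg (by positivity) (h.nonneg _)))
  have hpart : ∀ U ∈ Finset.univ.filter fun U : ι → Bool => (∃ i, U i) ∧ ∃ i, ¬ U i,
      ∑ s ∈ Fintype.piFinset fun _ : ι => S,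
        |∫ ω, ∏ i : {i // U i}, X (c i) (s i) ω ∂P| *
          |∫ ω, ∏ i : {i // ¬ U i}, X (c i) (s i) ω ∂P| ≤
        C ^ 2 * (S.card : ℝ) ^ (Fintype.card ι / 2) := by
    intro U hU
    obtain ⟨-, ⟨i, hi⟩, j, hj⟩ := Finset.mem_filter.1 hU
    have hlt := Fintype.card_subtype_lt (p := fun i => U i = true) hj
    have hlt' := Fintype.card_subtype_lt (p := fun i => ¬ U i = true) (not_not.2 hi)
    exact HasMomentSumBound.sum_mul_subtype_le hC0
      (hC _ (Fintype.card_pos_iff.2 ⟨⟨i, hi⟩⟩) hlt) (hC _ (Fintype.card_pos_iff.2 ⟨⟨j, hj⟩⟩) hlt')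
      c hS
  have hparts : ((Finset.univ.filter fun U : ι → Bool => (∃ i, U i) ∧ ∃ i, ¬ U i).card : ℝ) ≤
      2 ^ Fintype.card ι := by
    exact_mod_cast (Finset.card_filter_le _ _).trans_eq (by simp)
  grw [Finset.sum_le_sum fun s _ => h.abs_integral_prod_le hn i₀ c s, Finset.sum_add_distrib,
    sum_piFinset_radial_le h.nonneg (h.summable_of_le hn) i₀ S, Finset.sum_comm,
    Finset.sum_le_sum hpart, Finset.sum_const, nsmul_eq_mul, hparts, add_mul, mul_assoc (2 ^ _)]
  gcongr
  exact le_self_pow₀ hN (by omega)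

theorem exists_hasMomentSumBound (h : IsWeaklyDependent P X Q f) (n : ℕ) (hn1 : 1 ≤ n)
    (hn : n ≤ Q) : ∃ C, 0 ≤ C ∧ HasMomentSumBound P X n C := by
  induction n using Nat.strong_induction_on with
  | _ n ih =>
  obtain rfl | hn2 := hn1.eq_or_lt
  · exact ⟨0, le_rfl, h.hasMomentSumBound_one⟩
  · have ih' : ∀ k, ∃ C, 0 ≤ C ∧ (1 ≤ k → k < n → HasMomentSumBound P X k C) := fun k => by
      by_cases hk : 1 ≤ k ∧ k < n
      · obtain ⟨C, hC0, hC⟩ := ih k hk.2 hk.1 (hk.2.le.trans hn)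
        exact ⟨C, hC0, fun _ _ => hC⟩
      · exact ⟨0, le_rfl, fun h1 h2 => absurd ⟨h1, h2⟩ hk⟩
    choose C hC0 hC using ih'
    have hB : ∀ k, k < n → C k ≤ ∑ k ∈ Finset.range n, C k := fun k hk =>
      Finset.single_le_sum (fun k _ => hC0 k) (Finset.mem_range.2 hk)
    have hn_bound := h.hasMomentSumBound_of_lt hn2 hn (Finset.sum_nonneg fun k _ => hC0 k)
      fun k hk hkn => (hC k hk hkn).mono (hB k hkn)
    exact ⟨_, le_max_left _ _, hn_bound.mono (le_max_right 0 _)⟩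

end IsWeaklyDependent

end MomentSums

/-! ### Stationary mixing fields are weakly dependent -/

/-- The coordinates of the centred field `Z - μ`. -/
noncomputable def centered {d p : ℕ} {Ω : Type*} [MeasurableSpace Ω] (P : Measure Ω)
    (Z : (Fin d → ℤ) → Ω → EuclideanSpace ℝ (Fin p)) (c : Fin p) (k : Fin d → ℤ) (ω : Ω) : ℝ :=
  Z k ω c - fieldMean P Z c

lemma measurable_centered {d p : ℕ} {Ω : Type*} {m _ : MeasurableSpace Ω} {P : Measure Ω}
    {Z : (Fin d → ℤ) → Ω → EuclideanSpace ℝ (Fin p)} {k : Fin d → ℤ} (hZ : Measurable[m] (Z k))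
    (c : Fin p) : Measurable[m] (centered P Z c k) :=
  ((EuclideanSpace.proj (𝕜 := ℝ) c).continuous.measurable.comp hZ).sub_const _

section Field

variable {d p : ℕ} {Ω : Type*} [MeasurableSpace Ω] {P : Measure Ω}
  {Z : (Fin d → ℤ) → Ω → EuclideanSpace ℝ (Fin p)}

lemma IsStationary.identDistrib_pair (hstat : IsStationary P Z) (hZ : ∀ k, Measurable (Z k))
    (j k : Fin d → ℤ) :
    IdentDistrib (fun ω => (Z j ω, Z k ω)) (fun ω => (Z 0 ω, Z (k - j) ω)) P P where
  aemeasurable_fst := ((hZ j).prodMk (hZ k)).aemeasurable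
  aemeasurable_snd := ((hZ 0).prodMk (hZ (k - j))).aemeasurable
  map_eq := by
    have hπ : Measurable fun z : (Fin d → ℤ) → EuclideanSpace ℝ (Fin p) => (z 0, z (k - j)) := by
      fun_prop
    have hmap := congrArg (Measure.map fun z => (z 0, z (k - j))) (hstat j)
    rw [Measure.map_map hπ (measurable_pi_lambda _ fun i => hZ (i + j)),
      Measure.map_map hπ (measurable_pi_lambda _ fun i => hZ i)] at hmap
    simpa only [Function.comp_def, zero_add, sub_add_cancel] using hmap

lemma IsStationary.identDistrib (hstat : IsStationary P Z) (hZ : ∀ k, Measurable (Z k))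
    (k : Fin d → ℤ) : IdentDistrib (Z k) (Z 0) P P :=
  (hstat.identDistrib_pair hZ k 0).comp measurable_fst

lemma IsStationary.memLp_of_integrable_rpow (hstat : IsStationary P Z)
    (hZ : ∀ k, Measurable (Z k)) {s : ℝ} (hs : 0 < s)
    (hint : Integrable (fun ω => ‖Z 0 ω‖ ^ s) P) (k : Fin d → ℤ) :
    MemLp (Z k) (ENNReal.ofReal s) P := by
  rw [(hstat.identDistrib hZ k).memLp_iff,
    ← integrable_norm_rpow_iff (hZ 0).aestronglyMeasurable (by simpa using hs)
      ENNReal.ofReal_ne_top, ENNReal.toReal_ofReal hs.le]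
  exact hint

lemma IsStationary.identDistrib_centered (hstat : IsStationary P Z) (hZ : ∀ k, Measurable (Z k))
    (c : Fin p) (k : Fin d → ℤ) : IdentDistrib (centered P Z c k) (centered P Z c 0) P P :=
  (hstat.identDistrib hZ k).comp (u := fun z : EuclideanSpace ℝ (Fin p) => z c - fieldMean P Z c)
    (by fun_prop)

section Moments

variable [IsProbabilityMeasure P]

lemma IsStationary.integral_centered (hstat : IsStationary P Z) (hZ : ∀ k, Measurable (Z k))
    (hint : Integrable (Z 0) P) (c : Fin p) (k : Fin d → ℤ) :
    ∫ ω, centered P Z c k ω ∂P = 0 := by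
  have hcoord : Integrable (fun ω => Z 0 ω c) P :=
    (EuclideanSpace.proj (𝕜 := ℝ) c).integrable_comp hint
  have hmean : ∫ ω, Z 0 ω c ∂P = fieldMean P Z c :=
    (EuclideanSpace.proj (𝕜 := ℝ) c).integral_comp_comm hint
  rw [(hstat.identDistrib_centered hZ c k).integral_eq]
  unfold centered
  rw [integral_sub hcoord (integrable_const _), hmean, integral_const]
  simp

lemma IsStationary.hasMomentBound_centered (hstat : IsStationary P Z)
    (hZ : ∀ k, Measurable (Z k)) {s : ℝ} (hs : 0 < s) (hLp : ∀ k, MemLp (Z k) (.ofReal s) P) :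
    HasMomentBound P (fun x : Fin p × (Fin d → ℤ) => centered P Z x.1 x.2) s
      (∑ c, ∫ ω, |centered P Z c 0 ω| ^ s ∂P) where
  measurable x := measurable_centered (hZ x.2) x.1
  integrable x := by
    have hx : MemLp (centered P Z x.1 x.2) (.ofReal s) P :=
      ((EuclideanSpace.proj (𝕜 := ℝ) x.1).comp_memLp' (hLp x.2)).sub (memLp_const _)
    simpa only [ENNReal.toReal_ofReal hs.le, Real.norm_eq_abs] using
      hx.integrable_norm_rpow (by simpa using hs) ENNReal.ofReal_ne_top
  integral_le x :=
    calc ∫ ω, |centered P Z x.1 x.2 ω| ^ s ∂P = ∫ ω, |centered P Z x.1 0 ω| ^ s ∂P :=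
          ((hstat.identDistrib_centered hZ x.1 x.2).comp
            (measurable_id.abs.pow_const s)).integral_eq
      _ ≤ _ := Finset.single_le_sum (f := fun c => ∫ ω, |centered P Z c 0 ω| ^ s ∂P)
          (fun c _ => integral_nonneg fun ω => by positivity) (Finset.mem_univ x.1)

end Moments

/-- A common bound for the mixed moments of order at most `Q` of variables whose absolute moments
of order `s` are at most `K`, at `m = 0`, and for the error of factorizing these moments across a
gap of length `m ≥ 1`, where `θ = (s - Q) / s`. -/
noncomputable def mixedMomentBound (Q : ℕ) (K θ : ℝ) (α₁ g : ℝ → ℝ) (m : ℕ) : ℝ :=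
  if m = 0 then 1 + Q * K else (4 + 3 * (1 + Q * K) ^ 2) * (α₁ m * g Q) ^ θ

section Mixing

variable {α₁ g : ℝ → ℝ} {Q m : ℕ} {δ : ℝ}

lemma AssumptionA3.mixing_nonneg (hA3 : AssumptionA3 P Z α₁ g) (hQ : 1 ≤ Q) (hm : m ≠ 0) :
    0 ≤ α₁ m * g Q :=
  mul_nonneg (hA3.alpha_nonneg _ (by positivity))
    (hA3.g_nonneg _ (Nat.cast_pos.2 hQ))

lemma AssumptionA3.summable_mixedMomentBound (hA3 : AssumptionA3 P Z α₁ g) (hQ : 1 ≤ Q) {e : ℕ}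
    (K θ : ℝ) (hsum : Summable fun m : ℕ => ((m : ℝ) + 1) ^ e * α₁ ((m : ℝ) + 1) ^ θ) :
    Summable fun m : ℕ => ((m : ℝ) + 1) ^ e * mixedMomentBound Q K θ α₁ g (m + 1) := by
  refine (hsum.mul_left ((4 + 3 * (1 + Q * K) ^ 2) * g Q ^ θ)).congr fun m => ?_
  rw [mixedMomentBound, if_neg m.succ_ne_zero, Nat.cast_add_one,
    Real.mul_rpow (hA3.alpha_nonneg _ (by positivity)) (hA3.g_nonneg _ (Nat.cast_pos.2 hQ))]
  ring

variable [IsProbabilityMeasure P]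

lemma AssumptionA3.hasMixingBound (hA3 : AssumptionA3 P Z α₁ g) {ι : Type*} [Fintype ι]
    (x : ι → Fin d → ℤ) (q : ι → Prop) (hQ : 1 ≤ Q) (hι : Fintype.card ι ≤ Q) (hm : m ≠ 0)
    (hdist : ∀ i j, q i → ¬ q j → m ≤ supNorm (x j - x i)) :
    HasMixingBound P (sigmaField Z (x '' {i | q i})) (sigmaField Z (x '' {i | ¬ q i}))
      (α₁ m * g Q) := by
  classical
  have hcard (u : ι → Prop) : (((Finset.univ.filter u).image x).card : ℝ) ≤ Q :=
    mod_cast Finset.card_image_le.trans ((Finset.card_filter_le _ _).trans hι)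
  have himage (u : ι → Prop) : ((Finset.univ.filter u).image x : Set (Fin d → ℤ)) =
      x '' {i | u i} := by simp
  have hdis : DisGE (x '' {i | q i}) (x '' {i | ¬ q i}) m := by
    rintro _ ⟨i, hi, rfl⟩ _ ⟨j, hj, rfl⟩
    rw [dist_comm]
    exact (Nat.cast_le.2 (hdist i j hi hj)).trans (supNorm_sub_le_dist _ _)
  intro S T hS hT
  refine (hasMixingBound_alphaTilde P Z _ _ S T hS hT).trans ?_
  rw [← himage, ← himage] at hdis ⊢
  exact (alphaTilde_le_mixingCoeff P Z (hcard _) (hcard _) hdis).trans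
    (hA3.bound _ _ (by positivity) (Nat.cast_pos.2 hQ))

theorem AssumptionA3.isWeaklyDependent (hA3 : AssumptionA3 P Z α₁ g) (hstat : IsStationary P Z)
    (hZ : ∀ k, Measurable (Z k)) (hQ : 1 ≤ Q) (hδ : 0 < δ)
    (hLp : ∀ k, MemLp (Z k) (.ofReal (Q + δ)) P)
    (hsum : Summable fun m : ℕ =>
      ((m : ℝ) + 1) ^ ((Q - 1) * d - 1) * α₁ ((m : ℝ) + 1) ^ (δ / (Q + δ))) :
    IsWeaklyDependent P (centered P Z) Q
      (mixedMomentBound Q (∑ c, ∫ ω, |centered P Z c 0 ω| ^ (Q + δ) ∂P) (δ / (Q + δ)) α₁ g) := by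
  set K := ∑ c, ∫ ω, |centered P Z c 0 ω| ^ (Q + δ) ∂P
  have hK : 0 ≤ K := Finset.sum_nonneg fun c _ => integral_nonneg fun ω => by positivity
  have hQ1 : (1 : ℝ) ≤ Q := mod_cast hQ
  have hX := hstat.hasMomentBound_centered hZ (by positivity) hLp
  have hcard {ι : Type} [Fintype ι] (hι : Fintype.card ι ≤ Q) : (Fintype.card ι : ℝ) ≤ Q :=
    mod_cast hι
  have hZint : Integrable (Z 0) P :=
    (hLp 0).integrable (ENNReal.one_le_ofReal.2 (by linarith))
  refine ⟨fun m => ?_, hA3.summable_mixedMomentBound hQ K _ hsum,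
    hstat.integral_centered hZ hZint, fun ι _ c x hι => ?_, fun ι _ c x hι => ?_,
    fun ι _ c x q _ m hι hm hdist => ?_⟩
  · unfold mixedMomentBound
    split_ifs with hm
    · positivity
    · have := hA3.mixing_nonneg hQ hm
      positivity
  · exact (hX.comp fun i => (c i, x i)).integrable_prod (by linarith [hcard hι])
  · rw [mixedMomentBound, if_pos rfl]
    grw [(hX.comp fun i => (c i, x i)).abs_integral_prod_le (by linarith [hcard hι]), hι]
  · have hm0 : m ≠ 0 := Nat.one_le_iff_ne_zero.1 hm
    have hmix := hA3.hasMixingBound x q hQ hι hm0 hdist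
    have hα := hA3.mixing_nonneg hQ hm0
    have hmeas {u : ι → Prop} (i : ι) (hi : u i) :
        Measurable[sigmaField Z (x '' {i | u i})] (centered P Z (c i) (x i)) :=
      measurable_centered (measurable_sigmaField
        (Set.mem_image_of_mem x (show i ∈ {i | u i} from hi))) (c i)
    refine (hmix.abs_integral_prod_sub_mul_le (X := fun i => centered P Z (c i) (x i))
      (sigmaField_le hZ _) (sigmaField_le hZ _) hmeas hmeas (hX.comp fun i => (c i, x i)) hK
      (by positivity) (by linarith [hcard hι]) hα).trans ?_
    rw [mixedMomentBound, if_neg hm0]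
    gcongr

end Mixing

section ConditionM

variable {α₁ g : ℝ → ℝ} {r : ℕ}

lemma ConditionM.memLp [IsFiniteMeasure P] (hM : ConditionM P Z α₁ g r)
    (hstat : IsStationary P Z) (hZ : ∀ k, Measurable (Z k)) (k : Fin d → ℤ) :
    MemLp (Z k) (2 * r : ℕ) P := by
  obtain ⟨δ, -, -, hδ, -, -, -, -, hint, -, -⟩ := hM
  refine (hstat.memLp_of_integrable_rpow hZ (by positivity) hint k).mono_exponent ?_
  rw [← ENNReal.ofReal_natCast, Nat.cast_mul, Nat.cast_two]
  exact ENNReal.ofReal_le_ofReal (by linarith)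

theorem ConditionM.exists_isWeaklyDependent [NeZero d] [IsProbabilityMeasure P]
    (hM : ConditionM P Z α₁ g r) (hstat : IsStationary P Z) (hZ : ∀ k, Measurable (Z k))
    (hA3 : AssumptionA3 P Z α₁ g) (hr : 1 ≤ r) :
    ∃ f, IsWeaklyDependent P (centered P Z) (2 * r) f := by
  obtain ⟨δ, -, -, hδ, -, -, -, -, hint, hsum, -⟩ := hM
  have hexp : (2 * (r : ℝ) - 1) * d - 1 = ((2 * r - 1) * d - 1 : ℕ) := by
    have : 1 ≤ (2 * r - 1) * d :=
      one_le_mul (by omega) (Nat.one_le_iff_ne_zero.2 (NeZero.ne d))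
    push_cast [this, (by omega : 1 ≤ 2 * r)]
    ring
  have hcast : (2 : ℝ) * r = (2 * r : ℕ) := by push_cast; ring
  simp only [hexp, Real.rpow_natCast] at hsum
  rw [hcast] at hint
  simp only [hcast] at hsum
  exact ⟨_, hA3.isWeaklyDependent hstat hZ (by omega) hδ
    (hstat.memLp_of_integrable_rpow hZ (by positivity) hint) hsum⟩

end ConditionM

end Field

section WeakDependence

variable {d : ℕ} {κ Ω : Type*} [MeasurableSpace Ω] {P : Measure Ω}
  {X : κ → (Fin d → ℤ) → Ω → ℝ} {Q : ℕ} {f : ℕ → ℝ}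

lemma IsWeaklyDependent.abs_integral_mul_le (h : IsWeaklyDependent P X Q f) (hQ : 2 ≤ Q)
    (a b : κ) (j k : Fin d → ℤ) :
    |∫ ω, X a j ω * X b k ω ∂P| ≤ f (supNorm (k - j)) := by
  have hprod (ω) : X a j ω * X b k ω = ∏ i : Fin 2, X (![a, b] i) (![j, k] i) ω := by
    simp [Fin.prod_univ_two]
  simp only [hprod]
  obtain h0 | h0 := Nat.eq_zero_or_pos (supNorm (k - j))
  · rw [h0]
    exact h.bound (Fin 2) ![a, b] ![j, k] (by simpa using hQ)
  · have hsplit := h.split (Fin 2) ![a, b] ![j, k] (· = 0) _ (by simpa using hQ) h0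
      fun u v hu hv => by
        obtain rfl : v = 1 := by omega
        simp [hu]
    have hmean (_ : Fintype {i : Fin 2 // i = 0}) :
        ∫ ω, ∏ i : {i : Fin 2 // i = 0}, X (![a, b] i) (![j, k] i) ω ∂P = 0 := by
      rw [← h.mean_zero a j]
      exact integral_congr_ae (.of_forall fun ω => Fintype.prod_subsingleton _
        (⟨0, rfl⟩ : {i : Fin 2 // i = 0}))
    rwa [hmean, zero_mul, sub_zero] at hsplit

lemma IsWeaklyDependent.exists_sum_weighted_le [NeZero d] (h : IsWeaklyDependent P X Q f)
    (hQ : 3 ≤ Q) :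
    ∃ C, ∀ W : Finset (Fin d → ℤ), ∑ k ∈ W, ((supNorm k : ℝ) + 1) * f (supNorm k) ≤ C := by
  have hd : d - 1 + 1 ≤ (Q - 1) * d - 1 := by
    have := Nat.one_le_iff_ne_zero.2 (NeZero.ne d)
    have := Nat.mul_le_mul_right d (show 2 ≤ Q - 1 by omega)
    omega
  have hsum : Summable fun m : ℕ =>
      ((m : ℝ) + 1) ^ (d - 1) * ((((m + 1 : ℕ) : ℝ) + 1) * f (m + 1)) := by
    refine (h.summable.mul_left 2).of_nonneg_of_le (fun m => ?_) fun m => ?_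
    · have := h.nonneg (m + 1)
      positivity
    · have := h.nonneg (m + 1)
      calc ((m : ℝ) + 1) ^ (d - 1) * ((((m + 1 : ℕ) : ℝ) + 1) * f (m + 1))
          ≤ ((m : ℝ) + 1) ^ (d - 1) * ((2 * ((m : ℝ) + 1)) * f (m + 1)) := by
            gcongr
            push_cast
            linarith [m.cast_nonneg (α := ℝ)]
        _ = 2 * (((m : ℝ) + 1) ^ (d - 1 + 1) * f (m + 1)) := by ring
        _ ≤ 2 * (((m : ℝ) + 1) ^ ((Q - 1) * d - 1) * f (m + 1)) := by
            gcongr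
            linarith [m.cast_nonneg (α := ℝ)]
  refine ⟨radialSumBound d 1 fun m => ((m : ℝ) + 1) * f m, fun W => ?_⟩
  simpa using sum_radial_le one_pos (f := fun m => ((m : ℝ) + 1) * f m)
    (fun m => mul_nonneg (by positivity) (h.nonneg m)) (by simpa using hsum) W

lemma IsWeaklyDependent.integrable_prod_sum (h : IsWeaklyDependent P X Q f) {n : ℕ} (hn : n ≤ Q)
    (c : Fin n → κ) (S : Finset (Fin d → ℤ)) :
    Integrable (fun ω => ∏ i, ∑ k ∈ S, X (c i) k ω) P := by
  simp only [Finset.prod_univ_sum]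
  exact integrable_finsetSum _ fun s _ => h.integrable (Fin n) c s (by simpa using hn)

/-- Only tuples of sites in which every site has a near neighbour contribute, and there are
`O(N ^ ⌊n / 2⌋)` of them. -/
lemma IsWeaklyDependent.exists_abs_integral_prod_sum_le (h : IsWeaklyDependent P X Q f) {n : ℕ}
    (hn1 : 1 ≤ n) (hn : n ≤ Q) :
    ∃ C, 0 ≤ C ∧ ∀ (c : Fin n → κ) (S : Finset (Fin d → ℤ)), S.Nonempty →
      |∫ ω, ∏ i, ∑ k ∈ S, X (c i) k ω ∂P| ≤ C * (S.card : ℝ) ^ (n / 2) := by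
  obtain ⟨C, hC0, hC⟩ := h.exists_hasMomentSumBound n hn1 hn
  refine ⟨C, hC0, fun c S hS => ?_⟩
  simp only [Finset.prod_univ_sum]
  rw [integral_finsetSum _ fun s _ => h.integrable (Fin n) c s (by simpa using hn)]
  exact (Finset.abs_sum_le_sum_abs _ _).trans (hC (Fin n) (by simp) c S hS)

end WeakDependence

/-! ### Taylor expansion of `H` -/

section Taylor

variable {p r : ℕ}

lemma multilinear_diagonal_eq_sum
    (φ : ContinuousMultilinearMap ℝ (fun _ : Fin r => EuclideanSpace ℝ (Fin p)) ℝ)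
    (y : EuclideanSpace ℝ (Fin p)) :
    φ (fun _ => y) = ∑ j : Fin r → Fin p,
      φ (fun i => EuclideanSpace.single (j i) (1 : ℝ)) * ∏ i, y (j i) := by
  have hy : ∑ c, y c • EuclideanSpace.single c (1 : ℝ) = y := by
    simpa using (EuclideanSpace.basisFun (Fin p) ℝ).sum_repr y
  conv_lhs => rw [← hy, φ.map_sum]
  simp only [φ.map_smul_univ, smul_eq_mul, mul_comm]

lemma abs_multilinear_diagonal_le
    (φ : ContinuousMultilinearMap ℝ (fun _ : Fin r => EuclideanSpace ℝ (Fin p)) ℝ) {M : ℝ}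
    (hM : ∀ j : Fin r → Fin p, |φ fun i => EuclideanSpace.single (j i) (1 : ℝ)| ≤ M)
    (y : EuclideanSpace ℝ (Fin p)) :
    |φ fun _ => y| ≤ p ^ r * (M * ‖y‖ ^ r) := by
  have hterm (j : Fin r → Fin p) :
      |(φ fun i => EuclideanSpace.single (j i) (1 : ℝ)) * ∏ i, y (j i)| ≤ M * ‖y‖ ^ r := by
    have hy : ∏ i, |y (j i)| ≤ ‖y‖ ^ r := by
      simpa using Finset.prod_le_prod (s := Finset.univ) (fun i _ => abs_nonneg (y (j i)))
        fun i _ => PiLp.norm_apply_le y (j i)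
    rw [abs_mul, Finset.abs_prod]
    exact mul_le_mul (hM j) hy (by positivity) ((abs_nonneg _).trans (hM j))
  rw [multilinear_diagonal_eq_sum]
  calc _ ≤ ∑ _j : Fin r → Fin p, M * ‖y‖ ^ r :=
        (Finset.abs_sum_le_sum_abs _ _).trans (Finset.sum_le_sum fun j _ => hterm j)
    _ = p ^ r * (M * ‖y‖ ^ r) := by simp

lemma one_add_norm_pow_le {E : Type*} [SeminormedAddCommGroup E] (a : ℕ) {x y z : E}
    (h : ‖z‖ ≤ ‖x‖ + ‖y‖) :
    1 + ‖z‖ ^ a ≤ (1 + 2 ^ (a - 1) * (1 + ‖x‖ ^ a)) * (1 + ‖y‖ ^ a) := by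
  have hz : ‖z‖ ^ a ≤ 2 ^ (a - 1) * (‖x‖ ^ a + ‖y‖ ^ a) :=
    (pow_le_pow_left₀ (norm_nonneg _) h a).trans (add_pow_le (norm_nonneg _) (norm_nonneg _) a)
  have hcross : 0 ≤ 2 ^ (a - 1) * (‖x‖ ^ a * ‖y‖ ^ a) := by positivity
  have hy : 0 ≤ ‖y‖ ^ a := by positivity
  have htwo : (0 : ℝ) ≤ 2 ^ (a - 1) := by positivity
  linarith

variable {H : EuclideanSpace ℝ (Fin p) → ℝ} {a : ℕ}

lemma ConditionD.exists_abs_iteratedFDeriv_diagonal_le (hD : ConditionD H r a)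
    (μ : EuclideanSpace ℝ (Fin p)) :
    ∃ C, 0 ≤ C ∧ ∀ x y, ‖x‖ ≤ ‖μ‖ + ‖y‖ →
      |iteratedFDeriv ℝ r H x fun _ => y| ≤ C * (‖y‖ ^ r * (1 + ‖y‖ ^ a)) := by
  obtain ⟨-, C, hC, hH⟩ := hD
  refine ⟨p ^ r * (C * (1 + 2 ^ (a - 1) * (1 + ‖μ‖ ^ a))), by positivity, fun x y hx => ?_⟩
  calc |iteratedFDeriv ℝ r H x fun _ => y| ≤ p ^ r * (C * (1 + ‖x‖ ^ a) * ‖y‖ ^ r) :=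
        abs_multilinear_diagonal_le _ (hH x) y
    _ ≤ p ^ r * (C * ((1 + 2 ^ (a - 1) * (1 + ‖μ‖ ^ a)) * (1 + ‖y‖ ^ a)) * ‖y‖ ^ r) := by
        gcongr ?_ * (C * ?_ * ?_)
        exact one_add_norm_pow_le a hx
    _ = _ := by ring

/-- The remainder of the Taylor polynomial of degree `n - 1` of `H` at `μ`, as a function of the
increment. -/
noncomputable def taylorRemainder (H : EuclideanSpace ℝ (Fin p) → ℝ)
    (μ : EuclideanSpace ℝ (Fin p)) (n : ℕ) (y : EuclideanSpace ℝ (Fin p)) : ℝ :=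
  H (μ + y) - ∑ k ∈ Finset.range n, (k.factorial : ℝ)⁻¹ * iteratedFDeriv ℝ k H μ fun _ => y

lemma taylorRemainder_two (H : EuclideanSpace ℝ (Fin p) → ℝ) (μ y : EuclideanSpace ℝ (Fin p)) :
    taylorRemainder H μ 2 y = H (μ + y) - H μ - inner ℝ (gradient H μ) y := by
  simp [taylorRemainder, Finset.sum_range_succ, iteratedFDeriv_one_apply, inner_gradient_left,
    sub_sub]

lemma taylorRemainder_two_eq_add (H : EuclideanSpace ℝ (Fin p) → ℝ)
    (μ y : EuclideanSpace ℝ (Fin p)) :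
    taylorRemainder H μ 2 y =
      2⁻¹ * iteratedFDeriv ℝ 2 H μ (fun _ => y) + taylorRemainder H μ 3 y := by
  simp only [taylorRemainder, Finset.sum_range_succ, Nat.factorial, Finset.range_zero]
  push_cast
  ring

lemma ConditionD.exists_abs_taylorRemainder_le {n : ℕ} (hD : ConditionD H (n + 1) a)
    (μ : EuclideanSpace ℝ (Fin p)) :
    ∃ C, 0 ≤ C ∧ ∀ y, |taylorRemainder H μ (n + 1) y| ≤ C * (‖y‖ ^ (n + 1) * (1 + ‖y‖ ^ a)) := by
  obtain ⟨C, hC0, hC⟩ := hD.exists_abs_iteratedFDeriv_diagonal_le μ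
  refine ⟨C, hC0, fun y => ?_⟩
  have htaylor := map_add_eq_sum_add_integral_iteratedFDeriv (f := H) (x := μ) (y := y) (n := n)
    fun t _ => hD.1.contDiffAt
  simp only [smul_eq_mul] at htaylor
  have hintegrand (t : ℝ) (ht : t ∈ Set.uIoc (0 : ℝ) 1) :
      ‖(1 - t) ^ n * iteratedFDeriv ℝ (n + 1) H (μ + t • y) fun _ => y‖ ≤
        C * (‖y‖ ^ (n + 1) * (1 + ‖y‖ ^ a)) := by
    rw [Set.uIoc_of_le zero_le_one] at ht
    have hpow : |1 - t| ^ n ≤ 1 :=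
      pow_le_one₀ (abs_nonneg _) (abs_le.2 ⟨by linarith [ht.2], by linarith [ht.1]⟩)
    have hnorm : ‖μ + t • y‖ ≤ ‖μ‖ + ‖y‖ := by
      grw [norm_add_le, norm_smul, Real.norm_of_nonneg ht.1.le, ht.2, one_mul]
    rw [Real.norm_eq_abs, abs_mul, abs_pow]
    exact (mul_le_of_le_one_left (abs_nonneg _) hpow).trans (hC _ y hnorm)
  have hfactorial : |(n.factorial : ℝ)⁻¹| ≤ 1 := by
    rw [abs_of_nonneg (by positivity)]
    exact inv_le_one_of_one_le₀ (mod_cast n.factorial_pos)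
  rw [taylorRemainder, htaylor, add_sub_cancel_left, abs_mul]
  refine (mul_le_of_le_one_left (abs_nonneg _) hfactorial).trans ?_
  simpa using intervalIntegral.norm_integral_le_of_norm_le_const hintegrand

end Taylor

/-! ### Functions of power growth -/

section PowerGrowth

lemma pow_le_pow_add_pow {t : ℝ} (ht : 0 ≤ t) {i j k : ℕ} (hik : i ≤ k) (hkj : k ≤ j) :
    t ^ k ≤ t ^ i + t ^ j := by
  rcases le_total t 1 with ht1 | ht1
  · linarith [pow_le_pow_of_le_one ht ht1 hik, pow_nonneg ht j]
  · linarith [pow_le_pow_right₀ ht1 hkj, pow_nonneg ht i]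

/-- A measurable real function that is `O(‖y‖ ^ m)` at the origin and `O(‖y‖ ^ n)` at infinity,
with one constant for both bounds. -/
structure HasPowerGrowth {E : Type*} [NormedAddCommGroup E] [MeasurableSpace E] (R : E → ℝ)
    (m n : ℕ) : Prop where
  measurable : Measurable R
  bound : ∃ C, 0 ≤ C ∧ ∀ y, |R y| ≤ C * (‖y‖ ^ m + ‖y‖ ^ n)

namespace HasPowerGrowth

variable {E : Type*} [NormedAddCommGroup E] [MeasurableSpace E] {R R' : E → ℝ} {m n m' n' : ℕ}

lemma mono (hR : HasPowerGrowth R m n) (hm : m' ≤ m) (hmn : m ≤ n) (hn : n ≤ n') :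
    HasPowerGrowth R m' n' := by
  obtain ⟨C, hC0, hC⟩ := hR.bound
  refine ⟨hR.measurable, 2 * C, by positivity, fun y => (hC y).trans ?_⟩
  rw [mul_assoc, mul_left_comm, two_mul]
  gcongr
  · exact pow_le_pow_add_pow (norm_nonneg y) hm (hmn.trans hn)
  · exact pow_le_pow_add_pow (norm_nonneg y) (hm.trans hmn) hn

lemma add (hR : HasPowerGrowth R m n) (hR' : HasPowerGrowth R' m n) :
    HasPowerGrowth (fun y => R y + R' y) m n := by
  obtain ⟨C, hC0, hC⟩ := hR.bound
  obtain ⟨C', hC0', hC'⟩ := hR'.bound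
  refine ⟨hR.measurable.add hR'.measurable, C + C', by positivity, fun y => ?_⟩
  rw [add_mul]
  exact (abs_add_le _ _).trans (add_le_add (hC y) (hC' y))

lemma multilinear_diagonal [NormedSpace ℝ E] [BorelSpace E]
    (φ : ContinuousMultilinearMap ℝ (fun _ : Fin n => E) ℝ) :
    HasPowerGrowth (fun y => φ fun _ => y) n n := by
  refine ⟨(φ.cont.comp (by fun_prop)).measurable, ‖φ‖, norm_nonneg _, fun y => ?_⟩
  have hbound : |φ fun _ => y| ≤ ‖φ‖ * ‖y‖ ^ n := by simpa using φ.le_opNorm fun _ => y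
  nlinarith [mul_nonneg (norm_nonneg φ) (pow_nonneg (norm_nonneg y) n)]

lemma exists_sq_le (hR : HasPowerGrowth R m n) :
    ∃ C, 0 ≤ C ∧ ∀ y, R y ^ 2 ≤ C * (‖y‖ ^ (2 * m) + ‖y‖ ^ (2 * n)) := by
  obtain ⟨C, -, hC⟩ := hR.bound
  refine ⟨C ^ 2 * 2, by positivity, fun y => ?_⟩
  calc R y ^ 2 = |R y| ^ 2 := (sq_abs _).symm
    _ ≤ (C * (‖y‖ ^ m + ‖y‖ ^ n)) ^ 2 := pow_le_pow_left₀ (abs_nonneg _) (hC y) 2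
    _ ≤ C ^ 2 * (2 * ((‖y‖ ^ m) ^ 2 + (‖y‖ ^ n) ^ 2)) := by
        rw [mul_pow]
        gcongr
        exact add_sq_le
    _ = C ^ 2 * 2 * (‖y‖ ^ (2 * m) + ‖y‖ ^ (2 * n)) := by ring

end HasPowerGrowth

lemma ConditionD.hasPowerGrowth_taylorRemainder {p n a : ℕ} {H : EuclideanSpace ℝ (Fin p) → ℝ}
    (hD : ConditionD H (n + 1) a) (μ : EuclideanSpace ℝ (Fin p)) :
    HasPowerGrowth (taylorRemainder H μ (n + 1)) (n + 1) (n + 1 + a) where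
  measurable := by
    have hH := hD.1.continuous
    have hdiag (k : ℕ) := (HasPowerGrowth.multilinear_diagonal (iteratedFDeriv ℝ k H μ)).measurable
    unfold taylorRemainder
    exact (hH.comp (by fun_prop)).measurable.sub
      (Finset.measurable_fun_sum _ fun k _ => (hdiag k).const_mul _)
  bound := by simpa only [mul_add, mul_one, ← pow_add] using hD.exists_abs_taylorRemainder_le μ

end PowerGrowth

/-! ### Moments of the sample mean -/

section Means

variable {d p : ℕ} {Ω : Type*}

/-- The sample mean over a finite set of sites. -/
noncomputable def siteMean {E : Type*} [AddCommGroup E] [Module ℝ E] (Y : (Fin d → ℤ) → Ω → E)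
    (S : Finset (Fin d → ℤ)) (ω : Ω) : E := (S.card : ℝ)⁻¹ • ∑ k ∈ S, Y k ω

variable [MeasurableSpace Ω] {P : Measure Ω} {Z : (Fin d → ℤ) → Ω → EuclideanSpace ℝ (Fin p)}
  {r : ℕ} {f : ℕ → ℝ} {S : Finset (Fin d → ℤ)}

lemma siteMean_sub_apply (hS : S.Nonempty) (ω : Ω) (c : Fin p) :
    (siteMean Z S ω - fieldMean P Z) c = (S.card : ℝ)⁻¹ * ∑ k ∈ S, centered P Z c k ω := by
  have hcard : (S.card : ℝ) ≠ 0 := by exact_mod_cast hS.card_pos.ne'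
  simp [siteMean, centered, mul_sub, hcard]

lemma memLp_siteMean_sub [IsFiniteMeasure P] {u : ENNReal} (hLp : ∀ k, MemLp (Z k) u P)
    (S : Finset (Fin d → ℤ)) : MemLp (fun ω => siteMean Z S ω - fieldMean P Z) u P :=
  ((memLp_finsetSum S fun k _ => hLp k).const_smul (S.card : ℝ)⁻¹).sub (memLp_const _)

lemma norm_pow_le_sum_pow (ρ : ℕ) (v : EuclideanSpace ℝ (Fin p)) :
    ‖v‖ ^ (2 * (ρ + 1)) ≤ p ^ ρ * ∑ c, (v c) ^ (2 * (ρ + 1)) := by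
  have hpow := pow_sum_le_card_mul_sum_pow (s := Finset.univ) (f := fun c => (v c) ^ 2)
    (fun c _ => sq_nonneg _) ρ
  rw [← EuclideanSpace.real_norm_sq_eq] at hpow
  simpa [← pow_mul] using hpow

lemma IsWeaklyDependent.exists_integral_mean_pow_le {κ : Type*} {X : κ → (Fin d → ℤ) → Ω → ℝ}
    {Q : ℕ} (h : IsWeaklyDependent P X Q f) {ρ : ℕ} (hρ1 : 1 ≤ ρ) (hρ : 2 * ρ ≤ Q) :
    ∃ C, 0 ≤ C ∧ ∀ (c : κ) (S : Finset (Fin d → ℤ)), S.Nonempty →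
      Integrable (fun ω => ((S.card : ℝ)⁻¹ * ∑ k ∈ S, X c k ω) ^ (2 * ρ)) P ∧
      ∫ ω, ((S.card : ℝ)⁻¹ * ∑ k ∈ S, X c k ω) ^ (2 * ρ) ∂P ≤ C * (S.card : ℝ)⁻¹ ^ ρ := by
  obtain ⟨C, hC0, hC⟩ := h.exists_abs_integral_prod_sum_le (n := 2 * ρ) (by omega) hρ
  refine ⟨C, hC0, fun c S hS => ?_⟩
  have hprod (ω : Ω) : ((S.card : ℝ)⁻¹ * ∑ k ∈ S, X c k ω) ^ (2 * ρ) =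
      (S.card : ℝ)⁻¹ ^ (2 * ρ) * ∏ _i : Fin (2 * ρ), ∑ k ∈ S, X c k ω := by
    simp [mul_pow]
  simp only [hprod]
  refine ⟨(h.integrable_prod_sum hρ (fun _ => c) S).const_mul _, ?_⟩
  have hN : (S.card : ℝ) ≠ 0 := mod_cast hS.card_pos.ne'
  have hmoment := (le_abs_self _).trans (hC (fun _ => c) S hS)
  rw [Nat.mul_div_cancel_left _ two_pos] at hmoment
  rw [integral_const_mul]
  calc _ ≤ (S.card : ℝ)⁻¹ ^ (2 * ρ) * (C * (S.card : ℝ) ^ ρ) := by gcongr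
    _ = C * (S.card : ℝ)⁻¹ ^ ρ * ((S.card : ℝ)⁻¹ * S.card) ^ ρ := by rw [mul_pow]; ring
    _ = C * (S.card : ℝ)⁻¹ ^ ρ := by rw [inv_mul_cancel₀ hN, one_pow, mul_one]

lemma IsWeaklyDependent.exists_integral_norm_pow_le [IsFiniteMeasure P]
    (h : IsWeaklyDependent P (centered P Z) (2 * r) f)
    (hLp : ∀ k, MemLp (Z k) (2 * r : ℕ) P) {ρ : ℕ} (hρ1 : 1 ≤ ρ) (hρ : ρ ≤ r) :
    ∃ C, 0 ≤ C ∧ ∀ S : Finset (Fin d → ℤ), S.Nonempty →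
      Integrable (fun ω => ‖siteMean Z S ω - fieldMean P Z‖ ^ (2 * ρ)) P ∧
      ∫ ω, ‖siteMean Z S ω - fieldMean P Z‖ ^ (2 * ρ) ∂P ≤ C * (S.card : ℝ)⁻¹ ^ ρ := by
  obtain ⟨C, hC0, hC⟩ := h.exists_integral_mean_pow_le hρ1 (by omega)
  obtain ⟨ρ, rfl⟩ := Nat.exists_eq_add_of_le' hρ1
  refine ⟨p ^ ρ * (p * C), by positivity, fun S hS => ?_⟩
  have hint : Integrable (fun ω => ‖siteMean Z S ω - fieldMean P Z‖ ^ (2 * (ρ + 1))) P := by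
    refine MemLp.integrable_norm_pow ((memLp_siteMean_sub hLp S).mono_exponent ?_) (by omega)
    exact_mod_cast (by omega : 2 * (ρ + 1) ≤ 2 * r)
  have hcoord := fun c => hC c S hS
  simp only [← siteMean_sub_apply hS] at hcoord
  refine ⟨hint, ?_⟩
  calc ∫ ω, ‖siteMean Z S ω - fieldMean P Z‖ ^ (2 * (ρ + 1)) ∂P
      ≤ ∫ ω, p ^ ρ * ∑ c, ((siteMean Z S ω - fieldMean P Z) c) ^ (2 * (ρ + 1)) ∂P :=
        integral_mono hint ((integrable_finsetSum _ fun c _ => (hcoord c).1).const_mul _)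
          fun ω => norm_pow_le_sum_pow ρ _
    _ = p ^ ρ * ∑ c, ∫ ω, ((siteMean Z S ω - fieldMean P Z) c) ^ (2 * (ρ + 1)) ∂P := by
        rw [integral_const_mul, integral_finsetSum _ fun c _ => (hcoord c).1]
    _ ≤ p ^ ρ * ∑ _c : Fin p, C * (S.card : ℝ)⁻¹ ^ (ρ + 1) := by
        gcongr with c
        exact (hcoord c).2
    _ = _ := by
        rw [Finset.sum_const, Finset.card_univ, Fintype.card_fin, nsmul_eq_mul]
        ring

end Means

/-! ### Moments of functions of the sample mean -/

section MomentsOfFunctions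

lemma abs_integral_mul_le_of_sq {Ω : Type*} [MeasurableSpace Ω] {P : Measure Ω} {u v : Ω → ℝ}
    (hu : MemLp u 2 P) (hv : MemLp v 2 P) {t : ℝ} (ht : 0 < t) :
    |∫ ω, u ω * v ω ∂P| ≤ t * (∫ ω, u ω ^ 2 ∂P) + t⁻¹ * ∫ ω, v ω ^ 2 ∂P := by
  have hpointwise (x y : ℝ) : |x * y| ≤ t * x ^ 2 + t⁻¹ * y ^ 2 := by
    have hsq := two_mul_le_add_sq (√t * |x|) (√t⁻¹ * |y|)
    have hone : √t * √t⁻¹ = 1 := by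
      rw [← Real.sqrt_mul ht.le, mul_inv_cancel₀ ht.ne', Real.sqrt_one]
    rw [mul_pow, mul_pow, Real.sq_sqrt ht.le, Real.sq_sqrt (inv_pos.2 ht).le, sq_abs, sq_abs] at hsq
    calc |x * y| ≤ 2 * (√t * √t⁻¹) * (|x| * |y|) := by
          rw [hone, abs_mul]
          linarith [mul_nonneg (abs_nonneg x) (abs_nonneg y)]
      _ ≤ _ := by linarith
  rw [← integral_const_mul, ← integral_const_mul,
    ← integral_add (hu.integrable_sq.const_mul t) (hv.integrable_sq.const_mul _)]
  exact abs_integral_le_integral_abs.trans (integral_mono (hu.integrable_mul hv).abs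
    ((hu.integrable_sq.const_mul t).add (hv.integrable_sq.const_mul _)) fun ω => hpointwise _ _)

variable {d p : ℕ} {Ω : Type*} [MeasurableSpace Ω] {P : Measure Ω}
  {Z : (Fin d → ℤ) → Ω → EuclideanSpace ℝ (Fin p)} {r m n m' n' : ℕ} {f : ℕ → ℝ}
  {R R' : EuclideanSpace ℝ (Fin p) → ℝ}

lemma HasPowerGrowth.memLp_siteMean [IsFiniteMeasure P] (hR : HasPowerGrowth R m n)
    (hLp : ∀ k, MemLp (Z k) (2 * r : ℕ) P) (hmn : m ≤ n) (hn : n ≤ r)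
    (S : Finset (Fin d → ℤ)) :
    MemLp (fun ω => R (siteMean Z S ω - fieldMean P Z)) 2 P := by
  obtain ⟨C, -, hC⟩ := hR.exists_sq_le
  have hmean := memLp_siteMean_sub hLp S
  have hmeas : AEStronglyMeasurable (fun ω => R (siteMean Z S ω - fieldMean P Z)) P :=
    (hR.measurable.comp_aemeasurable
      hmean.aestronglyMeasurable.aemeasurable).aestronglyMeasurable
  have hpow {ρ : ℕ} (hρ : ρ ≤ r) :
      Integrable (fun ω => ‖siteMean Z S ω - fieldMean P Z‖ ^ (2 * ρ)) P :=
    (hmean.mono_exponent (mod_cast Nat.mul_le_mul_left 2 hρ)).integrable_norm_pow'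
  refine (memLp_two_iff_integrable_sq hmeas).2 ((((hpow (hmn.trans hn)).add (hpow hn)).const_mul
    C).mono' (hmeas.pow 2) (.of_forall fun ω => ?_))
  rw [Real.norm_of_nonneg (sq_nonneg _)]
  exact hC _

lemma IsWeaklyDependent.exists_integral_sq_le [IsFiniteMeasure P]
    (h : IsWeaklyDependent P (centered P Z) (2 * r) f)
    (hLp : ∀ k, MemLp (Z k) (2 * r : ℕ) P) (hR : HasPowerGrowth R m n) (hm : 1 ≤ m) (hmn : m ≤ n)
    (hn : n ≤ r) :
    ∃ C, 0 ≤ C ∧ ∀ S : Finset (Fin d → ℤ), S.Nonempty →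
      ∫ ω, R (siteMean Z S ω - fieldMean P Z) ^ 2 ∂P ≤ C * (S.card : ℝ)⁻¹ ^ m := by
  obtain ⟨C, hC0, hC⟩ := hR.exists_sq_le
  obtain ⟨A, hA0, hA⟩ := h.exists_integral_norm_pow_le hLp hm (hmn.trans hn)
  obtain ⟨B, hB0, hB⟩ := h.exists_integral_norm_pow_le hLp (hm.trans hmn) hn
  refine ⟨C * (A + B), by positivity, fun S hS => ?_⟩
  obtain ⟨hAint, hAle⟩ := hA S hS
  obtain ⟨hBint, hBle⟩ := hB S hS
  have hinv : (S.card : ℝ)⁻¹ ≤ 1 := inv_le_one_of_one_le₀ (mod_cast hS.card_pos)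
  calc ∫ ω, R (siteMean Z S ω - fieldMean P Z) ^ 2 ∂P
      ≤ ∫ ω, C * (‖siteMean Z S ω - fieldMean P Z‖ ^ (2 * m) +
          ‖siteMean Z S ω - fieldMean P Z‖ ^ (2 * n)) ∂P :=
        integral_mono (hR.memLp_siteMean hLp hmn hn S).integrable_sq
          ((hAint.add hBint).const_mul C) fun ω => hC _
    _ = C * ((∫ ω, ‖siteMean Z S ω - fieldMean P Z‖ ^ (2 * m) ∂P) +
          ∫ ω, ‖siteMean Z S ω - fieldMean P Z‖ ^ (2 * n) ∂P) := by
        rw [integral_const_mul, integral_add hAint hBint]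
    _ ≤ C * (A * (S.card : ℝ)⁻¹ ^ m + B * (S.card : ℝ)⁻¹ ^ m) := by
        gcongr
        exact hBle.trans (by gcongr ?_ * ?_; exact pow_le_pow_of_le_one (by positivity) hinv hmn)
    _ = C * (A + B) * (S.card : ℝ)⁻¹ ^ m := by ring

lemma IsWeaklyDependent.exists_abs_integral_mul_le [IsFiniteMeasure P]
    (h : IsWeaklyDependent P (centered P Z) (2 * r) f)
    (hLp : ∀ k, MemLp (Z k) (2 * r : ℕ) P) (hR : HasPowerGrowth R m n) (hm : 1 ≤ m) (hmn : m ≤ n)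
    (hn : n ≤ r) (hR' : HasPowerGrowth R' m' n') (hm' : 1 ≤ m') (hmn' : m' ≤ n') (hn' : n' ≤ r) :
    ∃ C, 0 ≤ C ∧ ∀ S : Finset (Fin d → ℤ), S.Nonempty →
      |∫ ω, R (siteMean Z S ω - fieldMean P Z) * R' (siteMean Z S ω - fieldMean P Z) ∂P| ≤
        C * (S.card : ℝ) ^ (-((m + m') / 2 : ℝ)) := by
  obtain ⟨C, hC0, hC⟩ := h.exists_integral_sq_le hLp hR hm hmn hn
  obtain ⟨C', hC0', hC'⟩ := h.exists_integral_sq_le hLp hR' hm' hmn' hn'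
  refine ⟨C + C', by positivity, fun S hS => ?_⟩
  have hN : (0 : ℝ) < S.card := mod_cast hS.card_pos
  have hinv (k : ℕ) : (S.card : ℝ)⁻¹ ^ k = (S.card : ℝ) ^ (-k : ℝ) := by
    rw [Real.rpow_neg hN.le, Real.rpow_natCast, inv_pow]
  set t : ℝ := (S.card : ℝ) ^ ((m - m') / 2 : ℝ) with ht
  have ht0 : 0 < t := by positivity
  have hleft : t * (S.card : ℝ)⁻¹ ^ m = (S.card : ℝ) ^ (-((m + m') / 2 : ℝ)) := by
    rw [hinv, ht, ← Real.rpow_add hN]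
    ring_nf
  have hright : t⁻¹ * (S.card : ℝ)⁻¹ ^ m' = (S.card : ℝ) ^ (-((m + m') / 2 : ℝ)) := by
    rw [hinv, ht, ← Real.rpow_neg hN.le, ← Real.rpow_add hN]
    ring_nf
  calc _ ≤ t * (C * (S.card : ℝ)⁻¹ ^ m) + t⁻¹ * (C' * (S.card : ℝ)⁻¹ ^ m') := by
        refine (abs_integral_mul_le_of_sq (hR.memLp_siteMean hLp hmn hn S)
          (hR'.memLp_siteMean hLp hmn' hn' S) ht0).trans ?_
        gcongr
        exacts [hC S hS, hC' S hS]
    _ = C * (t * (S.card : ℝ)⁻¹ ^ m) + C' * (t⁻¹ * (S.card : ℝ)⁻¹ ^ m') := by ring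
    _ = (C + C') * (S.card : ℝ) ^ (-((m + m') / 2 : ℝ)) := by rw [hleft, hright, add_mul]

/-- An odd moment of the sample mean gains a factor `N ^ (-1 / 2)` over the bound given by its
`L ^ n` norm. -/
lemma IsWeaklyDependent.exists_abs_integral_multilinear_le
    (h : IsWeaklyDependent P (centered P Z) (2 * r) f) (hn1 : 1 ≤ n) (hn : n ≤ 2 * r)
    (φ : ContinuousMultilinearMap ℝ (fun _ : Fin n => EuclideanSpace ℝ (Fin p)) ℝ) :
    ∃ C, 0 ≤ C ∧ ∀ S : Finset (Fin d → ℤ), S.Nonempty →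
      |∫ ω, φ (fun _ => siteMean Z S ω - fieldMean P Z) ∂P| ≤
        C * (S.card : ℝ)⁻¹ ^ (n - n / 2) := by
  obtain ⟨C, hC0, hC⟩ := h.exists_abs_integral_prod_sum_le hn1 hn
  let coeff (j : Fin n → Fin p) : ℝ := φ fun i => EuclideanSpace.single (j i) 1
  refine ⟨∑ j, |coeff j| * C, by positivity, fun S hS => ?_⟩
  have hN : (S.card : ℝ) ≠ 0 := mod_cast hS.card_pos.ne'
  have hexpand (ω : Ω) : φ (fun _ => siteMean Z S ω - fieldMean P Z) =
      ∑ j, coeff j * (S.card : ℝ)⁻¹ ^ n * ∏ i, ∑ k ∈ S, centered P Z (j i) k ω := by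
    simp [multilinear_diagonal_eq_sum, siteMean_sub_apply hS, Finset.prod_mul_distrib, coeff,
      mul_assoc]
  have hpow : (S.card : ℝ)⁻¹ ^ n * (S.card : ℝ) ^ (n / 2) = (S.card : ℝ)⁻¹ ^ (n - n / 2) := by
    rw [← pow_sub_mul_pow _ (Nat.div_le_self n 2), mul_assoc, ← mul_pow, inv_mul_cancel₀ hN,
      one_pow, mul_one]
  simp only [hexpand]
  rw [integral_finsetSum _ fun j _ => (h.integrable_prod_sum hn j S).const_mul _, Finset.sum_mul]
  refine (Finset.abs_sum_le_sum_abs _ _).trans (Finset.sum_le_sum fun j _ => ?_)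
  rw [integral_const_mul, abs_mul, abs_mul, abs_of_nonneg (by positivity : 0 ≤ (S.card : ℝ)⁻¹ ^ n)]
  calc _ ≤ |coeff j| * (S.card : ℝ)⁻¹ ^ n * (C * (S.card : ℝ) ^ (n / 2)) := by
        gcongr
        exact hC j S hS
    _ = |coeff j| * C * (S.card : ℝ)⁻¹ ^ (n - n / 2) := by rw [← hpow]; ring

end MomentsOfFunctions

/-! ### Asymptotic linearity of smooth functions of sample means -/

/-- What is left of a statistic `θ` of finite sets of sites after subtracting the constant `h₀` and
the sample mean of the field `Y`. -/
noncomputable def linearizationError {d : ℕ} {Ω : Type*} (θ : Finset (Fin d → ℤ) → Ω → ℝ) (h₀ : ℝ)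
    (Y : (Fin d → ℤ) → Ω → ℝ) (S : Finset (Fin d → ℤ)) (ω : Ω) : ℝ :=
  θ S ω - h₀ - siteMean Y S ω

/-- A statistic `θ` of finite sets of sites that equals a constant plus the sample mean of a
centred second-order stationary field `Y` up to an error of order `N⁻¹` in `L²` whose covariance
with that mean is of order `N ^ (-(1 + γ))`. The autocovariances `σ` of `Y` have a finite first
absolute moment. -/
structure IsAsymptoticallyLinear {d : ℕ} {Ω : Type*} [MeasurableSpace Ω] (P : Measure Ω)
    (θ : Finset (Fin d → ℤ) → Ω → ℝ) (h₀ : ℝ) (Y : (Fin d → ℤ) → Ω → ℝ) (σ : (Fin d → ℤ) → ℝ)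
    (B C γ : ℝ) : Prop where
  memLp : ∀ k, MemLp (Y k) 2 P
  mean_zero : ∀ k, ∫ ω, Y k ω ∂P = 0
  cov : ∀ j k, ∫ ω, Y j ω * Y k ω ∂P = σ (k - j)
  sum_le : ∀ W : Finset (Fin d → ℤ), ∑ k ∈ W, ((supNorm k : ℝ) + 1) * |σ k| ≤ B
  error_memLp : ∀ S : Finset (Fin d → ℤ), S.Nonempty → MemLp (linearizationError θ h₀ Y S) 2 P
  error_sq_le : ∀ S : Finset (Fin d → ℤ), S.Nonempty →
    ∫ ω, linearizationError θ h₀ Y S ω ^ 2 ∂P ≤ C * (S.card : ℝ)⁻¹ ^ 2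
  error_mul_le : ∀ S : Finset (Fin d → ℤ), S.Nonempty →
    |∫ ω, siteMean Y S ω * linearizationError θ h₀ Y S ω ∂P| ≤ C * (S.card : ℝ) ^ (-(1 + γ))

section Linearization

variable {d p : ℕ} {Ω : Type*} [MeasurableSpace Ω] {P : Measure Ω}
  {Z : (Fin d → ℤ) → Ω → EuclideanSpace ℝ (Fin p)} {H : EuclideanSpace ℝ (Fin p) → ℝ}
  {r : ℕ} {f : ℕ → ℝ}

/-- The field `∇'(Z(s) - μ)`, where `∇` is the gradient of `H` at the mean `μ`. -/
noncomputable def linearizedField (P : Measure Ω) (Z : (Fin d → ℤ) → Ω → EuclideanSpace ℝ (Fin p))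
    (H : EuclideanSpace ℝ (Fin p) → ℝ) (k : Fin d → ℤ) (ω : Ω) : ℝ :=
  inner ℝ (gradient H (fieldMean P Z)) (Z k ω - fieldMean P Z)

lemma siteMean_linearizedField {S : Finset (Fin d → ℤ)} (hS : S.Nonempty) (ω : Ω) :
    siteMean (linearizedField P Z H) S ω =
      inner ℝ (gradient H (fieldMean P Z)) (siteMean Z S ω - fieldMean P Z) := by
  have hcard : (S.card : ℝ) ≠ 0 := by exact_mod_cast hS.card_pos.ne'
  simp [siteMean, linearizedField, inner_sub_right, inner_smul_right, inner_sum, mul_sub, hcard]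

lemma linearizationError_linearizedField {S : Finset (Fin d → ℤ)} (hS : S.Nonempty) (ω : Ω) :
    linearizationError (fun S ω => H (siteMean Z S ω)) (H (fieldMean P Z))
        (linearizedField P Z H) S ω =
      taylorRemainder H (fieldMean P Z) 2 (siteMean Z S ω - fieldMean P Z) := by
  rw [linearizationError, siteMean_linearizedField hS, taylorRemainder_two, add_sub_cancel]

lemma memLp_linearizedField [IsFiniteMeasure P] {u : ENNReal} (hLp : ∀ k, MemLp (Z k) u P)
    (k : Fin d → ℤ) : MemLp (linearizedField P Z H k) u P :=
  ((hLp k).sub (memLp_const _)).const_inner _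

lemma IsStationary.integral_linearizedField [IsProbabilityMeasure P] (hstat : IsStationary P Z)
    (hZ : ∀ k, Measurable (Z k)) (hint : Integrable (Z 0) P) (k : Fin d → ℤ) :
    ∫ ω, linearizedField P Z H k ω ∂P = 0 := by
  have hk : Integrable (Z k) P := (hstat.identDistrib hZ k).integrable_iff.2 hint
  have hmean : ∫ ω, (Z k ω - fieldMean P Z) ∂P = 0 := by
    rw [integral_sub hk (integrable_const _), (hstat.identDistrib hZ k).integral_eq]
    simp [fieldMean]
  have hinner := integral_inner (𝕜 := ℝ) (hk.sub (integrable_const (fieldMean P Z)))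
    (gradient H (fieldMean P Z))
  simp only [Pi.sub_apply, hmean, inner_zero_right] at hinner
  exact hinner

lemma IsStationary.integral_linearizedField_mul [IsProbabilityMeasure P] (hstat : IsStationary P Z)
    (hZ : ∀ k, Measurable (Z k)) (hint : Integrable (Z 0) P) (j k : Fin d → ℤ) :
    ∫ ω, linearizedField P Z H j ω * linearizedField P Z H k ω ∂P = sigmaCov P Z H (k - j) := by
  set v := gradient H (fieldMean P Z) with hv
  have hmean (k : Fin d → ℤ) : ∫ ω, inner ℝ v (Z k ω) ∂P = inner ℝ v (fieldMean P Z) := by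
    rw [integral_inner ((hstat.identDistrib hZ k).integrable_iff.2 hint),
      (hstat.identDistrib hZ k).integral_eq, fieldMean]
  have hmeas : Measurable fun x : EuclideanSpace ℝ (Fin p) × EuclideanSpace ℝ (Fin p) =>
      inner ℝ v (x.1 - fieldMean P Z) * inner ℝ v (x.2 - fieldMean P Z) := by fun_prop
  have hpair := ((hstat.identDistrib_pair hZ j k).comp hmeas).integral_eq
  simp only [Function.comp_def] at hpair
  simp only [linearizedField, ← hv, hpair, sigmaCov, covariance, hmean, ← inner_sub_right]

lemma inner_mul_inner_eq_sum (v x y : EuclideanSpace ℝ (Fin p)) :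
    inner ℝ v x * inner ℝ v y = ∑ b, ∑ c, v b * v c * (x b * y c) := by
  simp only [PiLp.inner_apply, RCLike.inner_apply, conj_trivial, Finset.sum_mul_sum]
  refine Finset.sum_congr rfl fun b _ => Finset.sum_congr rfl fun c _ => ?_
  ring

lemma IsWeaklyDependent.exists_abs_integral_linearizedField_mul_le
    (h : IsWeaklyDependent P (centered P Z) (2 * r) f) (hr : 1 ≤ r) :
    ∃ A, 0 ≤ A ∧ ∀ j k, |∫ ω, linearizedField P Z H j ω * linearizedField P Z H k ω ∂P| ≤
      A * f (supNorm (k - j)) := by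
  set v := gradient H (fieldMean P Z)
  refine ⟨∑ b, ∑ c, |v b * v c|, by positivity, fun j k => ?_⟩
  have hint (b c : Fin p) :
      Integrable (fun ω => v b * v c * (centered P Z b j ω * centered P Z c k ω)) P := by
    simpa using (h.integrable (Fin 2) ![b, c] ![j, k] (by simpa using by omega)).const_mul _
  have hexpand (ω : Ω) : linearizedField P Z H j ω * linearizedField P Z H k ω =
      ∑ b, ∑ c, v b * v c * (centered P Z b j ω * centered P Z c k ω) :=
    inner_mul_inner_eq_sum _ _ _
  simp only [hexpand]
  rw [integral_finsetSum _ fun b _ => integrable_finsetSum _ fun c _ => hint b c, Finset.sum_mul]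
  refine (Finset.abs_sum_le_sum_abs _ _).trans (Finset.sum_le_sum fun b _ => ?_)
  rw [integral_finsetSum _ fun c _ => hint b c, Finset.sum_mul]
  refine (Finset.abs_sum_le_sum_abs _ _).trans (Finset.sum_le_sum fun c _ => ?_)
  rw [integral_const_mul, abs_mul]
  gcongr
  exact h.abs_integral_mul_le (by omega) b c j k

lemma IsWeaklyDependent.exists_sum_abs_sigmaCov_le [NeZero d] [IsProbabilityMeasure P]
    (h : IsWeaklyDependent P (centered P Z) (2 * r) f) (hr : 2 ≤ r)
    (hZ : ∀ k, Measurable (Z k)) (hstat : IsStationary P Z) (hint : Integrable (Z 0) P) :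
    ∃ B, ∀ W : Finset (Fin d → ℤ), ∑ k ∈ W, ((supNorm k : ℝ) + 1) * |sigmaCov P Z H k| ≤ B := by
  obtain ⟨C, hC⟩ := h.exists_sum_weighted_le (by omega)
  obtain ⟨A, hA0, hA⟩ := h.exists_abs_integral_linearizedField_mul_le (H := H) (by omega)
  refine ⟨A * C, fun W => ?_⟩
  calc _ ≤ ∑ k ∈ W, A * (((supNorm k : ℝ) + 1) * f (supNorm k)) := by
        refine Finset.sum_le_sum fun k _ => ?_
        rw [mul_left_comm]
        gcongr
        simpa [hstat.integral_linearizedField_mul hZ hint] using hA 0 k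
    _ ≤ A * C := by
        rw [← Finset.mul_sum]
        gcongr
        exact hC W

lemma HasPowerGrowth.inner_left (v : EuclideanSpace ℝ (Fin p)) :
    HasPowerGrowth (fun y => inner ℝ v y) 1 1 := by
  refine ⟨by fun_prop, ‖v‖, norm_nonneg v, fun y => (abs_real_inner_le_norm v y).trans ?_⟩
  gcongr
  linarith [norm_nonneg y, pow_one ‖y‖]

lemma IsWeaklyDependent.exists_isAsymptoticallyLinear [NeZero d] [IsProbabilityMeasure P]
    (h : IsWeaklyDependent P (centered P Z) (2 * r) f) (hLp : ∀ k, MemLp (Z k) (2 * r : ℕ) P)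
    (hZ : ∀ k, Measurable (Z k)) (hstat : IsStationary P Z) {n : ℕ} (hn2 : 2 ≤ n) (hnr : n ≤ r)
    (hT : HasPowerGrowth (taylorRemainder H (fieldMean P Z) 2) 2 n) {γ : ℝ}
    (hmixed : ∃ C, 0 ≤ C ∧ ∀ S : Finset (Fin d → ℤ), S.Nonempty →
      |∫ ω, inner ℝ (gradient H (fieldMean P Z)) (siteMean Z S ω - fieldMean P Z) *
        taylorRemainder H (fieldMean P Z) 2 (siteMean Z S ω - fieldMean P Z) ∂P| ≤
        C * (S.card : ℝ) ^ (-(1 + γ))) :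
    ∃ B C, IsAsymptoticallyLinear P (fun S ω => H (siteMean Z S ω)) (H (fieldMean P Z))
      (linearizedField P Z H) (sigmaCov P Z H) B C γ := by
  have hL2 (k : Fin d → ℤ) : MemLp (Z k) 2 P :=
    (hLp k).mono_exponent (mod_cast (by omega : 2 ≤ 2 * r))
  have hint : Integrable (Z 0) P := (hL2 0).integrable one_le_two
  obtain ⟨B, hB⟩ := h.exists_sum_abs_sigmaCov_le (H := H) (by omega) hZ hstat hint
  obtain ⟨C₁, hC₁0, hC₁⟩ := h.exists_integral_sq_le hLp hT one_le_two hn2 hnr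
  obtain ⟨C₂, hC₂0, hC₂⟩ := hmixed
  refine ⟨B, C₁ + C₂, memLp_linearizedField hL2, hstat.integral_linearizedField hZ hint,
    hstat.integral_linearizedField_mul hZ hint, hB, fun S hS => ?_, fun S hS => ?_, fun S hS => ?_⟩
  · simpa only [funext (linearizationError_linearizedField hS)]
      using hT.memLp_siteMean hLp hn2 hnr S
  · simp only [linearizationError_linearizedField hS]
    grw [hC₁ S hS, ← le_add_of_nonneg_right hC₂0]
  · simp only [linearizationError_linearizedField hS, siteMean_linearizedField hS]
    grw [hC₂ S hS, ← le_add_of_nonneg_left hC₁0]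

/-- For `D₃` the quadratic Taylor term contributes a third moment of the sample mean, which is
`O(N⁻²)` like the contribution of the cubic remainder. -/
lemma IsWeaklyDependent.exists_integral_inner_mul_taylorRemainder_le [IsFiniteMeasure P]
    (h : IsWeaklyDependent P (centered P Z) (2 * r) f) (hLp : ∀ k, MemLp (Z k) (2 * r : ℕ) P)
    {n : ℕ} (hn3 : 3 ≤ n) (hnr : n ≤ r)
    (hT : HasPowerGrowth (taylorRemainder H (fieldMean P Z) 3) 3 n)
    (v : EuclideanSpace ℝ (Fin p)) :
    ∃ C, 0 ≤ C ∧ ∀ S : Finset (Fin d → ℤ), S.Nonempty →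
      |∫ ω, inner ℝ v (siteMean Z S ω - fieldMean P Z) *
        taylorRemainder H (fieldMean P Z) 2 (siteMean Z S ω - fieldMean P Z) ∂P| ≤
        C * (S.card : ℝ) ^ (-2 : ℝ) := by
  have hv := HasPowerGrowth.inner_left v
  let φ := iteratedFDeriv ℝ 2 H (fieldMean P Z)
  let ψ : ContinuousMultilinearMap ℝ (fun _ : Fin 3 => EuclideanSpace ℝ (Fin p)) ℝ :=
    ((innerSL ℝ v).smulRight φ).uncurryLeft
  obtain ⟨A, hA0, hA⟩ := h.exists_abs_integral_multilinear_le (by norm_num) (by omega) ψ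
  obtain ⟨B, hB0, hB⟩ := h.exists_abs_integral_mul_le hLp hv le_rfl le_rfl (by omega) hT
    (by norm_num) hn3 hnr
  refine ⟨2⁻¹ * A + B, by positivity, fun S hS => ?_⟩
  have hlin := hv.memLp_siteMean hLp le_rfl (by omega) S
  have hquad : Integrable (fun ω => ψ fun _ => siteMean Z S ω - fieldMean P Z) P :=
    hlin.integrable_mul
      ((HasPowerGrowth.multilinear_diagonal φ).memLp_siteMean hLp le_rfl (by omega) S)
  have hcubic : Integrable (fun ω => inner ℝ v (siteMean Z S ω - fieldMean P Z) *
      taylorRemainder H (fieldMean P Z) 3 (siteMean Z S ω - fieldMean P Z)) P :=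
    hlin.integrable_mul (hT.memLp_siteMean hLp hn3 hnr S)
  have hsplit (ω : Ω) : inner ℝ v (siteMean Z S ω - fieldMean P Z) *
        taylorRemainder H (fieldMean P Z) 2 (siteMean Z S ω - fieldMean P Z) =
      2⁻¹ * ψ (fun _ => siteMean Z S ω - fieldMean P Z) +
        inner ℝ v (siteMean Z S ω - fieldMean P Z) *
          taylorRemainder H (fieldMean P Z) 3 (siteMean Z S ω - fieldMean P Z) := by
    have hψ (y : EuclideanSpace ℝ (Fin p)) : ψ (fun _ => y) = inner ℝ v y * φ fun _ => y := rfl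
    rw [taylorRemainder_two_eq_add, hψ]
    ring
  simp only [hsplit]
  rw [integral_add (hquad.const_mul 2⁻¹) hcubic, integral_const_mul, add_mul]
  refine (abs_add_le _ _).trans (add_le_add ?_ ?_)
  · rw [abs_mul, abs_of_pos (by norm_num : (0 : ℝ) < 2⁻¹), mul_assoc,
      Real.rpow_neg (Nat.cast_nonneg _), Real.rpow_ofNat, ← inv_pow]
    gcongr
    exact hA S hS
  · have hrate : -(((1 : ℕ) + (3 : ℕ) : ℝ) / 2) = -2 := by norm_num
    simpa only [hrate] using hB S hS

theorem exists_isAsymptoticallyLinear [NeZero d] [IsProbabilityMeasure P]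
    (hZ : ∀ k, Measurable (Z k)) (hstat : IsStationary P Z) {α₁ g : ℝ → ℝ} {a : ℕ}
    (hA3 : AssumptionA3 P Z α₁ g)
    (hDM : (2 ≤ d ∧ ConditionD H 2 a ∧ ConditionM P Z α₁ g (2 + a)) ∨
      (d = 1 ∧ ConditionD H 3 a ∧ ConditionM P Z α₁ g (3 + a))) :
    ∃ B C γ : ℝ, 1 ≤ γ * d ∧ IsAsymptoticallyLinear P (fun S ω => H (siteMean Z S ω))
      (H (fieldMean P Z)) (linearizedField P Z H) (sigmaCov P Z H) B C γ := by
  have hv := HasPowerGrowth.inner_left (gradient H (fieldMean P Z))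
  rcases hDM with ⟨hd, hD, hM⟩ | ⟨rfl, hD, hM⟩
  · have hLp := hM.memLp hstat hZ
    obtain ⟨f, hf⟩ := hM.exists_isWeaklyDependent hstat hZ hA3 (by omega)
    have hT := hD.hasPowerGrowth_taylorRemainder (fieldMean P Z)
    have hmixed := hf.exists_abs_integral_mul_le hLp hv le_rfl le_rfl (by omega) hT (by norm_num)
      (by omega) le_rfl
    obtain ⟨B, C, hlin⟩ := hf.exists_isAsymptoticallyLinear hLp hZ hstat (by omega) le_rfl hT
      (γ := 1 / 2) (by norm_num at hmixed ⊢; exact hmixed)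
    refine ⟨B, C, 1 / 2, ?_, hlin⟩
    have : (2 : ℝ) ≤ d := mod_cast hd
    linarith
  · have hLp := hM.memLp hstat hZ
    obtain ⟨f, hf⟩ := hM.exists_isWeaklyDependent hstat hZ hA3 (by omega)
    have hT := hD.hasPowerGrowth_taylorRemainder (fieldMean P Z)
    have hT2 : HasPowerGrowth (taylorRemainder H (fieldMean P Z) 2) 2 (3 + a) := by
      have hquad := HasPowerGrowth.multilinear_diagonal
        ((2 : ℝ)⁻¹ • iteratedFDeriv ℝ 2 H (fieldMean P Z))
      rw [funext (taylorRemainder_two_eq_add H (fieldMean P Z))]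
      exact (hquad.mono le_rfl le_rfl (by omega)).add (hT.mono (by omega) (by omega) le_rfl)
    obtain ⟨B, C, hlin⟩ := hf.exists_isAsymptoticallyLinear hLp hZ hstat (by omega) le_rfl hT2
      (γ := 1) (by
        rw [one_add_one_eq_two]
        exact hf.exists_integral_inner_mul_taylorRemainder_le hLp (by omega) le_rfl hT _)
    exact ⟨B, C, 1, by simp, hlin⟩

end Linearization

/-! ### Variances of asymptotically linear statistics -/

namespace IsAsymptoticallyLinear

variable {d : ℕ} {Ω : Type*} [MeasurableSpace Ω] {P : Measure Ω}
  {θ : Finset (Fin d → ℤ) → Ω → ℝ} {h₀ : ℝ} {Y : (Fin d → ℤ) → Ω → ℝ} {σ : (Fin d → ℤ) → ℝ}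
  {B C γ : ℝ} {S : Finset (Fin d → ℤ)}

lemma bound_nonneg (h : IsAsymptoticallyLinear P θ h₀ Y σ B C γ) : 0 ≤ B := by
  simpa using h.sum_le ∅

lemma const_nonneg (h : IsAsymptoticallyLinear P θ h₀ Y σ B C γ) : 0 ≤ C := by
  have hsq := h.error_sq_le {0} (Finset.singleton_nonempty 0)
  simp only [Finset.card_singleton, Nat.cast_one, inv_one, one_pow, mul_one] at hsq
  exact (integral_nonneg fun ω => sq_nonneg _).trans hsq

lemma sum_abs_le (h : IsAsymptoticallyLinear P θ h₀ Y σ B C γ) (W : Finset (Fin d → ℤ)) :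
    ∑ k ∈ W, |σ k| ≤ B :=
  (Finset.sum_le_sum fun k _ => le_mul_of_one_le_left (abs_nonneg _)
    (by linarith [(supNorm k).cast_nonneg (α := ℝ)])).trans (h.sum_le W)

lemma summable (h : IsAsymptoticallyLinear P θ h₀ Y σ B C γ) : Summable σ :=
  (summable_of_sum_le (fun _ => abs_nonneg _) h.sum_abs_le).of_abs

lemma integral_sum_mul_sq (h : IsAsymptoticallyLinear P θ h₀ Y σ B C γ)
    (T : Finset (Fin d → ℤ)) (w : (Fin d → ℤ) → ℝ) :
    ∫ ω, (∑ k ∈ T, w k * Y k ω) ^ 2 ∂P = ∑ j ∈ T, ∑ k ∈ T, w j * w k * σ (k - j) := by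
  have hexpand (ω : Ω) : (∑ k ∈ T, w k * Y k ω) ^ 2 =
      ∑ j ∈ T, ∑ k ∈ T, w j * w k * (Y j ω * Y k ω) := by
    simp only [sq, Finset.sum_mul_sum, mul_mul_mul_comm]
  have hint (j k : Fin d → ℤ) : Integrable (fun ω => w j * w k * (Y j ω * Y k ω)) P :=
    ((h.memLp j).integrable_mul (h.memLp k)).const_mul _
  simp only [hexpand]
  rw [integral_finsetSum _ fun j _ => integrable_finsetSum _ fun k _ => hint j k]
  refine Finset.sum_congr rfl fun j _ => ?_
  rw [integral_finsetSum _ fun k _ => hint j k]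
  simp only [integral_const_mul, h.cov]

/-- Schur's test for the covariance matrix of the field. -/
lemma integral_sum_mul_sq_le (h : IsAsymptoticallyLinear P θ h₀ Y σ B C γ)
    (T : Finset (Fin d → ℤ)) (w : (Fin d → ℤ) → ℝ) :
    ∫ ω, (∑ k ∈ T, w k * Y k ω) ^ 2 ∂P ≤ B * ∑ k ∈ T, w k ^ 2 := by
  have hrow (j : Fin d → ℤ) : ∑ k ∈ T, |σ (k - j)| ≤ B := by
    have hsum := h.sum_abs_le (T.image fun k => k - j)
    rwa [Finset.sum_image fun a _ b _ hab => sub_left_injective hab] at hsum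
  have hcol (k : Fin d → ℤ) : ∑ j ∈ T, |σ (k - j)| ≤ B := by
    have hsum := h.sum_abs_le (T.image fun j => k - j)
    rwa [Finset.sum_image fun a _ b _ hab => sub_right_injective hab] at hsum
  have hterm (j k : Fin d → ℤ) : w j * w k * σ (k - j) ≤
      2⁻¹ * (w j ^ 2 * |σ (k - j)|) + 2⁻¹ * (w k ^ 2 * |σ (k - j)|) := by
    have hamgm : |w j * w k| ≤ 2⁻¹ * (w j ^ 2 + w k ^ 2) := by
      rw [abs_mul]
      linarith [two_mul_le_add_sq |w j| |w k|, sq_abs (w j), sq_abs (w k)]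
    calc w j * w k * σ (k - j) ≤ |w j * w k| * |σ (k - j)| := (le_abs_self _).trans (abs_mul _ _).le
      _ ≤ 2⁻¹ * (w j ^ 2 + w k ^ 2) * |σ (k - j)| := by gcongr
      _ = _ := by ring
  calc ∫ ω, (∑ k ∈ T, w k * Y k ω) ^ 2 ∂P
      ≤ ∑ j ∈ T, ∑ k ∈ T,
          (2⁻¹ * (w j ^ 2 * |σ (k - j)|) + 2⁻¹ * (w k ^ 2 * |σ (k - j)|)) := by
        rw [h.integral_sum_mul_sq]
        exact Finset.sum_le_sum fun j _ => Finset.sum_le_sum fun k _ => hterm j k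
    _ = 2⁻¹ * ∑ j ∈ T, w j ^ 2 * ∑ k ∈ T, |σ (k - j)| +
          2⁻¹ * ∑ k ∈ T, w k ^ 2 * ∑ j ∈ T, |σ (k - j)| := by
        simp only [Finset.sum_add_distrib, Finset.mul_sum]
        congr 1
        exact Finset.sum_comm
    _ ≤ 2⁻¹ * ∑ j ∈ T, w j ^ 2 * B + 2⁻¹ * ∑ k ∈ T, w k ^ 2 * B := by
        gcongr with j _ k _
        · exact hrow j
        · exact hcol k
    _ = B * ∑ k ∈ T, w k ^ 2 := by
        rw [← Finset.sum_mul]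
        ring

lemma memLp_siteMean (h : IsAsymptoticallyLinear P θ h₀ Y σ B C γ) (S : Finset (Fin d → ℤ)) :
    MemLp (siteMean Y S) 2 P :=
  (memLp_finsetSum S fun k _ => h.memLp k).const_smul (S.card : ℝ)⁻¹

lemma integral_siteMean [IsFiniteMeasure P] (h : IsAsymptoticallyLinear P θ h₀ Y σ B C γ)
    (S : Finset (Fin d → ℤ)) : ∫ ω, siteMean Y S ω ∂P = 0 := by
  simp only [siteMean, smul_eq_mul]
  rw [integral_const_mul, integral_finsetSum _ fun k _ => (h.memLp k).integrable one_le_two]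
  simp [h.mean_zero]

lemma integral_siteMean_sq (h : IsAsymptoticallyLinear P θ h₀ Y σ B C γ)
    (S : Finset (Fin d → ℤ)) :
    ∫ ω, siteMean Y S ω ^ 2 ∂P = (S.card : ℝ)⁻¹ ^ 2 * ∑ j ∈ S, ∑ k ∈ S, σ (k - j) := by
  have hsum := h.integral_sum_mul_sq S fun _ => (S.card : ℝ)⁻¹
  simp only [← Finset.mul_sum] at hsum
  simp only [siteMean, smul_eq_mul, hsum]
  ring

lemma hasSum_card_leaving_mul (h : IsAsymptoticallyLinear P θ h₀ Y σ B C γ)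
    (S : Finset (Fin d → ℤ)) :
    HasSum (fun v => ((S.filter fun k => k + v ∉ S).card : ℝ) * σ v)
      (S.card * (∑' k, σ k) - ∑ j ∈ S, ∑ k ∈ S, σ (k - j)) := by
  have hstay (j : Fin d → ℤ) :
      HasSum (fun v => if j + v ∈ S then σ v else 0) (∑ k ∈ S, σ (k - j)) := by
    have hsum : HasSum (fun k => if k ∈ S then σ (k - j) else 0) (∑ k ∈ S, σ (k - j)) := by
      rw [← Finset.sum_congr rfl fun k (hk : k ∈ S) => if_pos (c := k ∈ S) hk]
      exact hasSum_sum_of_ne_finset_zero fun k hk => if_neg hk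
    simpa [Function.comp_def] using (Equiv.addLeft j).hasSum_iff.2 hsum
  have hleave := hasSum_sum fun j (_ : j ∈ S) => h.summable.hasSum.sub (hstay j)
  simp only [Finset.sum_sub_distrib, Finset.sum_const, nsmul_eq_mul] at hleave
  refine hleave.congr_fun fun v => ?_
  rw [← Finset.sum_filter, Finset.sum_const, nsmul_eq_mul,
    ← Finset.card_filter_add_card_filter_not (s := S) (fun k => k + v ∈ S)]
  push_cast
  ring

lemma abs_card_mul_integral_siteMean_sq_sub_le (h : IsAsymptoticallyLinear P θ h₀ Y σ B C γ)
    (hS : S.Nonempty) {b : ℝ} (hb0 : 0 ≤ b)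
    (hb : ∀ v, ((S.filter fun k => k + v ∉ S).card : ℝ) ≤ b * supNorm v) :
    |S.card * (∫ ω, siteMean Y S ω ^ 2 ∂P) - ∑' k, σ k| ≤ (S.card : ℝ)⁻¹ * (b * B) := by
  have hN : (0 : ℝ) < S.card := mod_cast hS.card_pos
  have hnonneg (v : Fin d → ℤ) : 0 ≤ ((supNorm v : ℝ) + 1) * |σ v| := by positivity
  have hsummable := summable_of_sum_le hnonneg h.sum_le
  have hterm (v : Fin d → ℤ) : ‖((S.filter fun k => k + v ∉ S).card : ℝ) * σ v‖ ≤
      b * (((supNorm v : ℝ) + 1) * |σ v|) := by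
    rw [norm_mul, Real.norm_natCast, Real.norm_eq_abs, ← mul_assoc]
    grw [hb v]
    gcongr
    linarith
  have hloss : |S.card * (∑' k, σ k) - ∑ j ∈ S, ∑ k ∈ S, σ (k - j)| ≤ b * B := by
    rw [← (h.hasSum_card_leaving_mul S).tsum_eq]
    refine (tsum_of_norm_bounded (hsummable.hasSum.mul_left b) hterm).trans ?_
    gcongr
    exact Real.tsum_le_of_sum_le hnonneg h.sum_le
  calc |S.card * (∫ ω, siteMean Y S ω ^ 2 ∂P) - ∑' k, σ k|
      = |-((S.card : ℝ)⁻¹ * (S.card * (∑' k, σ k) - ∑ j ∈ S, ∑ k ∈ S, σ (k - j)))| := by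
        rw [h.integral_siteMean_sq]
        congr 1
        field_simp
        ring
    _ = (S.card : ℝ)⁻¹ * |S.card * (∑' k, σ k) - ∑ j ∈ S, ∑ k ∈ S, σ (k - j)| := by
        rw [abs_neg, abs_mul, abs_of_pos (inv_pos.2 hN)]
    _ ≤ (S.card : ℝ)⁻¹ * (b * B) := by gcongr

lemma memLp_sub_const (h : IsAsymptoticallyLinear P θ h₀ Y σ B C γ) (hS : S.Nonempty) :
    MemLp (fun ω => θ S ω - h₀) 2 P := by
  simpa [Pi.add_def, linearizationError] using (h.memLp_siteMean S).add (h.error_memLp S hS)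

variable [IsProbabilityMeasure P]

lemma memLp_stat (h : IsAsymptoticallyLinear P θ h₀ Y σ B C γ) (hS : S.Nonempty) :
    MemLp (θ S) 2 P := by
  simpa [Pi.add_def] using (h.memLp_sub_const hS).add (memLp_const h₀)

lemma variance_eq (h : IsAsymptoticallyLinear P θ h₀ Y σ B C γ) (hS : S.Nonempty) :
    variance (θ S) P = (∫ ω, siteMean Y S ω ^ 2 ∂P) +
      2 * (∫ ω, siteMean Y S ω * linearizationError θ h₀ Y S ω ∂P) +
      variance (linearizationError θ h₀ Y S) P := by
  have hmean := h.memLp_siteMean S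
  have herror := h.error_memLp S hS
  have hsplit : θ S = fun ω => (siteMean Y S + linearizationError θ h₀ Y S) ω + h₀ := by
    funext ω
    simp [linearizationError]
  rw [hsplit, variance_add_const (hmean.add herror).aestronglyMeasurable,
    variance_add hmean herror, covariance_eq_sub hmean herror,
    variance_of_integral_eq_zero hmean.aemeasurable (h.integral_siteMean S),
    h.integral_siteMean S, zero_mul, sub_zero]
  rfl

theorem abs_card_mul_variance_sub_le (h : IsAsymptoticallyLinear P θ h₀ Y σ B C γ)
    (hS : S.Nonempty) {b : ℝ} (hb0 : 0 ≤ b)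
    (hb : ∀ v, ((S.filter fun k => k + v ∉ S).card : ℝ) ≤ b * supNorm v) :
    |S.card * variance (θ S) P - ∑' k, σ k| ≤
      (S.card : ℝ)⁻¹ * (b * B) + 2 * (C * (S.card : ℝ) ^ (-γ)) + C * (S.card : ℝ)⁻¹ := by
  have hN : (0 : ℝ) < S.card := mod_cast hS.card_pos
  have hcross : |S.card * ∫ ω, siteMean Y S ω * linearizationError θ h₀ Y S ω ∂P| ≤
      C * (S.card : ℝ) ^ (-γ) := by
    rw [abs_mul, abs_of_pos hN]
    grw [h.error_mul_le S hS]
    rw [neg_add, Real.rpow_add hN, Real.rpow_neg_one]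
    field_simp
    exact le_rfl
  have herror : |S.card * variance (linearizationError θ h₀ Y S) P| ≤ C * (S.card : ℝ)⁻¹ := by
    rw [abs_mul, abs_of_pos hN, abs_of_nonneg (variance_nonneg _ _)]
    grw [variance_le_expectation_sq (h.error_memLp S hS).aestronglyMeasurable]
    refine (mul_le_mul_of_nonneg_left (h.error_sq_le S hS) hN.le).trans_eq ?_
    field_simp
  have hsplit : S.card * variance (θ S) P - ∑' k, σ k =
      (S.card * (∫ ω, siteMean Y S ω ^ 2 ∂P) - ∑' k, σ k) +
      2 * (S.card * ∫ ω, siteMean Y S ω * linearizationError θ h₀ Y S ω ∂P) +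
      S.card * variance (linearizationError θ h₀ Y S) P := by
    rw [h.variance_eq hS]
    ring
  rw [hsplit]
  grw [abs_add_three, abs_mul 2, abs_two, h.abs_card_mul_integral_siteMean_sq_sub_le hS hb0 hb,
    hcross, herror]

lemma sq_integral_sub_const_le (h : IsAsymptoticallyLinear P θ h₀ Y σ B C γ) (hS : S.Nonempty) :
    (∫ ω, (θ S ω - h₀) ∂P) ^ 2 ≤ C * (S.card : ℝ)⁻¹ ^ 2 := by
  have herror := h.error_memLp S hS
  have hbias : ∫ ω, linearizationError θ h₀ Y S ω ∂P = ∫ ω, (θ S ω - h₀) ∂P := by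
    simp only [linearizationError]
    rw [integral_sub ((h.memLp_sub_const hS).integrable one_le_two)
      ((h.memLp_siteMean S).integrable one_le_two), h.integral_siteMean, sub_zero]
  have hvar := variance_nonneg (linearizationError θ h₀ Y S) P
  rw [variance_eq_sub herror, hbias] at hvar
  exact (sub_nonneg.1 hvar).trans (h.error_sq_le S hS)

lemma abs_card_mul_integral_sq_sub_le (h : IsAsymptoticallyLinear P θ h₀ Y σ B C γ)
    (hS : S.Nonempty) (τ : ℝ) :
    |S.card * (∫ ω, (θ S ω - h₀) ^ 2 ∂P) - τ| ≤
      |S.card * variance (θ S) P - τ| + C * (S.card : ℝ)⁻¹ := by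
  have hN : (0 : ℝ) < S.card := mod_cast hS.card_pos
  have hvar : variance (θ S) P =
      (∫ ω, (θ S ω - h₀) ^ 2 ∂P) - (∫ ω, (θ S ω - h₀) ∂P) ^ 2 := by
    rw [← variance_sub_const (h.memLp_stat hS).aestronglyMeasurable h₀,
      variance_eq_sub (h.memLp_sub_const hS)]
    rfl
  have hsplit : S.card * (∫ ω, (θ S ω - h₀) ^ 2 ∂P) - τ =
      (S.card * variance (θ S) P - τ) + S.card * (∫ ω, (θ S ω - h₀) ∂P) ^ 2 := by
    rw [hvar]
    ring
  rw [hsplit]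
  refine (abs_add_le _ _).trans (add_le_add_right ?_ _)
  rw [abs_of_nonneg (by positivity)]
  refine (mul_le_mul_of_nonneg_left (h.sq_integral_sub_const_le hS) hN.le).trans_eq ?_
  field_simp

end IsAsymptoticallyLinear

/-! ### Averages over families of blocks -/

/-- A nonempty family of blocks `S i`, `i ∈ J`, whose sizes lie between `V` and `c * V` and which
cover each site at most `M` times. -/
structure IsBlockFamily {d : ℕ} {ι : Type*} (J : Finset ι) (S : ι → Finset (Fin d → ℤ))
    (V c M : ℝ) : Prop where
  nonempty : J.Nonempty
  pos : 0 < V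
  le_card : ∀ i ∈ J, V ≤ (S i).card
  card_le : ∀ i ∈ J, ((S i).card : ℝ) ≤ c * V
  multiplicity_le : ∀ k, ((J.filter fun i => k ∈ S i).card : ℝ) ≤ M

/-- The total weight that a weighted average of block means puts on a site. -/
noncomputable def siteWeight {d : ℕ} {ι : Type*} (J : Finset ι) (S : ι → Finset (Fin d → ℤ))
    (w : ι → ℝ) (k : Fin d → ℤ) : ℝ :=
  ∑ i ∈ J with k ∈ S i, w i * ((S i).card : ℝ)⁻¹

section SiteWeight

variable {d : ℕ} {ι : Type*} {J : Finset ι} {S : ι → Finset (Fin d → ℤ)} {V c M A : ℝ} {w : ι → ℝ}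

lemma sum_mul_siteMean {Ω : Type*} (J : Finset ι) (S : ι → Finset (Fin d → ℤ)) (w : ι → ℝ)
    (Y : (Fin d → ℤ) → Ω → ℝ) (ω : Ω) :
    ∑ i ∈ J, w i * siteMean Y (S i) ω = ∑ k ∈ J.biUnion S, siteWeight J S w k * Y k ω := by
  simp only [siteMean, smul_eq_mul, siteWeight, Finset.sum_mul, Finset.mul_sum, ← mul_assoc]
  refine Finset.sum_comm' fun i k => ?_
  simp only [Finset.mem_biUnion, Finset.mem_filter]
  grind

namespace IsBlockFamily

lemma card_pos (hF : IsBlockFamily J S V c M) : (0 : ℝ) < J.card :=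
  mod_cast hF.nonempty.card_pos

lemma block_card_pos (hF : IsBlockFamily J S V c M) {i : ι} (hi : i ∈ J) :
    (0 : ℝ) < (S i).card :=
  hF.pos.trans_le (hF.le_card i hi)

lemma block_nonempty (hF : IsBlockFamily J S V c M) {i : ι} (hi : i ∈ J) : (S i).Nonempty :=
  Finset.card_pos.1 (mod_cast hF.block_card_pos hi)

lemma multiplicity_nonneg (hF : IsBlockFamily J S V c M) : 0 ≤ M :=
  (Nat.cast_nonneg _).trans (hF.multiplicity_le 0)

lemma ratio_nonneg (hF : IsBlockFamily J S V c M) : 0 ≤ c := by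
  obtain ⟨i, hi⟩ := hF.nonempty
  exact (pos_of_mul_pos_left ((hF.block_card_pos hi).trans_le (hF.card_le i hi)) hF.pos.le).le

lemma siteWeight_le (hF : IsBlockFamily J S V c M) (hw0 : ∀ i ∈ J, 0 ≤ w i)
    (hw : ∀ i ∈ J, w i ≤ A * (J.card : ℝ)⁻¹) (k : Fin d → ℤ) :
    siteWeight J S w k ≤ A * (M / (J.card * V)) := by
  have hV := hF.pos
  have hA : 0 ≤ A * (J.card : ℝ)⁻¹ := by
    obtain ⟨i, hi⟩ := hF.nonempty
    exact (hw0 i hi).trans (hw i hi)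
  calc siteWeight J S w k ≤ ∑ i ∈ J with k ∈ S i, A * (J.card : ℝ)⁻¹ * V⁻¹ := by
        refine Finset.sum_le_sum fun i hi => ?_
        have hi := (Finset.mem_filter.1 hi).1
        have hsize := hF.le_card i hi
        grw [hw i hi, ← hsize]
    _ = ((J.filter fun i => k ∈ S i).card : ℝ) * (A * (J.card : ℝ)⁻¹ * V⁻¹) := by
        rw [Finset.sum_const, nsmul_eq_mul]
    _ ≤ M * (A * (J.card : ℝ)⁻¹ * V⁻¹) := by
        gcongr
        exact hF.multiplicity_le k
    _ = A * (M / (J.card * V)) := by field_simp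

lemma sum_siteWeight (hF : IsBlockFamily J S V c M) (w : ι → ℝ) :
    ∑ k ∈ J.biUnion S, siteWeight J S w k = ∑ i ∈ J, w i := by
  have hone := sum_mul_siteMean J S w (fun _ (_ : Unit) => (1 : ℝ)) ()
  simp only [mul_one] at hone
  rw [← hone]
  refine Finset.sum_congr rfl fun i hi => ?_
  simp [siteMean, (hF.block_card_pos hi).ne']

lemma sum_siteWeight_sq_le (hF : IsBlockFamily J S V c M) (hw0 : ∀ i ∈ J, 0 ≤ w i)
    (hw : ∀ i ∈ J, w i ≤ A * (J.card : ℝ)⁻¹) :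
    ∑ k ∈ J.biUnion S, siteWeight J S w k ^ 2 ≤ A ^ 2 * (M / (J.card * V)) := by
  have hJ := hF.card_pos
  have hsum : ∑ i ∈ J, w i ≤ A := by
    refine (Finset.sum_le_sum hw).trans_eq ?_
    rw [Finset.sum_const, nsmul_eq_mul]
    field_simp
  have hsum0 : 0 ≤ ∑ i ∈ J, w i := Finset.sum_nonneg hw0
  have hM := hF.multiplicity_nonneg
  have hV := hF.pos
  calc ∑ k ∈ J.biUnion S, siteWeight J S w k ^ 2
      ≤ ∑ k ∈ J.biUnion S, A * (M / (J.card * V)) * siteWeight J S w k := by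
        refine Finset.sum_le_sum fun k _ => ?_
        rw [sq]
        refine mul_le_mul_of_nonneg_right (hF.siteWeight_le hw0 hw k) ?_
        exact Finset.sum_nonneg fun i hi =>
          mul_nonneg (hw0 i (Finset.mem_filter.1 hi).1) (by positivity)
    _ = A * (M / (J.card * V)) * ∑ i ∈ J, w i := by
        rw [← Finset.mul_sum, hF.sum_siteWeight]
    _ ≤ A * (M / (J.card * V)) * A := by
        have hA := hsum0.trans hsum
        gcongr
    _ = A ^ 2 * (M / (J.card * V)) := by ring

end IsBlockFamily

end SiteWeight

namespace IsAsymptoticallyLinear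

variable {d : ℕ} {Ω : Type*} [MeasurableSpace Ω] {P : Measure Ω}
  {θ : Finset (Fin d → ℤ) → Ω → ℝ} {h₀ : ℝ} {Y : (Fin d → ℤ) → Ω → ℝ} {σ : (Fin d → ℤ) → ℝ}
  {B C γ : ℝ} {ι : Type*} {J : Finset ι} {S : ι → Finset (Fin d → ℤ)} {V c M A : ℝ} {w : ι → ℝ}

lemma integral_sum_mul_error_sq_le (h : IsAsymptoticallyLinear P θ h₀ Y σ B C γ)
    (hF : IsBlockFamily J S V c M) (hw0 : ∀ i ∈ J, 0 ≤ w i)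
    (hw : ∀ i ∈ J, w i ≤ A * (J.card : ℝ)⁻¹) :
    ∫ ω, (∑ i ∈ J, w i * linearizationError θ h₀ Y (S i) ω) ^ 2 ∂P ≤ A ^ 2 * (C * V⁻¹ ^ 2) := by
  have hJ := hF.card_pos
  have hV := hF.pos
  have hC := h.const_nonneg
  have hmem (i : ι) (hi : i ∈ J) := h.error_memLp _ (hF.block_nonempty hi)
  have hint (i : ι) (hi : i ∈ J) : Integrable (fun ω => (A * (J.card : ℝ)⁻¹) ^ 2 *
      linearizationError θ h₀ Y (S i) ω ^ 2) P := (hmem i hi).integrable_sq.const_mul _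
  calc ∫ ω, (∑ i ∈ J, w i * linearizationError θ h₀ Y (S i) ω) ^ 2 ∂P
      ≤ ∫ ω, J.card * ∑ i ∈ J, (A * (J.card : ℝ)⁻¹) ^ 2 *
          linearizationError θ h₀ Y (S i) ω ^ 2 ∂P := by
        refine integral_mono (memLp_finsetSum J fun i hi => (hmem i hi).const_mul _).integrable_sq
          ((integrable_finsetSum J hint).const_mul _) fun ω => ?_
        refine sq_sum_le_card_mul_sum_sq.trans ?_
        simp only [mul_pow (w _)]
        gcongr with i hi
        · exact hw0 i hi
        · exact hw i hi
    _ = J.card * ∑ i ∈ J, (A * (J.card : ℝ)⁻¹) ^ 2 *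
          ∫ ω, linearizationError θ h₀ Y (S i) ω ^ 2 ∂P := by
        rw [integral_const_mul, integral_finsetSum J hint]
        simp only [integral_const_mul]
    _ ≤ J.card * ∑ _i ∈ J, (A * (J.card : ℝ)⁻¹) ^ 2 * (C * V⁻¹ ^ 2) := by
        gcongr with i hi
        have hsize := hF.le_card i hi
        grw [h.error_sq_le _ (hF.block_nonempty hi), ← hsize]
    _ = A ^ 2 * (C * V⁻¹ ^ 2) := by
        rw [Finset.sum_const, nsmul_eq_mul]
        field_simp

lemma integral_sum_mul_sub_const_sq_le (h : IsAsymptoticallyLinear P θ h₀ Y σ B C γ)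
    (hF : IsBlockFamily J S V c M) (hw0 : ∀ i ∈ J, 0 ≤ w i)
    (hw : ∀ i ∈ J, w i ≤ A * (J.card : ℝ)⁻¹) :
    ∫ ω, (∑ i ∈ J, w i * (θ (S i) ω - h₀)) ^ 2 ∂P ≤
      2 * A ^ 2 * (B * (M / (J.card * V)) + C * V⁻¹ ^ 2) := by
  have hmean : MemLp (fun ω => ∑ i ∈ J, w i * siteMean Y (S i) ω) 2 P :=
    memLp_finsetSum J fun i _ => (h.memLp_siteMean (S i)).const_mul (w i)
  have herror : MemLp (fun ω => ∑ i ∈ J, w i * linearizationError θ h₀ Y (S i) ω) 2 P :=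
    memLp_finsetSum J fun i hi => (h.error_memLp _ (hF.block_nonempty hi)).const_mul (w i)
  have hsplit (ω : Ω) : ∑ i ∈ J, w i * (θ (S i) ω - h₀) = ∑ i ∈ J, w i * siteMean Y (S i) ω +
      ∑ i ∈ J, w i * linearizationError θ h₀ Y (S i) ω := by
    simp only [← Finset.sum_add_distrib, ← mul_add, linearizationError, add_sub_cancel]
  have hmean_sq : ∫ ω, (∑ i ∈ J, w i * siteMean Y (S i) ω) ^ 2 ∂P ≤
      B * (A ^ 2 * (M / (J.card * V))) := by
    simp only [sum_mul_siteMean]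
    refine (h.integral_sum_mul_sq_le _ _).trans ?_
    exact mul_le_mul_of_nonneg_left (hF.sum_siteWeight_sq_le hw0 hw) h.bound_nonneg
  calc ∫ ω, (∑ i ∈ J, w i * (θ (S i) ω - h₀)) ^ 2 ∂P
      ≤ ∫ ω, 2 * ((∑ i ∈ J, w i * siteMean Y (S i) ω) ^ 2 +
          (∑ i ∈ J, w i * linearizationError θ h₀ Y (S i) ω) ^ 2) ∂P := by
        simp only [hsplit]
        exact integral_mono (hmean.add herror).integrable_sq
          ((hmean.integrable_sq.add herror.integrable_sq).const_mul 2) fun ω => add_sq_le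
    _ = 2 * ((∫ ω, (∑ i ∈ J, w i * siteMean Y (S i) ω) ^ 2 ∂P) +
          ∫ ω, (∑ i ∈ J, w i * linearizationError θ h₀ Y (S i) ω) ^ 2 ∂P) := by
        rw [integral_const_mul, integral_add hmean.integrable_sq herror.integrable_sq]
    _ ≤ 2 * (B * (A ^ 2 * (M / (J.card * V))) + A ^ 2 * (C * V⁻¹ ^ 2)) := by
        grw [hmean_sq, h.integral_sum_mul_error_sq_le hF hw0 hw]
    _ = 2 * A ^ 2 * (B * (M / (J.card * V)) + C * V⁻¹ ^ 2) := by ring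

end IsAsymptoticallyLinear

/-! ### The block variance -/

/-- The sample variance of the statistics of the blocks `S i`, `i ∈ J`, weighted by the block
sizes. Both subsample variance estimators are of this form. -/
noncomputable def blockVariance {d : ℕ} {ι Ω : Type*} (θ : Finset (Fin d → ℤ) → Ω → ℝ)
    (J : Finset ι) (S : ι → Finset (Fin d → ℤ)) (ω : Ω) : ℝ :=
  (J.card : ℝ)⁻¹ * ∑ i ∈ J, ((S i).card : ℝ) *
    (θ (S i) ω - (J.card : ℝ)⁻¹ * ∑ j ∈ J, θ (S j) ω) ^ 2

section BlockVariance

variable {d : ℕ} {Ω : Type*} {θ : Finset (Fin d → ℤ) → Ω → ℝ} {ι : Type*} {J : Finset ι}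
  {S : ι → Finset (Fin d → ℤ)} {V c M : ℝ}

lemma integrable_blockVariance [MeasurableSpace Ω] {P : Measure Ω} (hθ : ∀ S, MemLp (θ S) 2 P)
    (J : Finset ι) (S : ι → Finset (Fin d → ℤ)) : Integrable (blockVariance θ J S) P := by
  have hmean := (memLp_finsetSum J fun i _ => hθ (S i)).const_mul (J.card : ℝ)⁻¹
  exact (integrable_finsetSum J fun i _ =>
    ((hθ (S i)).sub hmean).integrable_sq.const_mul _).const_mul _

lemma blockVariance_eq (hJ : J.Nonempty) (h₀ : ℝ) (ω : Ω) :
    blockVariance θ J S ω =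
      (J.card : ℝ)⁻¹ * ∑ i ∈ J, (S i).card * (θ (S i) ω - h₀) ^ 2 -
      2 * ((∑ i ∈ J, (J.card : ℝ)⁻¹ * (θ (S i) ω - h₀)) *
        ∑ i ∈ J, (J.card : ℝ)⁻¹ * (S i).card * (θ (S i) ω - h₀)) +
      (J.card : ℝ)⁻¹ * (∑ i ∈ J, ((S i).card : ℝ)) *
        (∑ i ∈ J, (J.card : ℝ)⁻¹ * (θ (S i) ω - h₀)) ^ 2 := by
  have hcard : (J.card : ℝ) ≠ 0 := mod_cast hJ.card_pos.ne'
  set u := ∑ i ∈ J, (J.card : ℝ)⁻¹ * (θ (S i) ω - h₀) with hu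
  have hmean : (J.card : ℝ)⁻¹ * ∑ j ∈ J, θ (S j) ω = u + h₀ := by
    rw [hu, ← Finset.mul_sum, Finset.sum_sub_distrib, Finset.sum_const, nsmul_eq_mul]
    field_simp
    ring
  have hsquare (i : ι) : ((S i).card : ℝ) * (θ (S i) ω - (u + h₀)) ^ 2 =
      (S i).card * (θ (S i) ω - h₀) ^ 2 - 2 * u * ((S i).card * (θ (S i) ω - h₀)) +
        u ^ 2 * (S i).card := by ring
  simp only [blockVariance, hmean, hsquare, Finset.sum_add_distrib, Finset.sum_sub_distrib,
    mul_assoc, ← Finset.mul_sum]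
  ring

namespace IsAsymptoticallyLinear

variable [MeasurableSpace Ω] {P : Measure Ω} {h₀ : ℝ} {Y : (Fin d → ℤ) → Ω → ℝ}
  {σ : (Fin d → ℤ) → ℝ} {B C γ : ℝ}

lemma rate_le (h : IsAsymptoticallyLinear P θ h₀ Y σ B C γ) (hF : IsBlockFamily J S V c M) :
    V * (B * (M / (J.card * V)) + C * V⁻¹ ^ 2) ≤ (B + C) * (V⁻¹ + M / J.card) := by
  have hV := hF.pos
  have hM := hF.multiplicity_nonneg
  have hB := h.bound_nonneg
  have hC := h.const_nonneg
  calc V * (B * (M / (J.card * V)) + C * V⁻¹ ^ 2) = B * (M / J.card) + C * V⁻¹ := by field_simp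
    _ ≤ (B + C) * (V⁻¹ + M / J.card) := by
        rw [add_mul]
        gcongr
        · exact le_add_of_nonneg_left (by positivity)
        · exact le_add_of_nonneg_right (by positivity)

lemma mul_integral_blockMean_sq_le (h : IsAsymptoticallyLinear P θ h₀ Y σ B C γ)
    (hF : IsBlockFamily J S V c M) :
    V * ∫ ω, (∑ i ∈ J, (J.card : ℝ)⁻¹ * (θ (S i) ω - h₀)) ^ 2 ∂P ≤
      2 * ((B + C) * (V⁻¹ + M / J.card)) := by
  have hV := hF.pos
  have hsq := h.integral_sum_mul_sub_const_sq_le hF (A := 1) (w := fun _ => (J.card : ℝ)⁻¹)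
    (fun _ _ => by positivity) fun _ _ => (one_mul _).ge
  grw [hsq, ← h.rate_le hF]
  exact le_of_eq (by ring)

lemma inv_mul_integral_weightedMean_sq_le (h : IsAsymptoticallyLinear P θ h₀ Y σ B C γ)
    (hF : IsBlockFamily J S V c M) :
    V⁻¹ * ∫ ω, (∑ i ∈ J, (J.card : ℝ)⁻¹ * (S i).card * (θ (S i) ω - h₀)) ^ 2 ∂P ≤
      2 * c ^ 2 * ((B + C) * (V⁻¹ + M / J.card)) := by
  have hV := hF.pos
  have hsq := h.integral_sum_mul_sub_const_sq_le hF (A := c * V)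
    (w := fun i => (J.card : ℝ)⁻¹ * (S i).card) (fun _ _ => by positivity) fun i hi => by
      rw [mul_comm]
      gcongr
      exact hF.card_le i hi
  grw [hsq, ← h.rate_le hF]
  exact le_of_eq (by field_simp)

lemma integral_blockVariance_eq (h : IsAsymptoticallyLinear P θ h₀ Y σ B C γ)
    (hF : IsBlockFamily J S V c M) :
    ∫ ω, blockVariance θ J S ω ∂P =
      (J.card : ℝ)⁻¹ * ∑ i ∈ J, ((S i).card * ∫ ω, (θ (S i) ω - h₀) ^ 2 ∂P) -
      2 * (∫ ω, (∑ i ∈ J, (J.card : ℝ)⁻¹ * (θ (S i) ω - h₀)) *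
        ∑ i ∈ J, (J.card : ℝ)⁻¹ * (S i).card * (θ (S i) ω - h₀) ∂P) +
      (J.card : ℝ)⁻¹ * (∑ i ∈ J, ((S i).card : ℝ)) *
        ∫ ω, (∑ i ∈ J, (J.card : ℝ)⁻¹ * (θ (S i) ω - h₀)) ^ 2 ∂P := by
  have hmem (i : ι) (hi : i ∈ J) := h.memLp_sub_const (hF.block_nonempty hi)
  have hu : MemLp (fun ω => ∑ i ∈ J, (J.card : ℝ)⁻¹ * (θ (S i) ω - h₀)) 2 P :=
    memLp_finsetSum J fun i hi => (hmem i hi).const_mul _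
  have hv : MemLp (fun ω => ∑ i ∈ J, (J.card : ℝ)⁻¹ * (S i).card * (θ (S i) ω - h₀)) 2 P :=
    memLp_finsetSum J fun i hi => (hmem i hi).const_mul _
  have huv : Integrable (fun ω => (∑ i ∈ J, (J.card : ℝ)⁻¹ * (θ (S i) ω - h₀)) *
      ∑ i ∈ J, (J.card : ℝ)⁻¹ * (S i).card * (θ (S i) ω - h₀)) P := hu.integrable_mul hv
  have hsq (i : ι) (hi : i ∈ J) :
      Integrable (fun ω => ((S i).card : ℝ) * (θ (S i) ω - h₀) ^ 2) P :=
    (hmem i hi).integrable_sq.const_mul _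
  have hsum := (integrable_finsetSum J hsq).const_mul (J.card : ℝ)⁻¹
  have hdiff : Integrable (fun ω => (J.card : ℝ)⁻¹ * ∑ i ∈ J, (S i).card * (θ (S i) ω - h₀) ^ 2 -
      2 * ((∑ i ∈ J, (J.card : ℝ)⁻¹ * (θ (S i) ω - h₀)) *
        ∑ i ∈ J, (J.card : ℝ)⁻¹ * (S i).card * (θ (S i) ω - h₀))) P :=
    hsum.sub (huv.const_mul 2)
  simp only [blockVariance_eq hF.nonempty h₀]
  rw [integral_add hdiff (hu.integrable_sq.const_mul _),
    integral_sub hsum (huv.const_mul 2)]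
  simp only [integral_const_mul]
  rw [integral_finsetSum J hsq]
  simp only [integral_const_mul]

variable [IsProbabilityMeasure P]

lemma abs_mean_card_mul_integral_sq_sub_le (h : IsAsymptoticallyLinear P θ h₀ Y σ B C γ)
    (hF : IsBlockFamily J S V c M) {τ η : ℝ}
    (hη : ∀ i ∈ J, |(S i).card * variance (θ (S i)) P - τ| ≤ η) :
    |(J.card : ℝ)⁻¹ * ∑ i ∈ J, ((S i).card * ∫ ω, (θ (S i) ω - h₀) ^ 2 ∂P) - τ| ≤
      η + C * V⁻¹ := by
  have hJ := hF.card_pos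
  have hV := hF.pos
  have hC := h.const_nonneg
  have hterm (i : ι) (hi : i ∈ J) :
      |(S i).card * (∫ ω, (θ (S i) ω - h₀) ^ 2 ∂P) - τ| ≤ η + C * V⁻¹ := by
    have hsize := hF.le_card i hi
    grw [h.abs_card_mul_integral_sq_sub_le (hF.block_nonempty hi), hη i hi, ← hsize]
  calc |(J.card : ℝ)⁻¹ * ∑ i ∈ J, ((S i).card * ∫ ω, (θ (S i) ω - h₀) ^ 2 ∂P) - τ|
      = (J.card : ℝ)⁻¹ * |∑ i ∈ J, ((S i).card * (∫ ω, (θ (S i) ω - h₀) ^ 2 ∂P) - τ)| := by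
        rw [← abs_of_pos (inv_pos.2 hJ), ← abs_mul, abs_of_pos (inv_pos.2 hJ),
          Finset.sum_sub_distrib, Finset.sum_const, nsmul_eq_mul, mul_sub,
          inv_mul_cancel_left₀ hJ.ne']
    _ ≤ (J.card : ℝ)⁻¹ * ∑ _i ∈ J, (η + C * V⁻¹) := by
        gcongr
        exact (Finset.abs_sum_le_sum_abs _ _).trans (Finset.sum_le_sum hterm)
    _ = η + C * V⁻¹ := by
        rw [Finset.sum_const, nsmul_eq_mul, inv_mul_cancel_left₀ hJ.ne']

/-- The deviation of the block average from the constant `h₀` contributes a cross term and a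
square to the block variance, both of which are small in `L¹` because the average runs over many
blocks. -/
theorem abs_integral_blockVariance_sub_le (h : IsAsymptoticallyLinear P θ h₀ Y σ B C γ)
    (hF : IsBlockFamily J S V c M) {τ η : ℝ}
    (hη : ∀ i ∈ J, |(S i).card * variance (θ (S i)) P - τ| ≤ η) :
    |(∫ ω, blockVariance θ J S ω ∂P) - τ| ≤
      η + (C + (4 + 4 * c ^ 2 + 2 * c) * (B + C)) * (V⁻¹ + M / J.card) := by
  have hJ := hF.card_pos
  have hC := h.const_nonneg
  have hM := hF.multiplicity_nonneg
  have hmem (i : ι) (hi : i ∈ J) := h.memLp_sub_const (hF.block_nonempty hi)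
  set u : Ω → ℝ := fun ω => ∑ i ∈ J, (J.card : ℝ)⁻¹ * (θ (S i) ω - h₀)
  set v : Ω → ℝ := fun ω => ∑ i ∈ J, (J.card : ℝ)⁻¹ * (S i).card * (θ (S i) ω - h₀)
  set n : ℝ := (J.card : ℝ)⁻¹ * ∑ i ∈ J, ((S i).card : ℝ)
  set ε : ℝ := V⁻¹ + M / J.card
  have hdiag := h.abs_mean_card_mul_integral_sq_sub_le hF hη
  have hcross : |∫ ω, u ω * v ω ∂P| ≤ (2 + 2 * c ^ 2) * ((B + C) * ε) := by
    refine (abs_integral_mul_le_of_sq (memLp_finsetSum J fun i hi => (hmem i hi).const_mul _)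
      (memLp_finsetSum J fun i hi => (hmem i hi).const_mul _) hF.pos).trans ?_
    linarith [h.mul_integral_blockMean_sq_le hF, h.inv_mul_integral_weightedMean_sq_le hF]
  have hn : n ≤ c * V := by
    refine (mul_le_mul_of_nonneg_left (Finset.sum_le_sum hF.card_le) (by positivity)).trans_eq ?_
    rw [Finset.sum_const, nsmul_eq_mul, inv_mul_cancel_left₀ hJ.ne']
  have hsquare : |n * ∫ ω, u ω ^ 2 ∂P| ≤ 2 * c * ((B + C) * ε) := by
    rw [abs_of_nonneg (mul_nonneg (by positivity) (integral_nonneg fun ω => sq_nonneg _))]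
    grw [hn, mul_assoc, h.mul_integral_blockMean_sq_le hF]
    · exact le_of_eq (by ring)
    · exact hF.ratio_nonneg
  have hε : V⁻¹ ≤ ε := le_add_of_nonneg_right (by positivity)
  rw [h.integral_blockVariance_eq hF, add_sub_right_comm, sub_right_comm]
  grw [abs_add_le, abs_sub, hdiag, abs_mul 2, abs_two, hcross, hsquare, hε]
  exact le_of_eq (by ring)

end IsAsymptoticallyLinear

end BlockVariance

/-! ### Sites in scaled and translated regions -/

/-- The integer vectors in the box with corners `lo` and `hi`. -/
noncomputable def integerBox {d : ℕ} (lo hi : Fin d → ℝ) : Finset (Fin d → ℤ) :=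
  Finset.Icc (fun i => ⌈lo i⌉) fun i => ⌊hi i⌋

/-- The elements of a set as a finset, and the empty finset if the set is infinite: the junk value
that makes sums over it agree with `finsum` and its cardinality with `Set.ncard`. -/
noncomputable def toFinsetOrEmpty {α : Type*} (s : Set α) : Finset α :=
  open Classical in if h : s.Finite then h.toFinset else ∅

/-- The sites of the lattice `t + ℤ^d` in the region `A`, as a finset. -/
noncomputable def siteFinset {d : ℕ} (t : Fin d → ℝ) (A : Set (Fin d → ℝ)) : Finset (Fin d → ℤ) :=
  toFinsetOrEmpty (sites t A)

section ToFinsetOrEmpty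

variable {α : Type*} {s : Set α}

lemma mem_toFinsetOrEmpty (hs : s.Finite) {a : α} : a ∈ toFinsetOrEmpty s ↔ a ∈ s := by
  simp [toFinsetOrEmpty, hs]

lemma ncard_eq_card_toFinsetOrEmpty (s : Set α) : s.ncard = (toFinsetOrEmpty s).card := by
  by_cases hs : s.Finite
  · simp [toFinsetOrEmpty, hs, Set.ncard_eq_toFinset_card s hs]
  · simp [toFinsetOrEmpty, hs, Set.Infinite.ncard hs]

lemma finAverage_eq {E : Type*} [AddCommGroup E] [Module ℝ E] (s : Set α) (f : α → E) :
    finAverage s f = ((toFinsetOrEmpty s).card : ℝ)⁻¹ • ∑ a ∈ toFinsetOrEmpty s, f a := by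
  rw [finAverage, ncard_eq_card_toFinsetOrEmpty]
  by_cases hs : s.Finite
  · simp [finsum_mem_eq_finite_toFinset_sum _ hs, toFinsetOrEmpty, hs]
  · simp [toFinsetOrEmpty, hs]

end ToFinsetOrEmpty

section Sites

variable {d : ℕ} {t l : Fin d → ℝ} {i k : Fin d → ℤ} {A : Set (Fin d → ℝ)}

lemma siteCount_eq_card (t : Fin d → ℝ) (A : Set (Fin d → ℝ)) :
    siteCount t A = (siteFinset t A).card := ncard_eq_card_toFinsetOrEmpty _

lemma thetaHat_eq_siteMean {p : ℕ} {Ω : Type*} (t : Fin d → ℝ)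
    (Z : (Fin d → ℤ) → Ω → EuclideanSpace ℝ (Fin p)) (H : EuclideanSpace ℝ (Fin p) → ℝ)
    (A : Set (Fin d → ℝ)) : thetaHat t Z H A = fun ω => H (siteMean Z (siteFinset t A) ω) := by
  funext ω
  rw [thetaHat, finAverage_eq]
  rfl

lemma mem_scaleSet (hl : ∀ i, 0 < l i) {x : Fin d → ℝ} :
    x ∈ scaleSet l A ↔ (fun i => x i / l i) ∈ A := by
  constructor
  · rintro ⟨y, hy, rfl⟩
    simpa only [mul_div_cancel_left₀ _ (hl _).ne'] using hy
  · exact fun hx => ⟨_, hx, funext fun i => mul_div_cancel₀ _ (hl i).ne'⟩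

lemma mem_shiftSet {x : Fin d → ℝ} : x ∈ shiftSet i A ↔ (fun j => x j - i j) ∈ A := by
  constructor
  · rintro ⟨y, hy, rfl⟩
    simpa only [add_sub_cancel_left] using hy
  · exact fun hx => ⟨_, hx, funext fun j => add_sub_cancel _ _⟩

lemma mem_sites_shiftSet : k ∈ sites t (shiftSet i A) ↔ k - i ∈ sites t A := by
  simp only [sites, Set.mem_ofPred_eq, mem_shiftSet, Pi.sub_apply, Int.cast_sub, add_sub_assoc]

lemma siteFinset_shiftSet (t : Fin d → ℝ) (i : Fin d → ℤ) (A : Set (Fin d → ℝ)) :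
    siteFinset t (shiftSet i A) = siteFinset (fun j => t j - i j) A := by
  have hsites : sites t (shiftSet i A) = sites (fun j => t j - i j) A := by
    ext k
    simp only [sites, Set.mem_ofPred_eq, mem_shiftSet, add_sub_right_comm]
  rw [siteFinset, hsites, siteFinset]

lemma siteFinset_scaleSet_shiftSet (hl : ∀ i, 0 < l i) (t : Fin d → ℝ) (i : Fin d → ℤ)
    (A : Set (Fin d → ℝ)) :
    siteFinset t (scaleSet l (shiftSet i A)) =
      siteFinset (fun j => t j - l j * i j) (scaleSet l A) := by
  have hcoord (k : Fin d → ℤ) (j : Fin d) :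
      (t j + k j) / l j - i j = (t j - l j * i j + k j) / l j := by
    rw [sub_add_eq_add_sub, sub_div, mul_div_cancel_left₀ _ (hl j).ne']
  have hsites : sites t (scaleSet l (shiftSet i A)) =
      sites (fun j => t j - l j * i j) (scaleSet l A) := by
    ext k
    simp only [sites, Set.mem_ofPred_eq, mem_scaleSet hl, mem_shiftSet, hcoord]
  rw [siteFinset, hsites, siteFinset]

lemma mem_siteFinset_shiftSet : k ∈ siteFinset t (shiftSet i A) ↔ k - i ∈ siteFinset t A := by
  have hsites : sites t (shiftSet i A) = Equiv.subRight i ⁻¹' sites t A :=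
    Set.ext fun _ => mem_sites_shiftSet
  by_cases hA : (sites t A).Finite
  · have hshift : (sites t (shiftSet i A)).Finite :=
      hsites ▸ hA.preimage (Equiv.injective _).injOn
    rw [siteFinset, siteFinset, mem_toFinsetOrEmpty hA, mem_toFinsetOrEmpty hshift,
      mem_sites_shiftSet]
  · have hshift : ¬ (sites t (shiftSet i A)).Finite := fun hfin =>
      hA ((hsites ▸ hfin).of_preimage (Equiv.surjective _))
    simp [siteFinset, toFinsetOrEmpty, hA, hshift]

lemma card_siteFinset_shiftSet (t : Fin d → ℝ) (i : Fin d → ℤ) (A : Set (Fin d → ℝ)) :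
    (siteFinset t (shiftSet i A)).card = (siteFinset t A).card :=
  Finset.card_equiv (Equiv.subRight i) fun _ => mem_siteFinset_shiftSet

end Sites

section IntegerBox

variable {d : ℕ} {lo hi w : Fin d → ℝ}

lemma mem_integerBox {k : Fin d → ℤ} : k ∈ integerBox lo hi ↔ ∀ i, lo i ≤ k i ∧ k i ≤ hi i := by
  simp only [integerBox, Finset.mem_Icc, Pi.le_def, Int.ceil_le, Int.le_floor, forall_and]

lemma card_integerBox (lo hi : Fin d → ℝ) :
    ((integerBox lo hi).card : ℝ) = ∏ i, ((⌊hi i⌋ + 1 - ⌈lo i⌉).toNat : ℝ) := by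
  simp only [integerBox, Pi.card_Icc, Int.card_Icc, Nat.cast_prod]

lemma card_integerBox_le (h : ∀ i, lo i ≤ hi i + 1) :
    ((integerBox lo hi).card : ℝ) ≤ ∏ i, (hi i - lo i + 1) := by
  rw [card_integerBox]
  refine Finset.prod_le_prod (fun _ _ => Nat.cast_nonneg _) fun i _ => ?_
  rw [← Int.cast_natCast, Int.toNat_eq_max]
  push_cast
  exact max_le (by linarith [Int.floor_le (hi i), Int.le_ceil (lo i)]) (by linarith [h i])

lemma prod_le_card_integerBox (hw : ∀ i, 0 ≤ w i) (h : ∀ i, w i ≤ hi i - lo i - 1) :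
    ∏ i, w i ≤ ((integerBox lo hi).card : ℝ) := by
  rw [card_integerBox]
  refine Finset.prod_le_prod (fun i _ => hw i) fun i _ => ?_
  have htoNat : ((⌊hi i⌋ + 1 - ⌈lo i⌉ : ℤ) : ℝ) ≤ (⌊hi i⌋ + 1 - ⌈lo i⌉).toNat :=
    mod_cast Int.self_le_toNat _
  push_cast at htoNat
  linarith [h i, Int.lt_floor_add_one (hi i), Int.ceil_lt_add_one (lo i)]

lemma pow_mul_prod_le_card {F : Finset (Fin d → ℤ)} {ε : ℝ} {l t : Fin d → ℝ}
    (hεl : ∀ i, 1 ≤ ε * l i) (hF : ∀ k : Fin d → ℤ, (∀ i, |t i + k i| ≤ ε * l i) → k ∈ F) :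
    ε ^ d * ∏ i, l i ≤ F.card := by
  have hsub : integerBox (fun i => -t i - ε * l i) (fun i => -t i + ε * l i) ⊆ F := by
    refine fun k hk => hF k fun i => ?_
    have hki := mem_integerBox.1 hk i
    rw [abs_le]
    constructor <;> linarith
  calc ε ^ d * ∏ i, l i = ∏ i, ε * l i := by
        rw [Finset.prod_mul_distrib, Finset.prod_const, Finset.card_fin]
    _ ≤ ((integerBox (fun i => -t i - ε * l i) fun i => -t i + ε * l i).card : ℝ) :=
        prod_le_card_integerBox (fun i => by linarith [hεl i]) fun i => by linarith [hεl i]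
    _ ≤ F.card := mod_cast Finset.card_le_card hsub

end IntegerBox

namespace IsTemplate

variable {d : ℕ} {R₀ : Set (Fin d → ℝ)} {l t : Fin d → ℝ} {ε : ℝ}

lemma abs_apply_le (hR₀ : IsTemplate R₀) {x : Fin d → ℝ} (hx : x ∈ R₀) (i : Fin d) :
    |x i| ≤ 1 / 2 := by
  have hcube := hR₀.subset_unitCube hx i
  exact abs_le.2 ⟨hcube.1.le, hcube.2⟩

lemma exists_box_subset (hR₀ : IsTemplate R₀) :
    ∃ ε : ℝ, 0 < ε ∧ {x | ∀ i, |x i| ≤ ε} ⊆ R₀ := by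
  obtain ⟨ε, hε, hball⟩ := Metric.nhds_basis_closedBall.mem_iff.1 hR₀.nhds_origin
  refine ⟨ε, hε, fun x hx => hball ?_⟩
  exact mem_closedBall_zero_iff.2 ((pi_norm_le_iff_of_nonneg hε.le).2 hx)

lemma sites_subset (hR₀ : IsTemplate R₀) (hl : ∀ i, 0 < l i) (t : Fin d → ℝ) :
    sites t (scaleSet l R₀) ⊆ integerBox (fun i => -t i - l i / 2) fun i => -t i + l i / 2 := by
  intro k hk
  rw [Finset.mem_coe, mem_integerBox]
  intro i
  have habs := hR₀.abs_apply_le ((mem_scaleSet hl).1 hk) i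
  rw [abs_div, abs_of_pos (hl i), div_le_iff₀ (hl i), abs_le] at habs
  constructor <;> linarith

lemma finite_sites (hR₀ : IsTemplate R₀) (hl : ∀ i, 0 < l i) (t : Fin d → ℝ) :
    (sites t (scaleSet l R₀)).Finite :=
  (Finset.finite_toSet _).subset (hR₀.sites_subset hl t)

lemma mem_siteFinset (hR₀ : IsTemplate R₀) (hl : ∀ i, 0 < l i) {k : Fin d → ℤ} :
    k ∈ siteFinset t (scaleSet l R₀) ↔ (fun i => (t i + k i) / l i) ∈ R₀ := by
  rw [siteFinset, mem_toFinsetOrEmpty (hR₀.finite_sites hl t)]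
  exact mem_scaleSet hl

lemma pow_mul_prod_le_card_siteFinset (hR₀ : IsTemplate R₀) (hbox : {x | ∀ i, |x i| ≤ ε} ⊆ R₀)
    (hl : ∀ i, 0 < l i) (hεl : ∀ i, 1 ≤ ε * l i) (t : Fin d → ℝ) :
    ε ^ d * ∏ i, l i ≤ (siteFinset t (scaleSet l R₀)).card := by
  refine pow_mul_prod_le_card (t := t) hεl fun k hk => (hR₀.mem_siteFinset hl).2 (hbox fun i => ?_)
  rw [abs_div, abs_of_pos (hl i), div_le_iff₀ (hl i)]
  exact hk i

lemma card_siteFinset_le (hR₀ : IsTemplate R₀) (hl : ∀ i, 1 ≤ l i) (t : Fin d → ℝ) :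
    ((siteFinset t (scaleSet l R₀)).card : ℝ) ≤ 2 ^ d * ∏ i, l i := by
  have hl0 (i : Fin d) : 0 < l i := zero_lt_one.trans_le (hl i)
  have hsub : siteFinset t (scaleSet l R₀) ⊆
      integerBox (fun i => -t i - l i / 2) (fun i => -t i + l i / 2) := fun k hk =>
    hR₀.sites_subset hl0 t ((mem_toFinsetOrEmpty (hR₀.finite_sites hl0 t)).1 hk)
  calc ((siteFinset t (scaleSet l R₀)).card : ℝ)
      ≤ ((integerBox (fun i => -t i - l i / 2) fun i => -t i + l i / 2).card : ℝ) :=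
        mod_cast Finset.card_le_card hsub
    _ ≤ ∏ i, ((-t i + l i / 2) - (-t i - l i / 2) + 1) :=
        card_integerBox_le fun i => by linarith [hl0 i]
    _ ≤ ∏ i, 2 * l i := Finset.prod_le_prod (fun i _ => by linarith [hl0 i])
        fun i _ => by linarith [hl i]
    _ = 2 ^ d * ∏ i, l i := by rw [Finset.prod_mul_distrib, Finset.prod_const, Finset.card_fin]

lemma exists_card_siteFinset_bounds (hR₀ : IsTemplate R₀) :
    ∃ c Λ : ℝ, 0 < c ∧ 1 ≤ Λ ∧ ∀ l : Fin d → ℝ, (∀ i, Λ ≤ l i) → ∀ t : Fin d → ℝ,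
      c * ∏ i, l i ≤ (siteFinset t (scaleSet l R₀)).card ∧
      ((siteFinset t (scaleSet l R₀)).card : ℝ) ≤ 2 ^ d * ∏ i, l i := by
  obtain ⟨ε, hε, hbox⟩ := hR₀.exists_box_subset
  refine ⟨ε ^ d, max 1 ε⁻¹, by positivity, le_max_left _ _, fun l hl t => ?_⟩
  have hl1 (i : Fin d) : 1 ≤ l i := (le_max_left _ _).trans (hl i)
  refine ⟨hR₀.pow_mul_prod_le_card_siteFinset hbox (fun _ => zero_lt_one.trans_le (hl1 _))
    (fun _ => ?_) t, hR₀.card_siteFinset_le hl1 t⟩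
  exact (inv_le_iff_one_le_mul₀' hε).1 ((le_max_right _ _).trans (hl _))

end IsTemplate

/-! ### Sites near the boundary of a region -/

/-- The indices of the cubes of the lattice `a ℤ^d` that are counted by `boundaryCubeCount`. -/
def boundaryCubes {d : ℕ} (A : Set (Fin d → ℝ)) (a : ℝ) : Set (Fin d → ℤ) :=
  {k | (latticeCube a k ∩ closure A).Nonempty ∧ (latticeCube a k ∩ closure Aᶜ).Nonempty}

section Boundary

lemma segment_inter_frontier_nonempty {E : Type*} [AddCommGroup E] [Module ℝ E]
    [TopologicalSpace E] [ContinuousAdd E] [ContinuousSMul ℝ E] {A : Set E} {x y : E}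
    (hx : x ∈ A) (hy : y ∉ A) : (segment ℝ x y ∩ frontier A).Nonempty := by
  rw [frontier_eq_closure_inter_closure]
  exact isPreconnected_closed_iff.1 (convex_segment x y).isPreconnected _ _ isClosed_closure
    isClosed_closure (fun z _ => (em (z ∈ A)).imp (fun h => subset_closure h)
      fun h => subset_closure h)
    ⟨x, left_mem_segment ℝ x y, subset_closure hx⟩
    ⟨y, right_mem_segment ℝ x y, subset_closure hy⟩

lemma mem_latticeCube_floor {d : ℕ} {a : ℝ} (ha : 0 < a) (x : Fin d → ℝ) :
    x ∈ latticeCube a fun i => ⌊x i / a⌋ := fun _ =>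
  ⟨(le_div_iff₀' ha).1 (Int.floor_le _), (div_le_iff₀' ha).1 (Int.lt_floor_add_one _).le⟩

lemma card_filter_add_notMem_le {α : Type*} [AddCommGroup α] [DecidableEq α] (S : Finset α)
    (u v : α) : (S.filter fun k => k + (u + v) ∉ S).card ≤
      (S.filter fun k => k + u ∉ S).card + (S.filter fun k => k + v ∉ S).card := by
  have hsub : (S.filter fun k => k + (u + v) ∉ S) ⊆ (S.filter fun k => k + u ∉ S) ∪
      (S.filter fun k => k + v ∉ S).image fun k => k - u := by
    intro k hk
    obtain ⟨hkS, hkuv⟩ := Finset.mem_filter.1 hk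
    by_cases hku : k + u ∈ S
    · refine Finset.mem_union_right _ (Finset.mem_image.2 ⟨k + u, ?_, add_sub_cancel_right k u⟩)
      exact Finset.mem_filter.2 ⟨hku, by rwa [add_assoc]⟩
    · exact Finset.mem_union_left _ (Finset.mem_filter.2 ⟨hkS, hku⟩)
  grw [hsub, Finset.card_union_le, Finset.card_image_le (s := S.filter fun k => k + v ∉ S)]

lemma exists_add_eq_of_supNorm_le_succ {d n : ℕ} {v : Fin d → ℤ} (hv : supNorm v ≤ n + 1) :
    ∃ u w : Fin d → ℤ, u + w = v ∧ supNorm u ≤ 1 ∧ supNorm w ≤ n := by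
  refine ⟨fun i => (v i).sign, fun i => v i - (v i).sign, funext fun i => add_sub_cancel _ _,
    supNorm_le_iff.2 fun i => ?_, supNorm_le_iff.2 fun i => ?_⟩
  · rw [Int.natAbs_sign]
    split_ifs <;> simp
  · have hvi := supNorm_le_iff.1 hv i
    rcases lt_trichotomy (v i) 0 with hneg | hzero | hpos
    · rw [Int.sign_eq_neg_one_of_neg hneg]
      omega
    · simp [hzero]
    · rw [Int.sign_eq_one_of_pos hpos]
      omega

lemma card_filter_add_notMem_le_mul {d : ℕ} {S : Finset (Fin d → ℤ)} {b : ℝ}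
    (hb : ∀ u, supNorm u ≤ 1 → ((S.filter fun k => k + u ∉ S).card : ℝ) ≤ b) {n : ℕ}
    {v : Fin d → ℤ} (hv : supNorm v ≤ n) :
    ((S.filter fun k => k + v ∉ S).card : ℝ) ≤ b * n := by
  induction n generalizing v with
  | zero => simp [supNorm_eq_zero.1 (Nat.le_zero.1 hv)]
  | succ n ih =>
    obtain ⟨u, w, rfl, hu, hw⟩ := exists_add_eq_of_supNorm_le_succ hv
    calc ((S.filter fun k => k + (u + w) ∉ S).card : ℝ)
        ≤ (S.filter fun k => k + u ∉ S).card + (S.filter fun k => k + w ∉ S).card :=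
          mod_cast card_filter_add_notMem_le S u w
      _ ≤ b + b * n := add_le_add (hb u hu) (ih hw)
      _ = b * (n + 1 : ℕ) := by push_cast; ring

namespace IsTemplate

variable {d : ℕ} {R₀ : Set (Fin d → ℝ)} {l t : Fin d → ℝ} {a K : ℝ}

lemma finite_boundaryCubes (hR₀ : IsTemplate R₀) (ha : 0 < a) : (boundaryCubes R₀ a).Finite := by
  refine (Finset.finite_toSet
    (integerBox (fun _ => -(1 / 2) / a - 1) fun _ => 1 / 2 / a)).subset ?_
  rintro k ⟨⟨x, hx, hxR⟩, -⟩
  rw [Finset.mem_coe, mem_integerBox]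
  intro i
  have hclosure : closure R₀ ⊆ {x | |x i| ≤ 1 / 2} :=
    closure_minimal (fun x hx => hR₀.abs_apply_le hx i)
      (isClosed_le (continuous_apply i).abs continuous_const)
  have hxi : -(1 / 2) ≤ x i ∧ x i ≤ 1 / 2 := abs_le.1 (hclosure hxR)
  have hcube := hx i
  rw [sub_le_iff_le_add, div_le_iff₀ ha, le_div_iff₀ ha]
  constructor <;> linarith

/-- If a step of length at most one leaves the scaled template, then it crosses the frontier, and
the cube that contains the crossing point is a boundary cube. -/
lemma exists_boundaryCube_of_add_notMem (hR₀ : IsTemplate R₀) (hl : ∀ i, 0 < l i) (ha : 0 < a)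
    (hK : ∀ i, l i * a ≤ K) {u k : Fin d → ℤ} (hu : supNorm u ≤ 1)
    (hk : k ∈ siteFinset t (scaleSet l R₀)) (hku : k + u ∉ siteFinset t (scaleSet l R₀)) :
    ∃ κ ∈ boundaryCubes R₀ a, k ∈ integerBox (fun i => l i * a * κ i - t i - 1)
      fun i => l i * a * κ i - t i + (K + 1) := by
  rw [hR₀.mem_siteFinset hl] at hk hku
  obtain ⟨z, hz, hzfr⟩ := segment_inter_frontier_nonempty hk hku
  rw [frontier_eq_closure_inter_closure] at hzfr
  have hzcube := mem_latticeCube_floor ha z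
  refine ⟨fun i => ⌊z i / a⌋, ⟨⟨z, hzcube, hzfr.1⟩, z, hzcube, hzfr.2⟩,
    mem_integerBox.2 fun i => ?_⟩
  rw [segment_eq_image] at hz
  obtain ⟨θ, ⟨hθ0, hθ1⟩, hzθ⟩ := hz
  have hzi : l i * z i = t i + k i + θ * u i := by
    have hli := (hl i).ne'
    simp only [← hzθ, Pi.add_apply, Pi.smul_apply, smul_eq_mul, Int.cast_add]
    field_simp
    ring
  have hui : |(u i : ℝ)| ≤ 1 := by
    rw [← Int.cast_abs, Int.abs_eq_natAbs]
    exact_mod_cast supNorm_le_iff.1 hu i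
  have hstep : |θ * u i| ≤ 1 := by
    rw [abs_mul, abs_of_nonneg hθ0]
    exact mul_le_one₀ hθ1 (abs_nonneg _) hui
  have hlower := mul_le_mul_of_nonneg_left (hzcube i).1 (hl i).le
  have hupper := mul_le_mul_of_nonneg_left (hzcube i).2 (hl i).le
  rw [abs_le] at hstep
  constructor <;> linarith [hK i]

lemma card_filter_add_notMem_le_boundaryCubeCount (hR₀ : IsTemplate R₀) (hl : ∀ i, 0 < l i)
    (t : Fin d → ℝ) (ha : 0 < a) (hK : ∀ i, l i * a ≤ K) {u : Fin d → ℤ} (hu : supNorm u ≤ 1) :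
    (((siteFinset t (scaleSet l R₀)).filter fun k =>
      k + u ∉ siteFinset t (scaleSet l R₀)).card : ℝ) ≤ (K + 3) ^ d * boundaryCubeCount R₀ a := by
  have hfin := hR₀.finite_boundaryCubes ha
  have hsub : ((siteFinset t (scaleSet l R₀)).filter fun k =>
      k + u ∉ siteFinset t (scaleSet l R₀)) ⊆ hfin.toFinset.biUnion fun κ =>
        integerBox (fun i => l i * a * κ i - t i - 1) fun i => l i * a * κ i - t i + (K + 1) := by
    intro k hk
    obtain ⟨hkS, hku⟩ := Finset.mem_filter.1 hk
    obtain ⟨κ, hκ, hkκ⟩ := hR₀.exists_boundaryCube_of_add_notMem hl ha hK hu hkS hku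
    exact Finset.mem_biUnion.2 ⟨κ, hfin.mem_toFinset.2 hκ, hkκ⟩
  have hbox (κ : Fin d → ℤ) : ((integerBox (fun i => l i * a * κ i - t i - 1)
      fun i => l i * a * κ i - t i + (K + 1)).card : ℝ) ≤ (K + 3) ^ d := by
    have hK0 (i : Fin d) : 0 < K := (mul_pos (hl i) ha).trans_le (hK i)
    refine (card_integerBox_le fun i => by linarith [hK0 i]).trans_eq ?_
    ring_nf
    simp [Finset.prod_const]
  have hcard : boundaryCubeCount R₀ a = hfin.toFinset.card :=
    Set.ncard_eq_toFinset_card _ hfin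
  grw [hsub, Finset.card_biUnion_le]
  push_cast
  refine (Finset.sum_le_sum fun κ _ => hbox κ).trans_eq ?_
  rw [Finset.sum_const, nsmul_eq_mul, hcard, mul_comm]

end IsTemplate

end Boundary

/-! ### Sequences of scalings -/

/-- All entries of a sequence of vectors are of the same order. -/
def HasComparableEntries {d : ℕ} (l : ℕ → Fin d → ℝ) : Prop :=
  ∃ K : ℝ, 0 < K ∧ ∀ᶠ n in atTop, ∀ i j, l n i ≤ K * l n j

section Comparable

variable {d : ℕ}

lemma AssumptionA1.hasComparableEntries [NeZero d] {slam : ℕ → Fin d → ℝ}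
    (h : AssumptionA1 slam) (hpos : ∀ n i, 0 < slam n i) : HasComparableEntries slam := by
  obtain ⟨l₀, hprod, hlim⟩ := h
  have hl₀ (i : Fin d) : l₀ i ≠ 0 := Finset.prod_ne_zero_iff.1 hprod.ne' i (Finset.mem_univ i)
  have hratio (i j : Fin d) : Tendsto (fun n => slam n i / slam n j) atTop (𝓝 (l₀ i / l₀ j)) :=
    ((hlim i).div (hlim j) (hl₀ j)).congr fun n =>
      mul_div_mul_left _ _ (one_div_ne_zero (hpos n 0).ne')
  obtain ⟨K, hK⟩ := (Set.finite_range fun q : Fin d × Fin d => l₀ q.1 / l₀ q.2).bddAbove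
  refine ⟨max K 0 + 1, by positivity, eventually_all.2 fun i => eventually_all.2 fun j => ?_⟩
  have hlt : l₀ i / l₀ j < max K 0 + 1 :=
    ((hK ⟨(i, j), rfl⟩).trans (le_max_left _ _)).trans_lt (lt_add_one _)
  filter_upwards [(hratio i j).eventually_le_const hlt] with n hn
  exact (div_le_iff₀ (hpos n j)).1 hn

lemma AssumptionA2.hasComparableEntries {lam slam : ℕ → Fin d → ℝ}
    (h : AssumptionA2 lam slam) (hpos : ∀ n i, 0 < lam n i) : HasComparableEntries lam := by
  obtain ⟨K, hK, hbound⟩ := h.2.exists_pos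
  refine ⟨K, hK, hbound.bound.mono fun n hn i j => ?_⟩
  rw [Real.norm_of_nonneg (Real.iInf_nonneg fun i => (hpos n i).le)] at hn
  calc lam n i ≤ ⨆ i, lam n i := le_ciSup (Set.finite_range _).bddAbove i
    _ ≤ K * ⨅ i, lam n i := (le_abs_self _).trans hn
    _ ≤ K * lam n j :=
        mul_le_mul_of_nonneg_left (ciInf_le (Set.finite_range _).bddBelow j) hK.le

lemma div_pow_card_le_prod {ι : Type*} [Fintype ι] {l : ι → ℝ} {x K : ℝ} (hx : 0 ≤ x) (hK : 0 < K)
    (h : ∀ i, x ≤ K * l i) : (x / K) ^ Fintype.card ι ≤ ∏ i, l i := by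
  rw [← Finset.card_univ, ← Finset.prod_const]
  exact Finset.prod_le_prod (fun _ _ => by positivity) fun i _ => (div_le_iff₀' hK).2 (h i)

end Comparable

section Template

variable {d : ℕ} [NeZero d] {R₀ : Set (Fin d → ℝ)} {l : ℕ → Fin d → ℝ}

lemma IsTemplate.exists_mul_pow_le_card_siteFinset (hR₀ : IsTemplate R₀)
    (htend : ∀ i, Tendsto (fun n => l n i) atTop atTop) (hcomp : HasComparableEntries l) :
    ∃ c : ℝ, 0 < c ∧ ∀ᶠ n in atTop, ∀ t : Fin d → ℝ,
      c * l n 0 ^ d ≤ (siteFinset t (scaleSet (l n) R₀)).card := by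
  obtain ⟨c, Λ, hc, hΛ, hcard⟩ := hR₀.exists_card_siteFinset_bounds
  obtain ⟨K, hK, hcomp⟩ := hcomp
  refine ⟨c / K ^ d, by positivity, ?_⟩
  filter_upwards [hcomp, eventually_all.2 fun i => (htend i).eventually_ge_atTop Λ]
    with n hKn hΛn t
  have hprod : (l n 0 / K) ^ d ≤ ∏ i, l n i := by
    simpa only [Fintype.card_fin] using
      div_pow_card_le_prod ((zero_le_one.trans hΛ).trans (hΛn 0)) hK (hKn 0)
  calc c / K ^ d * l n 0 ^ d = c * (l n 0 / K) ^ d := by rw [div_pow]; ring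
    _ ≤ c * ∏ i, l n i := mul_le_mul_of_nonneg_left hprod hc.le
    _ ≤ (siteFinset t (scaleSet (l n) R₀)).card := (hcard (l n) hΛn t).1

lemma IsTemplate.exists_card_filter_add_notMem_le (hR₀ : IsTemplate R₀) (hpos : ∀ n i, 0 < l n i)
    (htend : ∀ i, Tendsto (fun n => l n i) atTop atTop) (hcomp : HasComparableEntries l) :
    ∃ b : ℝ, 0 ≤ b ∧ ∀ᶠ n in atTop, ∀ (t : Fin d → ℝ) (v : Fin d → ℤ),
      (((siteFinset t (scaleSet (l n) R₀)).filter fun k =>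
        k + v ∉ siteFinset t (scaleSet (l n) R₀)).card : ℝ) ≤
        b * (l n 0 ^ d / l n 0) * supNorm v := by
  obtain ⟨K, hK, hcomp⟩ := hcomp
  obtain ⟨b, hb, hbound⟩ := (hR₀.boundary (fun n => (l n 0)⁻¹) (fun n => inv_pos.2 (hpos n 0))
    (tendsto_inv_atTop_zero.comp (htend 0))).exists_nonneg
  refine ⟨(K + 3) ^ d * b, by positivity, ?_⟩
  filter_upwards [hcomp, hbound.bound] with n hKn hbn t v
  have hL := hpos n 0
  have hcubes : (boundaryCubeCount R₀ (l n 0)⁻¹ : ℝ) ≤ b * (l n 0 ^ d / l n 0) := by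
    rwa [Real.norm_natCast, inv_inv, Real.norm_of_nonneg (Real.rpow_nonneg hL.le _),
      Real.rpow_sub_one hL.ne', Real.rpow_natCast] at hbn
  refine card_filter_add_notMem_le_mul (fun u hu => ?_) le_rfl
  refine (hR₀.card_filter_add_notMem_le_boundaryCubeCount (hpos n) t (inv_pos.2 hL)
    (fun i => (mul_inv_le_iff₀ hL).2 (hKn i 0)) hu).trans ?_
  rw [mul_assoc]
  exact mul_le_mul_of_nonneg_left hcubes (by positivity)

end Template

namespace IsAsymptoticallyLinear

variable {d : ℕ} [NeZero d] {Ω : Type*} [MeasurableSpace Ω] {P : Measure Ω}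
  [IsProbabilityMeasure P] {θ : Finset (Fin d → ℤ) → Ω → ℝ} {h₀ : ℝ} {Y : (Fin d → ℤ) → Ω → ℝ}
  {σ : (Fin d → ℤ) → ℝ} {B C γ : ℝ}

lemma abs_card_mul_variance_sub_le_div (h : IsAsymptoticallyLinear P θ h₀ Y σ B C γ)
    (hγ : 1 ≤ γ * d) {S : Finset (Fin d → ℤ)} {L c b : ℝ} (hL : 1 ≤ L) (hc : 0 < c)
    (hcard : c * L ^ d ≤ S.card) (hb0 : 0 ≤ b)
    (hb : ∀ v, ((S.filter fun k => k + v ∉ S).card : ℝ) ≤ b * (L ^ d / L) * supNorm v) :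
    |S.card * variance (θ S) P - ∑' k, σ k| ≤
      (c⁻¹ * (b * B) + 2 * (C * c ^ (-γ)) + C * c⁻¹) / L := by
  have hB := h.bound_nonneg
  have hC := h.const_nonneg
  have hL0 : 0 < L := zero_lt_one.trans_le hL
  have hcL : 0 < c * L ^ d := by positivity
  have hS : S.Nonempty := Finset.card_pos.1 (mod_cast hcL.trans_le hcard)
  have hγ0 : 0 < γ := pos_of_mul_pos_left (zero_lt_one.trans_le hγ) (Nat.cast_nonneg d)
  have hinv : (S.card : ℝ)⁻¹ ≤ c⁻¹ * (L ^ d)⁻¹ := by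
    rw [← mul_inv]
    exact inv_anti₀ hcL hcard
  have hinvL : (S.card : ℝ)⁻¹ ≤ c⁻¹ * L⁻¹ := hinv.trans <| mul_le_mul_of_nonneg_left
    (inv_anti₀ hL0 (le_self_pow₀ hL (NeZero.ne d))) (by positivity)
  have hrpow : (S.card : ℝ) ^ (-γ) ≤ c ^ (-γ) * L⁻¹ := by
    calc (S.card : ℝ) ^ (-γ) ≤ (c * L ^ d) ^ (-γ) :=
          Real.rpow_le_rpow_of_nonpos hcL hcard (neg_nonpos.2 hγ0.le)
      _ = c ^ (-γ) * L ^ (-(γ * d)) := by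
          rw [Real.mul_rpow hc.le (by positivity), ← Real.rpow_natCast L d,
            ← Real.rpow_mul hL0.le, mul_neg, mul_comm γ]
      _ ≤ c ^ (-γ) * L ^ (-1 : ℝ) := by gcongr
      _ = c ^ (-γ) * L⁻¹ := by rw [Real.rpow_neg_one]
  calc |S.card * variance (θ S) P - ∑' k, σ k|
      ≤ (S.card : ℝ)⁻¹ * (b * (L ^ d / L) * B) + 2 * (C * (S.card : ℝ) ^ (-γ)) +
        C * (S.card : ℝ)⁻¹ := h.abs_card_mul_variance_sub_le hS (by positivity) hb
    _ ≤ c⁻¹ * (L ^ d)⁻¹ * (b * (L ^ d / L) * B) + 2 * (C * (c ^ (-γ) * L⁻¹)) +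
        C * (c⁻¹ * L⁻¹) := by gcongr
    _ = (c⁻¹ * (b * B) + 2 * (C * c ^ (-γ)) + C * c⁻¹) / L := by field_simp

/-- The constant is uniform in the position `t` of the lattice, so that the bound applies to all
translates of a subsampling region at once. -/
theorem exists_abs_card_mul_variance_sub_le (h : IsAsymptoticallyLinear P θ h₀ Y σ B C γ)
    (hγ : 1 ≤ γ * d) {R₀ : Set (Fin d → ℝ)} (hR₀ : IsTemplate R₀) {l : ℕ → Fin d → ℝ}
    (hpos : ∀ n i, 0 < l n i) (htend : ∀ i, Tendsto (fun n => l n i) atTop atTop)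
    (hcomp : HasComparableEntries l) :
    ∃ D : ℝ, ∀ᶠ n in atTop, ∀ t : Fin d → ℝ,
      |(siteFinset t (scaleSet (l n) R₀)).card *
        variance (θ (siteFinset t (scaleSet (l n) R₀))) P - ∑' k, σ k| ≤ D / l n 0 := by
  obtain ⟨c, hc, hcard⟩ := hR₀.exists_mul_pow_le_card_siteFinset htend hcomp
  obtain ⟨b, hb, hleave⟩ := hR₀.exists_card_filter_add_notMem_le hpos htend hcomp
  refine ⟨c⁻¹ * (b * B) + 2 * (C * c ^ (-γ)) + C * c⁻¹, ?_⟩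
  filter_upwards [hcard, hleave, (htend 0).eventually_ge_atTop 1] with n hcardn hleaven hLn t
  exact h.abs_card_mul_variance_sub_le_div hγ hLn hc (hcardn t) hb (hleaven t)

end IsAsymptoticallyLinear

/-! ### The two families of subsampling regions -/

namespace IsTemplate

variable {d : ℕ} {R₀ : Set (Fin d → ℝ)} {l s : Fin d → ℝ} {ε : ℝ}

lemma finite_JOL (hR₀ : IsTemplate R₀) (hl : ∀ i, 0 < l i) (s : Fin d → ℝ) :
    (JOL R₀ l s).Finite := by
  refine (hR₀.finite_sites hl 0).subset fun i hi => hi ⟨0, ?_, ?_⟩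
  · exact ⟨0, mem_of_mem_nhds hR₀.nhds_origin, funext fun _ => mul_zero _⟩
  · exact funext fun _ => add_comm _ _

lemma finite_JNOL (hR₀ : IsTemplate R₀) (hl : ∀ i, 0 < l i) (hs : ∀ i, 0 < s i) :
    (JNOL R₀ l s).Finite := by
  refine (Finset.finite_toSet (integerBox (fun i => -(l i / 2) / s i)
    fun i => l i / 2 / s i)).subset fun i hi => mem_integerBox.2 fun j => ?_
  have hcenter : (fun j => s j * (i j : ℝ)) ∈ scaleSet s (shiftSet i (unitCube d)) :=
    ⟨fun j => i j, ⟨0, fun _ => by norm_num, funext fun _ => add_zero _⟩, rfl⟩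
  have habs := hR₀.abs_apply_le ((mem_scaleSet hl).1 (hi hcenter)) j
  rw [abs_div, abs_of_pos (hl j), div_le_iff₀ (hl j), abs_le] at habs
  rw [div_le_iff₀ (hs j), le_div_iff₀ (hs j)]
  constructor <;> linarith

lemma pow_mul_prod_le_card_JOL (hR₀ : IsTemplate R₀) (hbox : {x | ∀ i, |x i| ≤ ε} ⊆ R₀)
    (hl : ∀ i, 0 < l i) (hs : ∀ i, 0 < s i) (hεl : ∀ i, 1 ≤ ε / 2 * l i)
    (hsl : ∀ i, s i ≤ ε / 2 * l i) :
    (ε / 2) ^ d * ∏ i, l i ≤ (toFinsetOrEmpty (JOL R₀ l s)).card := by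
  refine pow_mul_prod_le_card (t := 0) hεl fun i hi => ?_
  rw [mem_toFinsetOrEmpty (hR₀.finite_JOL hl s)]
  rintro _ ⟨_, ⟨x, hx, rfl⟩, rfl⟩
  refine (mem_scaleSet hl).2 (hbox fun j => ?_)
  have hcenter := hi j
  rw [Pi.zero_apply, zero_add] at hcenter
  rw [abs_div, abs_of_pos (hl j), div_le_iff₀ (hl j)]
  calc |(i j : ℝ) + s j * x j| ≤ |(i j : ℝ)| + s j * |x j| := by
        rw [← abs_of_pos (hs j), ← abs_mul, abs_of_pos (hs j)]
        exact abs_add_le _ _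
    _ ≤ ε / 2 * l j + s j * (1 / 2) :=
        add_le_add hcenter (mul_le_mul_of_nonneg_left (hR₀.abs_apply_le hx j) (hs j).le)
    _ ≤ ε * l j := by linarith [hsl j, hs j]

lemma pow_mul_prod_div_le_card_JNOL (hR₀ : IsTemplate R₀) (hbox : {x | ∀ i, |x i| ≤ ε} ⊆ R₀)
    (hl : ∀ i, 0 < l i) (hs : ∀ i, 0 < s i) (hsl : ∀ i, s i ≤ ε / 2 * l i) :
    (ε / 2) ^ d * ∏ i, l i / s i ≤ (toFinsetOrEmpty (JNOL R₀ l s)).card := by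
  have hεl (i : Fin d) : 1 ≤ ε / 2 * (l i / s i) := by
    rw [← mul_div_assoc, one_le_div₀ (hs i)]
    exact hsl i
  refine pow_mul_prod_le_card (t := 0) hεl fun i hi => ?_
  rw [mem_toFinsetOrEmpty (hR₀.finite_JNOL hl hs)]
  rintro _ ⟨_, ⟨x, hx, rfl⟩, rfl⟩
  refine (mem_scaleSet hl).2 (hbox fun j => ?_)
  have hcenter := hi j
  rw [Pi.zero_apply, zero_add] at hcenter
  have hx_abs : |x j| ≤ 1 / 2 := abs_le.2 ⟨(hx j).1.le, (hx j).2⟩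
  rw [mul_div_right_comm, abs_mul, abs_of_pos (div_pos (hs j) (hl j)),
    ← le_div_iff₀' (div_pos (hs j) (hl j)), div_div_eq_mul_div, mul_div_assoc]
  linarith [abs_add_le (i j : ℝ) (x j), hεl j]

end IsTemplate

section Multiplicity

variable {d : ℕ} {R₀ : Set (Fin d → ℝ)} {s : Fin d → ℝ}

lemma card_filter_mem_siteFinset_shiftSet_le (t : Fin d → ℝ) (A : Set (Fin d → ℝ))
    (J : Finset (Fin d → ℤ)) (k : Fin d → ℤ) :
    (J.filter fun i => k ∈ siteFinset t (shiftSet i A)).card ≤ (siteFinset t A).card :=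
  Finset.card_le_card_of_injOn (fun i => k - i)
    (fun _ hi => mem_siteFinset_shiftSet.1 (Finset.mem_filter.1 hi).2)
    sub_right_injective.injOn

lemma eq_of_sub_mem_unitCube {x : Fin d → ℝ} {i j : Fin d → ℤ}
    (hi : (fun m => x m - i m) ∈ unitCube d) (hj : (fun m => x m - j m) ∈ unitCube d) : i = j := by
  funext m
  have hij : (i m : ℝ) < j m + 1 := by linarith [(hi m).1, (hj m).2]
  have hji : (j m : ℝ) < i m + 1 := by linarith [(hi m).2, (hj m).1]
  exact le_antisymm (Int.lt_add_one_iff.1 (mod_cast hij)) (Int.lt_add_one_iff.1 (mod_cast hji))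

lemma IsTemplate.card_filter_mem_siteFinset_scaleSet_shiftSet_le (hR₀ : IsTemplate R₀)
    (hs : ∀ i, 0 < s i) (t : Fin d → ℝ) (J : Finset (Fin d → ℤ)) (k : Fin d → ℤ) :
    (J.filter fun i => k ∈ siteFinset t (scaleSet s (shiftSet i R₀))).card ≤ 1 := by
  have hcube (i : Fin d → ℤ)
      (hi : i ∈ J.filter fun i => k ∈ siteFinset t (scaleSet s (shiftSet i R₀))) :
      (fun m => (t m + k m) / s m - i m) ∈ unitCube d := by
    have hmem := (Finset.mem_filter.1 hi).2
    rw [siteFinset_scaleSet_shiftSet hs, hR₀.mem_siteFinset hs] at hmem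
    convert hR₀.subset_unitCube hmem using 2 with m
    rw [sub_add_eq_add_sub, sub_div, mul_div_cancel_left₀ _ (hs m).ne']
  exact Finset.card_le_one.2 fun i hi j hj => eq_of_sub_mem_unitCube (hcube i hi) (hcube j hj)

end Multiplicity

/-- A family of blocks for each `n`: the blocks are the sets of sites in translates of `ₛΔ_n R₀`,
and the number of blocks containing a given site, relative to the number of all blocks, is at most
of the order of the volume ratio `det ₛΔ_n / det Δ_n`. -/
structure IsSubsamplingScheme {d : ℕ} {ι : Type*} (R₀ : Set (Fin d → ℝ))
    (lam slam : ℕ → Fin d → ℝ) (J : ℕ → Finset ι) (S : ℕ → ι → Finset (Fin d → ℤ)) : Prop where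
  exists_eq_siteFinset : ∀ n i, ∃ t, S n i = siteFinset t (scaleSet (slam n) R₀)
  exists_multiplicity_le : ∃ Q : ℝ, ∀ᶠ n in atTop, (J n).Nonempty ∧ ∃ M : ℝ,
    (∀ k, (((J n).filter fun i => k ∈ S n i).card : ℝ) ≤ M) ∧
      M / (J n).card ≤ Q * ((∏ i, slam n i) / ∏ i, lam n i)

namespace IsTemplate

variable {d : ℕ} {R₀ : Set (Fin d → ℝ)} {lam slam : ℕ → Fin d → ℝ}

lemma exists_eventually_mul_prod_le_card (hR₀ : IsTemplate R₀) (hscale : IsScaling lam slam) :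
    ∃ c : ℝ, 0 < c ∧ ∀ᶠ n in atTop,
      c * ∏ i, lam n i ≤ (toFinsetOrEmpty (JOL R₀ (lam n) (slam n))).card ∧
      c * ∏ i, lam n i / slam n i ≤ (toFinsetOrEmpty (JNOL R₀ (lam n) (slam n))).card := by
  obtain ⟨ε, hε, hbox⟩ := hR₀.exists_box_subset
  refine ⟨(ε / 2) ^ d, by positivity, ?_⟩
  filter_upwards [eventually_all.2 fun i => (hscale.lam_tendsto i).eventually_ge_atTop (ε / 2)⁻¹,
    eventually_all.2 fun i => (hscale.ratio_tendsto i).eventually_le_const (half_pos hε)]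
    with n hlam hratio
  have hl := hscale.lam_pos n
  have hs := hscale.slam_pos n
  have hεl (i : Fin d) : 1 ≤ ε / 2 * lam n i := (inv_le_iff_one_le_mul₀' (half_pos hε)).1 (hlam i)
  have hsl (i : Fin d) : slam n i ≤ ε / 2 * lam n i := (div_le_iff₀ (hl i)).1 (hratio i)
  exact ⟨hR₀.pow_mul_prod_le_card_JOL hbox hl hs hεl hsl,
    hR₀.pow_mul_prod_div_le_card_JNOL hbox hl hs hsl⟩

lemma isSubsamplingScheme_JOL (hR₀ : IsTemplate R₀) (hscale : IsScaling lam slam)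
    (t : Fin d → ℝ) :
    IsSubsamplingScheme R₀ lam slam (fun n => toFinsetOrEmpty (JOL R₀ (lam n) (slam n)))
      fun n i => siteFinset t (shiftSet i (scaleSet (slam n) R₀)) := by
  obtain ⟨c, hc, hJ⟩ := hR₀.exists_eventually_mul_prod_le_card hscale
  refine ⟨fun n i => ⟨_, siteFinset_shiftSet t i _⟩, 2 ^ d / c, ?_⟩
  filter_upwards [hJ, eventually_all.2 fun i => (hscale.slam_tendsto i).eventually_ge_atTop 1]
    with n hJn hn
  have hV : 0 < ∏ i, slam n i := Finset.prod_pos fun i _ => hscale.slam_pos n i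
  have hpos : 0 < c * ∏ i, lam n i := mul_pos hc (Finset.prod_pos fun i _ => hscale.lam_pos n i)
  refine ⟨Finset.card_pos.1 (mod_cast hpos.trans_le hJn.1), 2 ^ d * ∏ i, slam n i, fun k => ?_, ?_⟩
  · exact (Nat.cast_le.2 (card_filter_mem_siteFinset_shiftSet_le t _ _ k)).trans
      (hR₀.card_siteFinset_le hn t)
  · rw [← mul_div_mul_comm]
    exact div_le_div_of_nonneg_left (by positivity) hpos hJn.1

lemma isSubsamplingScheme_JNOL (hR₀ : IsTemplate R₀) (hscale : IsScaling lam slam)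
    (t : Fin d → ℝ) :
    IsSubsamplingScheme R₀ lam slam (fun n => toFinsetOrEmpty (JNOL R₀ (lam n) (slam n)))
      fun n i => siteFinset t (scaleSet (slam n) (shiftSet i R₀)) := by
  obtain ⟨c, hc, hJ⟩ := hR₀.exists_eventually_mul_prod_le_card hscale
  refine ⟨fun n i => ⟨_, siteFinset_scaleSet_shiftSet (hscale.slam_pos n) t i _⟩, 1 / c,
    hJ.mono fun n hJn => ?_⟩
  have hpos : 0 < c * ∏ i, lam n i / slam n i :=
    mul_pos hc (Finset.prod_pos fun i _ => div_pos (hscale.lam_pos n i) (hscale.slam_pos n i))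
  refine ⟨Finset.card_pos.1 (mod_cast hpos.trans_le hJn.2), 1, fun k => ?_, ?_⟩
  · exact mod_cast
      hR₀.card_filter_mem_siteFinset_scaleSet_shiftSet_le (hscale.slam_pos n) t _ k
  · calc _ ≤ 1 / (c * ∏ i, lam n i / slam n i) :=
          div_le_div_of_nonneg_left zero_le_one hpos hJn.2
      _ = 1 / c * ((∏ i, slam n i) / ∏ i, lam n i) := by
          rw [Finset.prod_div_distrib, one_div_mul_eq_div, one_div, mul_inv, inv_div,
            inv_mul_eq_div]

end IsTemplate

/-! ### The expected subsample variance -/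

section Volume

variable {d : ℕ} {lam slam : ℕ → Fin d → ℝ}

lemma HasComparableEntries.isBigO_inv_prod [NeZero d] (hcomp : HasComparableEntries slam)
    (htend : ∀ i, Tendsto (fun n => slam n i) atTop atTop) :
    (fun n => (∏ i, slam n i)⁻¹) =O[atTop] fun n => 1 / slam n 0 := by
  obtain ⟨K, hK, hcomp⟩ := hcomp
  refine IsBigO.of_bound (K ^ d) ?_
  filter_upwards [hcomp, (htend 0).eventually_ge_atTop 1] with n hKn hL
  have hL0 : 0 < slam n 0 := zero_lt_one.trans_le hL
  have hprod : (slam n 0 / K) ^ d ≤ ∏ i, slam n i := by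
    simpa only [Fintype.card_fin] using div_pow_card_le_prod hL0.le hK (hKn 0)
  have hpow : 0 < (slam n 0 / K) ^ d := by positivity
  rw [Real.norm_of_nonneg (inv_nonneg.2 (hpow.le.trans hprod)),
    Real.norm_of_nonneg (by positivity)]
  calc (∏ i, slam n i)⁻¹ ≤ ((slam n 0 / K) ^ d)⁻¹ := inv_anti₀ hpow hprod
    _ = K ^ d * (1 / slam n 0 ^ d) := by rw [← inv_pow, inv_div, div_pow, mul_one_div]
    _ ≤ K ^ d * (1 / slam n 0) := by
        gcongr
        exact le_self_pow₀ hL (NeZero.ne d)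

lemma AssumptionA2.eventually_prod_rpow_le_prod (hA2 : AssumptionA2 lam slam)
    (hscale : IsScaling lam slam) :
    ∀ᶠ n in atTop, (∏ i, slam n i) ^ (((d : ℝ) + 1) / d) ≤ ∏ i, lam n i := by
  filter_upwards [hA2.1.eventually_le_const zero_lt_one] with n hn
  have hs := hscale.slam_pos n
  have hl := hscale.lam_pos n
  have hinv : 0 ≤ ∑ i, 1 / slam n i := Finset.sum_nonneg fun i _ => (one_div_pos.2 (hs i)).le
  have hratio : 0 ≤ ∑ i, slam n i / lam n i :=
    Finset.sum_nonneg fun i _ => (div_pos (hs i) (hl i)).le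
  exact (div_le_one (Finset.prod_pos fun i _ => hl i)).1 (by linarith)

/-- The exponent `(d + 1) / d` in the growth condition leaves a factor `(det ₛΔ_n)^(1/d)`, which is
of the order of a single scaling factor. -/
lemma AssumptionA2.isBigO_prod_div_prod [NeZero d] (hA2 : AssumptionA2 lam slam)
    (hscale : IsScaling lam slam) (hcomp : HasComparableEntries slam) :
    (fun n => (∏ i, slam n i) / ∏ i, lam n i) =O[atTop] fun n => 1 / slam n 0 := by
  obtain ⟨K, hK, hcomp⟩ := hcomp
  refine IsBigO.of_bound K ?_
  filter_upwards [hcomp, hA2.eventually_prod_rpow_le_prod hscale] with n hKn hn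
  have hL := hscale.slam_pos n 0
  have hV : 0 < ∏ i, slam n i := Finset.prod_pos fun i _ => hscale.slam_pos n i
  have hW : 0 < ∏ i, lam n i := Finset.prod_pos fun i _ => hscale.lam_pos n i
  have hd : (d : ℝ) ≠ 0 := Nat.cast_ne_zero.2 (NeZero.ne d)
  have hroot : slam n 0 / K ≤ (∏ i, slam n i) ^ (d : ℝ)⁻¹ := by
    rw [Real.le_rpow_inv_iff_of_pos (by positivity) hV.le (by positivity), Real.rpow_natCast]
    simpa only [Fintype.card_fin] using div_pow_card_le_prod hL.le hK (hKn 0)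
  rw [add_div, div_self hd, Real.rpow_add hV, Real.rpow_one, one_div] at hn
  rw [Real.norm_of_nonneg (by positivity), Real.norm_of_nonneg (by positivity), mul_one_div,
    div_le_div_iff₀ hW hL]
  calc (∏ i, slam n i) * slam n 0 = K * ((∏ i, slam n i) * (slam n 0 / K)) := by field_simp
    _ ≤ K * ∏ i, lam n i := by
        gcongr
        exact (mul_le_mul_of_nonneg_left hroot hV.le).trans hn

end Volume

section Estimators

variable {d p : ℕ} {Ω : Type*} (t : Fin d → ℝ) (Z : (Fin d → ℤ) → Ω → EuclideanSpace ℝ (Fin p))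
  (H : EuclideanSpace ℝ (Fin p) → ℝ) (R₀ : Set (Fin d → ℝ)) (l s : Fin d → ℝ)

lemma tauHatOL_eq_blockVariance : tauHatOL t Z H R₀ l s =
    blockVariance (fun S ω => H (siteMean Z S ω)) (toFinsetOrEmpty (JOL R₀ l s))
      fun i => siteFinset t (shiftSet i (scaleSet s R₀)) := by
  funext ω
  simp only [tauHatOL, blockVariance, finAverage_eq, thetaHat_eq_siteMean, siteCount_eq_card,
    smul_eq_mul, card_siteFinset_shiftSet]

lemma tauHatNOL_eq_blockVariance : tauHatNOL t Z H R₀ l s =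
    blockVariance (fun S ω => H (siteMean Z S ω)) (toFinsetOrEmpty (JNOL R₀ l s))
      fun i => siteFinset t (scaleSet s (shiftSet i R₀)) := by
  funext ω
  simp only [tauHatNOL, blockVariance, finAverage_eq, thetaHat_eq_siteMean, siteCount_eq_card,
    smul_eq_mul]

lemma tauSqN_eq_card_mul_variance [MeasurableSpace Ω] (P : Measure Ω) : tauSqN t Z H R₀ P l =
    (siteFinset t (scaleSet l R₀)).card *
      variance (fun ω => H (siteMean Z (siteFinset t (scaleSet l R₀)) ω)) P := by
  rw [tauSqN, siteCount_eq_card, thetaHat_eq_siteMean]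

end Estimators

namespace IsAsymptoticallyLinear

variable {d : ℕ} [NeZero d] {Ω : Type*} [MeasurableSpace Ω] {P : Measure Ω}
  [IsProbabilityMeasure P] {θ : Finset (Fin d → ℤ) → Ω → ℝ} {h₀ : ℝ} {Y : (Fin d → ℤ) → Ω → ℝ}
  {σ : (Fin d → ℤ) → ℝ} {B C γ : ℝ} {R₀ : Set (Fin d → ℝ)} {lam slam : ℕ → Fin d → ℝ}
  {ι : Type*} {J : ℕ → Finset ι} {S : ℕ → ι → Finset (Fin d → ℤ)}

lemma isBigO_card_mul_variance_sub (h : IsAsymptoticallyLinear P θ h₀ Y σ B C γ)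
    (hγ : 1 ≤ γ * d) (hR₀ : IsTemplate R₀) (hscale : IsScaling lam slam)
    (hA2 : AssumptionA2 lam slam) (t : Fin d → ℝ) :
    (fun n => (siteFinset t (scaleSet (lam n) R₀)).card *
      variance (θ (siteFinset t (scaleSet (lam n) R₀))) P - ∑' k, σ k)
      =O[atTop] fun n => 1 / slam n 0 := by
  obtain ⟨D, hD⟩ := h.exists_abs_card_mul_variance_sub_le hγ hR₀ hscale.lam_pos
    hscale.lam_tendsto (hA2.hasComparableEntries hscale.lam_pos)
  refine IsBigO.of_bound |D| ?_
  filter_upwards [hD, (hscale.ratio_tendsto 0).eventually_le_const zero_lt_one] with n hn hratio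
  have hl := hscale.lam_pos n 0
  have hs := hscale.slam_pos n 0
  rw [Real.norm_eq_abs, Real.norm_of_nonneg (by positivity), mul_one_div]
  calc _ ≤ D / lam n 0 := hn t
    _ ≤ |D| / slam n 0 :=
        div_le_div₀ (abs_nonneg D) (le_abs_self D) hs ((div_le_one hl).1 hratio)

lemma isBigO_integral_blockVariance_sub (h : IsAsymptoticallyLinear P θ h₀ Y σ B C γ)
    (hγ : 1 ≤ γ * d) (hR₀ : IsTemplate R₀) (hscale : IsScaling lam slam)
    (hA1 : AssumptionA1 slam) (hA2 : AssumptionA2 lam slam)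
    (hS : IsSubsamplingScheme R₀ lam slam J S) :
    (fun n => (∫ ω, blockVariance θ (J n) (S n) ω ∂P) - ∑' k, σ k)
      =O[atTop] fun n => 1 / slam n 0 := by
  have hcomp := hA1.hasComparableEntries hscale.slam_pos
  obtain ⟨D, hD⟩ := h.exists_abs_card_mul_variance_sub_le hγ hR₀ hscale.slam_pos
    hscale.slam_tendsto hcomp
  obtain ⟨c, Λ, hc, -, hcard⟩ := hR₀.exists_card_siteFinset_bounds
  obtain ⟨Q, hQ⟩ := hS.exists_multiplicity_le
  set E := C + (4 + 4 * (2 ^ d / c) ^ 2 + 2 * (2 ^ d / c)) * (B + C)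
  have hE : 0 ≤ E := by
    have hB := h.bound_nonneg
    have hC := h.const_nonneg
    positivity
  have hbound : ∀ᶠ n in atTop, ‖(∫ ω, blockVariance θ (J n) (S n) ω ∂P) - ∑' k, σ k‖ ≤
      D * (1 / slam n 0) + E * (c⁻¹ * (∏ i, slam n i)⁻¹ +
        Q * ((∏ i, slam n i) / ∏ i, lam n i)) := by
    filter_upwards [hD, hQ, eventually_all.2 fun i =>
      (hscale.slam_tendsto i).eventually_ge_atTop Λ] with n hDn hQn hΛn
    obtain ⟨hJ, M, hM, hMJ⟩ := hQn
    have hV : 0 < ∏ i, slam n i := Finset.prod_pos fun i _ => hscale.slam_pos n i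
    have hF : IsBlockFamily (J n) (S n) (c * ∏ i, slam n i) (2 ^ d / c) M := by
      refine ⟨hJ, mul_pos hc hV, fun i _ => ?_, fun i _ => ?_, hM⟩ <;>
        obtain ⟨t, ht⟩ := hS.exists_eq_siteFinset n i <;> rw [ht]
      · exact (hcard _ hΛn t).1
      · rw [← mul_assoc, div_mul_cancel₀ _ hc.ne']
        exact (hcard _ hΛn t).2
    have hη (i : ι) : |(S n i).card * variance (θ (S n i)) P - ∑' k, σ k| ≤ D / slam n 0 := by
      obtain ⟨t, ht⟩ := hS.exists_eq_siteFinset n i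
      exact ht ▸ hDn t
    refine (h.abs_integral_blockVariance_sub_le hF fun i _ => hη i).trans ?_
    rw [mul_inv, mul_one_div]
    gcongr
  refine (IsBigO.of_norm_eventuallyLE hbound).trans (IsBigO.add ?_ (IsBigO.const_mul_left ?_ E))
  · exact (isBigO_refl _ _).const_mul_left D
  · exact ((hcomp.isBigO_inv_prod hscale.slam_tendsto).const_mul_left _).add
      ((hA2.isBigO_prod_div_prod hscale hcomp).const_mul_left Q)

/-- Both the expected block variance and the normalized variance over the sampling region are
compared with the common limit `∑' k, σ k`. -/
theorem isBigO_integral_blockVariance_sub_card_mul_variance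
    (h : IsAsymptoticallyLinear P θ h₀ Y σ B C γ) (hγ : 1 ≤ γ * d) (hR₀ : IsTemplate R₀)
    (hscale : IsScaling lam slam) (hA1 : AssumptionA1 slam) (hA2 : AssumptionA2 lam slam)
    (hS : IsSubsamplingScheme R₀ lam slam J S) (t : Fin d → ℝ) :
    (fun n => (∫ ω, blockVariance θ (J n) (S n) ω ∂P) -
      (siteFinset t (scaleSet (lam n) R₀)).card *
        variance (θ (siteFinset t (scaleSet (lam n) R₀))) P) =O[atTop] fun n => 1 / slam n 0 := by
  simpa only [sub_sub_sub_cancel_right] using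
    (h.isBigO_integral_blockVariance_sub hγ hR₀ hscale hA1 hA2 hS).sub
      (h.isBigO_card_mul_variance_sub hγ hR₀ hscale hA2 t)

end IsAsymptoticallyLinear

end SpatialSubsampling

theorem lemma4p1_general {d p : ℕ} [NeZero d] {Ω : Type*} [MeasurableSpace Ω]
    (P : Measure Ω) [IsProbabilityMeasure P] (t : Fin d → ℝ)
    (Z : (Fin d → ℤ) → Ω → EuclideanSpace ℝ (Fin p)) (hZ : ∀ k, Measurable (Z k))
    (hstat : IsStationary P Z) (H : EuclideanSpace ℝ (Fin p) → ℝ)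
    (R₀ : Set (Fin d → ℝ)) (hR₀ : IsTemplate R₀)
    (lam slam : ℕ → Fin d → ℝ) (hscale : IsScaling lam slam) (α₁ g : ℝ → ℝ) (a : ℕ)
    (hA1 : AssumptionA1 slam) (hA2 : AssumptionA2 lam slam) (hA3 : AssumptionA3 P Z α₁ g)
    (hDM : (2 ≤ d ∧ ConditionD H 2 a ∧ ConditionM P Z α₁ g (2 + a)) ∨
      (d = 1 ∧ ConditionD H 3 a ∧ ConditionM P Z α₁ g (3 + a))) :
    (∀ n, MemLp (thetaHat t Z H (scaleSet (lam n) R₀)) 2 P ∧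
      Integrable (tauHatOL t Z H R₀ (lam n) (slam n)) P ∧
      Integrable (tauHatNOL t Z H R₀ (lam n) (slam n)) P) ∧
    (fun n => (∫ ω, tauHatOL t Z H R₀ (lam n) (slam n) ω ∂P) - tauSqN t Z H R₀ P (lam n))
      =O[atTop] (fun n => 1 / slam n 0) ∧
    (fun n => (∫ ω, tauHatNOL t Z H R₀ (lam n) (slam n) ω ∂P) - tauSqN t Z H R₀ P (lam n))
      =O[atTop] (fun n => 1 / slam n 0) := by
  obtain ⟨B, C, γ, hγ, hlin⟩ := exists_isAsymptoticallyLinear hZ hstat hA3 hDM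
  have hmem (S : Finset (Fin d → ℤ)) : MemLp (fun ω => H (siteMean Z S ω)) 2 P := by
    rcases S.eq_empty_or_nonempty with rfl | hS
    · simpa [siteMean] using memLp_const (H 0)
    · exact hlin.memLp_stat hS
  simp only [thetaHat_eq_siteMean, tauHatOL_eq_blockVariance, tauHatNOL_eq_blockVariance,
    tauSqN_eq_card_mul_variance]
  refine ⟨fun n => ⟨hmem _, integrable_blockVariance hmem _ _,
    integrable_blockVariance hmem _ _⟩, ?_, ?_⟩
  · exact hlin.isBigO_integral_blockVariance_sub_card_mul_variance hγ hR₀ hscale hA1 hA2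
      (hR₀.isSubsamplingScheme_JOL hscale t) t
  · exact hlin.isBigO_integral_blockVariance_sub_card_mul_variance hγ hR₀ hscale hA1 hA2
      (hR₀.isSubsamplingScheme_JNOL hscale t) t

theorem lemma4p1 {d p : ℕ} [NeZero d] {Ω : Type*} [MeasurableSpace Ω]
    (P : Measure Ω) [IsProbabilityMeasure P]
    (t : Fin d → ℝ) (ht : ∀ i, -(1 / 2) ≤ t i ∧ t i ≤ 1 / 2)
    (Z : (Fin d → ℤ) → Ω → EuclideanSpace ℝ (Fin p)) (hZ : ∀ k, Measurable (Z k))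
    (hstat : IsStationary P Z)
    (H : EuclideanSpace ℝ (Fin p) → ℝ)
    (R₀ : Set (Fin d → ℝ)) (hR₀ : IsTemplate R₀)
    (lam slam : ℕ → Fin d → ℝ) (hscale : IsScaling lam slam)
    (α₁ g : ℝ → ℝ) (a : ℕ)
    (hA1 : AssumptionA1 slam) (hA2 : AssumptionA2 lam slam) (hA3 : AssumptionA3 P Z α₁ g)
    (hA4 : AssumptionA4 P Z) (hA5 : AssumptionA5 P Z H)
    (hDM : (2 ≤ d ∧ ConditionD H 2 a ∧ ConditionM P Z α₁ g (2 + a)) ∨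
      (d = 1 ∧ ConditionD H 3 a ∧ ConditionM P Z α₁ g (3 + a))) :
    (∀ n, MemLp (thetaHat t Z H (scaleSet (lam n) R₀)) 2 P ∧
      Integrable (tauHatOL t Z H R₀ (lam n) (slam n)) P ∧
      Integrable (tauHatNOL t Z H R₀ (lam n) (slam n)) P) ∧
    (fun n => (∫ ω, tauHatOL t Z H R₀ (lam n) (slam n) ω ∂P) - tauSqN t Z H R₀ P (lam n))
      =O[atTop] (fun n => 1 / slam n 0) ∧
    (fun n => (∫ ω, tauHatNOL t Z H R₀ (lam n) (slam n) ω ∂P) - tauSqN t Z H R₀ P (lam n))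
      =O[atTop] (fun n => 1 / slam n 0) :=
  lemma4p1_general P t Z hZ hstat H R₀ hR₀ lam slam hscale α₁ g a hA1 hA2 hA3 hDM
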